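/- **Setting.** For each sample size $T$ one observes $x_{it}=\chi_{it}+\epsilon_{it}$, $\chi_{it}=\boldsymbol\lambda_i^\top\mathbf f_t$, for $1\le i\le n$, $1\le t\le T$, where $n=n_T$, the number $r$ of factors is fixed and known, $\mathbf f_t=(f_{1t},\dots,f_{rt})^\top$ is random, $\boldsymbol\Lambda=[\boldsymbol\lambda_1,\dots,\boldsymbol\lambda_n]^\top\in\mathbb R^{n\times r}$ is deterministic, $\boldsymbol\epsilon_t=(\epsilon_{1t},\dots,\epsilon_{nt})^\top$, and $\mathsf E\mathbf f_t=0$, $\mathsf E\boldsymbol\epsilon_t=0$. All of these objects, the underlying probability space and the change-points below may depend on $T$; "fixed" and $O(\cdot)$ mean uniform in $T$ (and in $t,i,j$), and the assumptions need to hold for all sufficiently large $T$. There are change-points $0=\eta^\chi_0<\eta^\chi_1<\dots<\eta^\chi_{B_\chi}<\eta^\chi_{B_\chi+1}=T$ and $0=\eta^\epsilon_0<\dots<\eta^\epsilon_{B_\epsilon}<\eta^\epsilon_{B_\epsilon+1}=T$. Write $\beta(t)=\max\{0\le b\le B_\chi:\eta^\chi_b<t\}$, $\gamma(t)=\max\{0\le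 b\le B_\epsilon:\eta^\epsilon_b<t\}$. **Assumptions.** 1. (i) There are centred, square-integrable, weakly stationary processes $(\mathbf f^b_t)_{t\in\mathbb Z}$, $0\le b\le B_\chi$, with $\max_j\mathsf E\{f_{jt}-f^{\beta(t)}_{jt}\}^2=O(\rho_f^{\,t-\eta^\chi_{\beta(t)}})$ for a fixed $\rho_f\in[0,1)$. (ii) There is a fixed $\bar\tau_\chi<\infty$ such that for each $1\le b\le B_\chi$ the autocovariance matrices of $\boldsymbol\Lambda\mathbf f^b_t$ and $\boldsymbol\Lambda\mathbf f^{b-1}_t$ differ at some lag $|\tau|\le\bar\tau_\chi$. (iii) There are centred, square-integrable, weakly stationary processes $(\boldsymbol\epsilon^b_t)_{t\in\mathbb Z}$, $0\le b\le B_\epsilon$, with $\max_i\mathsf E\{\epsilon_{it}-\epsilon^{\gamma(t)}_{it}\}^2=O(\rho_\epsilon^{\,t-\eta^\epsilon_{\gamma(t)}})$ for a fixed $\rho_\epsilon\in[0,1)$. (iv) There is a fixed $\bar\tau_\epsilon<\infty$ such that for each $1\le b\le B_\epsilon$ the autocovariance matrices of $\boldsymbol\epsilon^b_t$ and $\boldsymbol\epsilon^{b-1}_t$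 differ at some lag $|\tau|\le\bar\tau_\epsilon$. 2. (i) $T^{-1}\sum_{t=1}^T\mathsf E(\mathbf f_t\mathbf f_t^\top)=\mathbf I_r$. (ii) There are fixed $c_f,\beta_f\in(0,\infty)$ with $\mathsf P(|f_{jt}|>z)\le\exp\{1-(z/c_f)^{\beta_f}\}$ for all $z>0$, $j$ and $t$. 3. (i) $n^{-1}\boldsymbol\Lambda^\top\boldsymbol\Lambda\to\mathbf H$ as $T\to\infty$, for a fixed positive definite $\mathbf H\in\mathbb R^{r\times r}$ with distinct eigenvalues. (ii) $|\lambda_{ij}|<\bar\lambda$ for all $i,j$, for a fixed $\bar\lambda<\infty$. 4. (i) There is a fixed $C_\epsilon<\infty$ such that $\frac1{e-s+1}\sum_{i,i'=1}^n\sum_{t,t'=s}^e a_ia_{i'}\mathsf E(\epsilon_{it}\epsilon_{i't'})<C_\epsilon$ for all $1\le s\le e\le T$ and all $a_1,\dots,a_n$ with $\sum_ia_i^2=1$. (ii) For each $t$, the vector $\boldsymbol\epsilon_t$ is multivariate normal (possibly degenerate). 5. (i) $\{\mathbf f_t\}_{1\le t\le T}$ and $\{\boldsymbol\epsilon_t\}_{1\le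 t\le T}$ are independent. (ii) With $\mathcal F_s^e=\sigma\{(\mathbf f_t,\boldsymbol\epsilon_t):s\le t\le e\}$ and $\alpha(k)=\max_{1\le t\le T}\sup_{A\in\mathcal F_1^t,\,B\in\mathcal F_{t+k}^T}|\mathsf P(A)\mathsf P(B)-\mathsf P(A\cap B)|$, there are fixed $c_\alpha,\beta\in(0,\infty)$ with $3\beta_f^{-1}+\beta^{-1}>1$ and $\alpha(k)\le\exp(-c_\alpha k^\beta)$ for all integers $k\ge1$. 6. There is a fixed $c_\eta\in(0,1)$ with $|\eta^\chi_{b+1}-\eta^\chi_b|\ge c_\eta T$ for $0\le b\le B_\chi$ and $|\eta^\epsilon_{b+1}-\eta^\epsilon_b|\ge c_\eta T$ for $0\le b\le B_\epsilon$. 7. $n\to\infty$ as $T\to\infty$, and $n=O(T^\kappa)$ for a fixed $\kappa\in(0,\infty)$. **Estimator.** Let $\widehat{\mathbf w}_{x,1},\widehat{\mathbf w}_{x,2},\dots$ be orthonormal eigenvectors of $\widehat{\boldsymbol\Gamma}_x=T^{-1}\sum_{t=1}^T\mathbf x_t\mathbf x_t^\top$, ordered by non-increasing eigenvalue (any choice),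 where $\mathbf x_t=(x_{1t},\dots,x_{nt})^\top$, and let $\widehat\chi_{it}=\sum_{j=1}^r\widehat w_{x,ij}\,\widehat{\mathbf w}_{x,j}^\top\mathbf x_t$, where $\widehat w_{x,ij}$ is the $i$-th entry of $\widehat{\mathbf w}_{x,j}$. **Theorem 1.** Under Assumptions 1–7, for every fixed $\theta\ge1+(\beta_f^{-1}\vee\tfrac12)$, $$\max_{1\le i\le n}\max_{1\le t\le T}|\widehat\chi_{it}-\chi_{it}|=O_p\Big\{\Big(\sqrt{\tfrac{\log n}{T}}\vee\tfrac1{\sqrt n}\Big)\log^\theta T\Big\}\qquad(T\to\infty).$$ Here $Y_T=O_p(a_T)$ means that for every $\delta>0$ there is $M>0$ with $\mathsf P(|Y_T|>Ma_T)\le\delta$ for all sufficiently large $T$. -/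

import Mathlib

open MeasureTheory ProbabilityTheory Filter Topology
open scoped Matrix

noncomputable section

/-- Stochastic boundedness along a sequence of probability spaces: `X_T = O_p(a_T)` as `T → ∞`,
for a positive deterministic sequence `a`. -/
def IsBigOp {Ω : ℕ → Type*} [∀ T, MeasurableSpace (Ω T)] (P : ∀ T, Measure (Ω T))
    (X : ∀ T, Ω T → ℝ) (a : ℕ → ℝ) : Prop :=
  ∀ δ : ℝ, 0 < δ → ∃ M : ℝ, 0 < M ∧
    ∀ᶠ T in atTop, P T {ω | M * a T < |X T ω|} ≤ ENNReal.ofReal δ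

section Model

variable {Ω : Type*} [MeasurableSpace Ω]

/-- A real vector-valued process indexed by `ℤ` is weakly stationary: it is square integrable,
its mean is constant, and its second moments depend on the time lag only. -/
structure IsWeaklyStationary {ι : Type*} (P : Measure Ω) (X : ℤ → ι → Ω → ℝ) : Prop where
  memLp : ∀ t i, MemLp (X t i) 2 P
  mean : ∀ t i, ∫ ω, X t i ω ∂P = ∫ ω, X 0 i ω ∂P
  second : ∀ t τ i j,
    ∫ ω, X (t + τ) i ω * X t j ω ∂P = ∫ ω, X τ i ω * X 0 j ω ∂P

/-- The autocovariance matrix `E (X_{t+τ} X_tᵀ)` at lag `τ` of a centred weakly stationary process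
(by stationarity it does not depend on `t`, which is taken to be `0`). -/
def autocov {ι : Type*} (P : Measure Ω) (X : ℤ → ι → Ω → ℝ) (τ : ℤ) : Matrix ι ι ℝ :=
  Matrix.of fun i j => ∫ ω, X τ i ω * X 0 j ω ∂P

/-- The common component `χ_t = Λ f_t`, for an arbitrary index set of times. -/
def commonComp {n r : ℕ} {τ : Type*} (Λ : Matrix (Fin n) (Fin r) ℝ) (f : τ → Fin r → Ω → ℝ) :
    τ → Fin n → Ω → ℝ :=
  fun t i ω => ∑ j, Λ i j * f t j ω

/-- The observations `x_t = χ_t + ε_t`. -/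
def observed {n r : ℕ} (Λ : Matrix (Fin n) (Fin r) ℝ) (f : ℕ → Fin r → Ω → ℝ)
    (ε : ℕ → Fin n → Ω → ℝ) : ℕ → Fin n → Ω → ℝ :=
  fun t i ω => commonComp Λ f t i ω + ε t i ω

/-- `η 1 < ⋯ < η B` are change-points in `{1, …, T}`, with the convention `η 0 = 0` and
`η (B + 1) = T`. Values `η b` for `b > B + 1` are irrelevant. -/
structure IsChangePoints (T B : ℕ) (η : ℕ → ℕ) : Prop where
  zero : η 0 = 0
  last : η (B + 1) = T
  lt : ∀ b ≤ B, η b < η (b + 1)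

/-- The index `max {0 ≤ b ≤ B : η b + 1 ≤ t}` of the last change-point strictly before `t ≥ 1`. -/
def segIdx (B : ℕ) (η : ℕ → ℕ) (t : ℕ) : ℕ := Nat.findGreatest (fun b => η b + 1 ≤ t) B

/-- The process `X` is approximated on the `b`-th segment `[η b + 1, η (b + 1)]` by the centred
weakly stationary process `Xb b`, at a geometric rate in the distance to the last change-point. -/
structure ApproxStationary {ι : Type*} (P : Measure Ω) (T B : ℕ) (η : ℕ → ℕ)
    (X : ℕ → ι → Ω → ℝ) (Xb : ℕ → ℤ → ι → Ω → ℝ) (C ρ : ℝ) : Prop where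
  stationary : ∀ b ≤ B, IsWeaklyStationary P (Xb b)
  centred : ∀ b ≤ B, ∀ t i, ∫ ω, Xb b t i ω ∂P = 0
  approx : ∀ t ∈ Finset.Icc 1 T, ∀ i,
    ∫ ω, (X t i ω - Xb (segIdx B η t) (t : ℤ) i ω) ^ 2 ∂P ≤ C * ρ ^ (t - η (segIdx B η t))

/-- At each of the `B` change-points the autocovariance matrix changes at some lag `|τ| ≤ τbar`. -/
def AutocovChanges {ι : Type*} (P : Measure Ω) (B : ℕ) (Xb : ℕ → ℤ → ι → Ω → ℝ) (τbar : ℕ) :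
    Prop :=
  ∀ b ∈ Finset.Icc 1 B, ∃ τ : ℤ, |τ| ≤ (τbar : ℤ) ∧
    autocov P (Xb b) τ - autocov P (Xb (b - 1)) τ ≠ 0

/-- The factors and the idiosyncratic components at times `1, …, T` are centred real random
variables. -/
structure IsCentredModel {n r : ℕ} (P : Measure Ω) (T : ℕ) (f : ℕ → Fin r → Ω → ℝ)
    (ε : ℕ → Fin n → Ω → ℝ) : Prop where
  measurable_factor : ∀ t ∈ Finset.Icc 1 T, ∀ j, Measurable (f t j)
  measurable_idio : ∀ t ∈ Finset.Icc 1 T, ∀ i, Measurable (ε t i)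
  mean_factor : ∀ t ∈ Finset.Icc 1 T, ∀ j, ∫ ω, f t j ω ∂P = 0
  mean_idio : ∀ t ∈ Finset.Icc 1 T, ∀ i, ∫ ω, ε t i ω ∂P = 0

/-- The factors are normalised, `T⁻¹ ∑ₜ E (f_t f_tᵀ) = I_r`. -/
def FactorNormalised {r : ℕ} (P : Measure Ω) (T : ℕ) (f : ℕ → Fin r → Ω → ℝ) : Prop :=
  (T : ℝ)⁻¹ • ∑ t ∈ Finset.Icc 1 T, Matrix.of (fun j k => ∫ ω, f t j ω * f t k ω ∂P) =
    (1 : Matrix (Fin r) (Fin r) ℝ)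

/-- The factors have exponential-type tails. -/
def FactorTails {r : ℕ} (P : Measure Ω) (T : ℕ) (f : ℕ → Fin r → Ω → ℝ) (cf βf : ℝ) : Prop :=
  ∀ t ∈ Finset.Icc 1 T, ∀ j, ∀ z : ℝ, 0 < z →
    P.real {ω | z < |f t j ω|} ≤ Real.exp (1 - (z / cf) ^ βf)

/-- Bounded normalised second moments of all weighted cross-sectional partial sums of `ε`. -/
def IdioBounded {n : ℕ} (P : Measure Ω) (T : ℕ) (ε : ℕ → Fin n → Ω → ℝ) (C : ℝ) : Prop :=
  ∀ a : Fin n → ℝ, ∑ i, a i ^ 2 = 1 → ∀ s e : ℕ, 1 ≤ s → s ≤ e → e ≤ T →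
    (1 / ((e : ℝ) - s + 1)) * ∑ i, ∑ i', ∑ t ∈ Finset.Icc s e, ∑ t' ∈ Finset.Icc s e,
      a i * a i' * ∫ ω, ε t i ω * ε t' i' ω ∂P < C

/-- At each time the vector `ε_t` has a (possibly degenerate) multivariate normal distribution. -/
def IdioGaussian {n : ℕ} (P : Measure Ω) (T : ℕ) (ε : ℕ → Fin n → Ω → ℝ) : Prop :=
  ∀ t ∈ Finset.Icc 1 T, HasGaussianLaw (fun ω => (fun i => ε t i ω : Fin n → ℝ)) P

/-- The families `(f_t)` and `(ε_t)`, `1 ≤ t ≤ T`, are independent. -/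
def FactorIdioIndep {n r : ℕ} (P : Measure Ω) (T : ℕ) (f : ℕ → Fin r → Ω → ℝ)
    (ε : ℕ → Fin n → Ω → ℝ) : Prop :=
  IndepFun (fun ω => (fun (t : Finset.Icc 1 T) j => f t j ω : Finset.Icc 1 T → Fin r → ℝ))
    (fun ω => (fun (t : Finset.Icc 1 T) i => ε t i ω : Finset.Icc 1 T → Fin n → ℝ)) P

/-- The σ-algebra generated by `(f_t, ε_t)`, `s ≤ t ≤ e`. -/
@[reducible] def sigmaBetween {n r : ℕ} (f : ℕ → Fin r → Ω → ℝ) (ε : ℕ → Fin n → Ω → ℝ) (s e : ℕ) :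
    MeasurableSpace Ω :=
  ⨆ t ∈ Finset.Icc s e, MeasurableSpace.comap
    (fun ω => ((fun j => f t j ω, fun i => ε t i ω) : (Fin r → ℝ) × (Fin n → ℝ))) inferInstance

/-- The strong mixing coefficient `α(k)` of the process `(f_t, ε_t)`, `1 ≤ t ≤ T`. -/
def mixingCoeff {n r : ℕ} (P : Measure Ω) (T : ℕ) (f : ℕ → Fin r → Ω → ℝ)
    (ε : ℕ → Fin n → Ω → ℝ) (k : ℕ) : ℝ :=
  sSup {x : ℝ | ∃ t ∈ Finset.Icc 1 T, ∃ A D : Set Ω,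
    MeasurableSet[sigmaBetween f ε 1 t] A ∧ MeasurableSet[sigmaBetween f ε (t + k) T] D ∧
    x = |P.real A * P.real D - P.real (A ∩ D)|}

/-- `α(k) ≤ exp (- c k ^ β)` for all positive integers `k`. -/
def ExpMixing {n r : ℕ} (P : Measure Ω) (T : ℕ) (f : ℕ → Fin r → Ω → ℝ)
    (ε : ℕ → Fin n → Ω → ℝ) (c β : ℝ) : Prop :=
  ∀ k : ℕ, 1 ≤ k → mixingCoeff P T f ε k ≤ Real.exp (-c * (k : ℝ) ^ β)

/-- Adjacent change-points are at least `c T` apart. -/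
def WellSpaced (T B : ℕ) (η : ℕ → ℕ) (c : ℝ) : Prop :=
  ∀ b ≤ B, c * (T : ℝ) ≤ |(η (b + 1) : ℝ) - (η b : ℝ)|

end Model

/-- The sample covariance matrix `T⁻¹ ∑ₜ x_t x_tᵀ` of a (centred) data set `x_1, …, x_T`. -/
def sampleCov {n : ℕ} (T : ℕ) (x : ℕ → Fin n → ℝ) : Matrix (Fin n) (Fin n) ℝ :=
  (T : ℝ)⁻¹ • ∑ t ∈ Finset.Icc 1 T, Matrix.vecMulVec (x t) (x t)

/-- `w 0, w 1, …` are orthonormal eigenvectors of `S` for its eigenvalues in non-increasing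
order, counted with multiplicity. -/
def IsOrderedEigenbasis {n : ℕ} (S : Matrix (Fin n) (Fin n) ℝ) (w : Fin n → Fin n → ℝ) : Prop :=
  (∀ j k, w j ⬝ᵥ w k = if j = k then 1 else 0) ∧
    ∃ μ : Fin n → ℝ, Antitone μ ∧ ∀ j, S *ᵥ w j = μ j • w j

/-- The PCA estimator of the common component at an observation `x`, built from the first `r` of
the eigenvectors `w`: the `i`-th entry is the sum over the leading `r` indices `j` of
`w_{ij} w_jᵀ x`. -/
def pcaEstimator {n : ℕ} (r : ℕ) (w : Fin n → Fin n → ℝ) (x : Fin n → ℝ) (i : Fin n) : ℝ :=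
  ∑ j : Fin n with j.val < r, w j i * (w j ⬝ᵥ x)

/-- The maximal absolute difference of two arrays over `i = 1, …, n` and `t = 1, …, T`. -/
def maxError {n : ℕ} (T : ℕ) (u v : ℕ → Fin n → ℝ) : ℝ :=
  ⨆ p : Finset.Icc 1 T × Fin n, |u p.1 p.2 - v p.1 p.2|

end

/-! At time `t` the estimator is `W Wᵀ x_t`, where the columns of `W` are the `r` leading
eigenvectors of the sample covariance `S`. It therefore suffices that this projection almost fixes
the range of `Λ` and almost kills `ε_t`, entry by entry. Only the projection matters, so signs and
rotations of the eigenvectors never enter.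

The deterministic half is `exists_pcaEstimator_error_le`. Write `S = Λ F Λᵀ + Λ Gᵀ + G Λᵀ + E`,
where `F`, `G`, `E` are the sample second moments of factors, of idiosyncratic parts against
factors, and of idiosyncratic parts. The eigenvalue equation `S W = W D` becomes `W = Λ A + R` on
division by the leading eigenvalues, which are at least of order `n` by Courant–Fischer
(`le_eigenvalue_of_forall_range`). Entrywise `A` is of order `1/√n` and `R` of order `ρ/√n`, where
`ρ` dominates `1/√n`, the entries of `G`, and `1/√n` times the row norms of `E`. Since `W` is
orthonormal, `abs_projection_sub_le` turns this into an error of order `ρ (φ + ψ)`, with `φ` and `ψ`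
bounding the factors and idiosyncratic parts. There it is essential that `Λᵀ ε_t` is bounded by `√n
ψ` rather than `n ψ`.

The probabilistic half bounds all deviations of the entries of `F`, `G`, `E` by a multiple of `log T
/ √T` at once. Decoupling (`integral_comp_add_le`), blocking and truncation give a Bernstein-type
inequality (`eventually_measure_abs_sum_sub_ge_le`) whose failure probability is an arbitrary
negative power of `T`; as `n` grows polynomially, a union bound over the `O(n²)` entries is
affordable. The mean of `F` is the identity, that of `G` vanishes by independence, and that of `E`
has bounded row norms, which costs `1/√n` in `ρ`.

So `ρ` is of order `1/√n + log T / √T`, while the largest factor or idiosyncratic value is of order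
`log T` to the power `max βf⁻¹ (1/2)`. The product of the two is the rate. -/

/-! ### Decoupling and exponential bounds under strong mixing -/

section Mixing

variable {Ω : Type*}

/-- The σ-algebras `m₁` and `m₂` have strong mixing coefficient at most `α` under `P`. -/
def IsAlphaMixing {m0 : MeasurableSpace Ω} (P : Measure Ω) (m₁ m₂ : MeasurableSpace Ω)
    (α : ℝ) : Prop :=
  ∀ A D : Set Ω, MeasurableSet[m₁] A → MeasurableSet[m₂] D →
    |P.real A * P.real D - P.real (A ∩ D)| ≤ α

variable {m m₁ m₂ m0 : MeasurableSpace Ω}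

theorem integrable_of_abs_le {P : Measure Ω} [IsFiniteMeasure P] {U : Ω → ℝ} {B : ℝ}
    (hU : Measurable U) (hB : ∀ ω, |U ω| ≤ B) : Integrable U P :=
  Integrable.of_bound hU.aestronglyMeasurable B (ae_of_all _ fun ω => by simpa using hB ω)

/-- If two finite measures are uniformly close on a σ-algebra, so are the integrals of functions
with values in `[0, 1]`. -/
theorem abs_integral_sub_integral_le (hm : m ≤ m0) (μ ν : Measure Ω)
    [IsFiniteMeasure μ] [IsFiniteMeasure ν] {α : ℝ}
    (h : ∀ A, MeasurableSet[m] A → |μ.real A - ν.real A| ≤ α) {U : Ω → ℝ}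
    (hU : Measurable[m] U) (h0 : ∀ ω, 0 ≤ U ω) (h1 : ∀ ω, U ω ≤ 1) :
    |∫ ω, U ω ∂μ - ∫ ω, U ω ∂ν| ≤ α := by
  have hU' : Measurable U := hU.mono hm le_rfl
  have habs : ∀ ω, |U ω| ≤ 1 := fun ω => by rw [abs_of_nonneg (h0 ω)]; exact h1 ω
  -- Layer-cake formula: the tail measures are compared on `(0, 1]`, an interval of length one, so
  -- the constant `α` is preserved.
  have key : ∀ (κ : Measure Ω) [IsFiniteMeasure κ],
      ∫ ω, U ω ∂κ = ∫ t in Set.Ioc (0 : ℝ) 1, κ.real {a | t ≤ U a} := fun κ _ =>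
    (integrable_of_abs_le hU' habs).integral_eq_integral_Ioc_meas_le (ae_of_all _ h0)
      (ae_of_all _ h1)
  have hint : ∀ (κ : Measure Ω) [IsFiniteMeasure κ],
      IntegrableOn (fun t : ℝ => κ.real {a | t ≤ U a}) (Set.Ioc (0 : ℝ) 1) := by
    intro κ _
    have hanti : Antitone (fun t : ℝ => κ.real {a | t ≤ U a}) := fun s t hst =>
      measureReal_mono (fun a ha => hst.trans ha)
    refine Measure.integrableOn_of_bounded (M := κ.real Set.univ) (by simp)
      hanti.measurable.aestronglyMeasurable (ae_of_all _ fun t => ?_)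
    rw [Real.norm_of_nonneg measureReal_nonneg]
    exact measureReal_mono (Set.subset_univ _)
  rw [key μ, key ν, ← integral_sub (hint μ) (hint ν)]
  have := norm_setIntegral_le_of_norm_le_const (μ := volume) (s := Set.Ioc (0 : ℝ) 1) (C := α)
    (f := fun t : ℝ => μ.real {a | t ≤ U a} - ν.real {a | t ≤ U a}) (by simp)
    (fun t _ => h _ (hU measurableSet_Ici))
  simpa using this

namespace IsAlphaMixing

variable {P : Measure Ω} [IsProbabilityMeasure P] {α : ℝ}

omit [IsProbabilityMeasure P] in
theorem nonneg (h : IsAlphaMixing P m₁ m₂ α) : 0 ≤ α :=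
  (abs_nonneg _).trans (h ∅ ∅ (@MeasurableSet.empty _ m₁) (@MeasurableSet.empty _ m₂))

/-- Mixing says exactly that, for fixed `D`, the measures `P.restrict D` and `P D • P` are `α`-close
on `m₁`; the layer-cake comparison passes from sets to functions. -/
theorem abs_setIntegral_sub_le (h : IsAlphaMixing P m₁ m₂ α) (hm₁ : m₁ ≤ m0)
    {U : Ω → ℝ} (hU : Measurable[m₁] U) (h0 : ∀ ω, 0 ≤ U ω) (h1 : ∀ ω, U ω ≤ 1) {D : Set Ω}
    (hD : MeasurableSet[m₂] D) : |∫ ω in D, U ω ∂P - P.real D * ∫ ω, U ω ∂P| ≤ α := by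
  have : IsFiniteMeasure ((P D) • P) := Measure.smul_finite _ (measure_ne_top _ _)
  have := abs_integral_sub_integral_le hm₁ (P.restrict D) ((P D) • P) (α := α) (fun A hA => by
    rw [measureReal_restrict_apply (hm₁ A hA), measureReal_ennreal_smul_apply, abs_sub_comm,
      mul_comm]
    exact h A D hA hD) hU h0 h1
  rwa [integral_smul_measure] at this

/-- The same comparison in the second variable: `U` serves as a density, and the previous lemma
supplies the closeness on sets of `m₂`. -/
theorem abs_integral_mul_sub_le_of_unit (h : IsAlphaMixing P m₁ m₂ α) (hm₁ : m₁ ≤ m0)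
    (hm₂ : m₂ ≤ m0) {U V : Ω → ℝ} (hU : Measurable[m₁] U) (h0 : ∀ ω, 0 ≤ U ω)
    (h1 : ∀ ω, U ω ≤ 1) (hV : Measurable[m₂] V) (h0' : ∀ ω, 0 ≤ V ω) (h1' : ∀ ω, V ω ≤ 1) :
    |∫ ω, U ω * V ω ∂P - (∫ ω, U ω ∂P) * ∫ ω, V ω ∂P| ≤ α := by
  have hU' : Measurable U := hU.mono hm₁ le_rfl
  have hUm : Measurable fun ω => ENNReal.ofReal (U ω) := hU'.ennreal_ofReal
  have hUint : Integrable U P := integrable_of_abs_le hU' (B := 1)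
    fun ω => by rw [abs_of_nonneg (h0 ω)]; exact h1 ω
  set c : ℝ := ∫ ω, U ω ∂P with hc
  have hc0 : 0 ≤ c := integral_nonneg h0
  have : IsFiniteMeasure (P.withDensity fun ω => ENNReal.ofReal (U ω)) :=
    isFiniteMeasure_withDensity_ofReal hUint.2
  have : IsFiniteMeasure ((ENNReal.ofReal c) • P) := Measure.smul_finite _ ENNReal.ofReal_ne_top
  have := abs_integral_sub_integral_le hm₂ (P.withDensity fun ω => ENNReal.ofReal (U ω))
    ((ENNReal.ofReal c) • P) (α := α) (fun A hA => by
      rw [measureReal_ennreal_smul_apply, ENNReal.toReal_ofReal hc0]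
      have e : (P.withDensity fun ω => ENNReal.ofReal (U ω)).real A = ∫ ω in A, U ω ∂P := by
        rw [measureReal_def, withDensity_apply _ (hm₂ A hA),
          ← ofReal_integral_eq_lintegral_ofReal hUint.integrableOn (ae_of_all _ h0),
          ENNReal.toReal_ofReal (integral_nonneg h0)]
      rw [e, mul_comm]
      exact h.abs_setIntegral_sub_le hm₁ hU h0 h1 hA) hV h0' h1'
  rw [integral_smul_measure, ENNReal.toReal_ofReal hc0,
    integral_withDensity_eq_integral_toReal_smul hUm (ae_of_all _ fun ω => ENNReal.ofReal_lt_top)]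
    at this
  simpa [ENNReal.toReal_ofReal (h0 _)] using this

/-- The covariance of bounded variables is controlled by the mixing coefficient. -/
theorem abs_integral_mul_sub_le (h : IsAlphaMixing P m₁ m₂ α) (hm₁ : m₁ ≤ m0)
    (hm₂ : m₂ ≤ m0) {U V : Ω → ℝ} {B : ℝ} (hB : 0 < B) (hU : Measurable[m₁] U)
    (hUB : ∀ ω, |U ω| ≤ B) (hV : Measurable[m₂] V) (hVB : ∀ ω, |V ω| ≤ B) :
    |∫ ω, U ω * V ω ∂P - (∫ ω, U ω ∂P) * ∫ ω, V ω ∂P| ≤ 4 * B ^ 2 * α := by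
  have hUi : Integrable U P := integrable_of_abs_le (hU.mono hm₁ le_rfl) hUB
  have hVi : Integrable V P := integrable_of_abs_le (hV.mono hm₂ le_rfl) hVB
  have hUVi : Integrable (fun ω => U ω * V ω) P :=
    integrable_of_abs_le ((hU.mono hm₁ le_rfl).mul (hV.mono hm₂ le_rfl)) (B := B * B) fun ω => by
      rw [abs_mul]; exact mul_le_mul (hUB ω) (hVB ω) (abs_nonneg _) hB.le
  -- The affine map to `[0, 1]` divides covariances by `(2 * B) ^ 2`, whence the factor `4 * B ^ 2`.
  have hr : ∀ x : ℝ, |x| ≤ B → 0 ≤ (x + B) / (2 * B) ∧ (x + B) / (2 * B) ≤ 1 := fun x hx => by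
    rw [abs_le] at hx
    exact ⟨div_nonneg (by linarith) (by linarith), by rw [div_le_one (by linarith)]; linarith⟩
  have := h.abs_integral_mul_sub_le_of_unit hm₁ hm₂
    (U := fun ω => (U ω + B) / (2 * B)) (V := fun ω => (V ω + B) / (2 * B))
    ((hU.add_const B).div_const _) (fun ω => (hr _ (hUB ω)).1) (fun ω => (hr _ (hUB ω)).2)
    ((hV.add_const B).div_const _) (fun ω => (hr _ (hVB ω)).1) (fun ω => (hr _ (hVB ω)).2)
  have e1 : ∫ ω, (U ω + B) / (2 * B) * ((V ω + B) / (2 * B)) ∂P =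
      (4 * B ^ 2)⁻¹ * ((∫ ω, U ω * V ω ∂P) + B * (∫ ω, U ω ∂P) + B * (∫ ω, V ω ∂P) + B ^ 2) := by
    have : ∀ ω, (U ω + B) / (2 * B) * ((V ω + B) / (2 * B)) =
        (4 * B ^ 2)⁻¹ * (U ω * V ω + B * U ω + B * V ω + B ^ 2) := fun ω => by
      field_simp; ring
    simp_rw [this]
    rw [integral_const_mul, integral_add ((hUVi.fun_add (hUi.const_mul B)).fun_add
      (hVi.const_mul B)) (integrable_const _),
      integral_add (hUVi.fun_add (hUi.const_mul B)) (hVi.const_mul B),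
      integral_add hUVi (hUi.const_mul B), integral_const_mul, integral_const_mul]
    simp
  have e2 : ∀ W : Ω → ℝ, Integrable W P →
      ∫ ω, (W ω + B) / (2 * B) ∂P = ((∫ ω, W ω ∂P) + B) / (2 * B) := fun W hW => by
    rw [integral_div, integral_add hW (integrable_const _)]; simp
  rw [e1, e2 U hUi, e2 V hVi] at this
  have e3 : (4 * B ^ 2)⁻¹ * ((∫ ω, U ω * V ω ∂P) + B * (∫ ω, U ω ∂P) + B * (∫ ω, V ω ∂P) + B ^ 2) -
      ((∫ ω, U ω ∂P) + B) / (2 * B) * (((∫ ω, V ω ∂P) + B) / (2 * B)) =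
      (4 * B ^ 2)⁻¹ * (∫ ω, U ω * V ω ∂P - (∫ ω, U ω ∂P) * ∫ ω, V ω ∂P) := by
    field_simp; ring
  rw [e3, abs_mul, abs_of_pos (by positivity), inv_mul_le_iff₀ (by positivity)] at this
  exact this

/-- Replacing a bounded variable by an independent copy changes the expectation of a Lipschitz
function of a sum only little. -/
theorem integral_comp_add_le (h : IsAlphaMixing P m₁ m₂ α) (hm₁ : m₁ ≤ m0) (hm₂ : m₂ ≤ m0)
    {S X : Ω → ℝ} {M L : ℝ} (hM : 0 < M) (hL : 0 ≤ L) (hS : Measurable[m₁] S)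
    (hX : Measurable[m₂] X) (hXM : ∀ ω, |X ω| ≤ M) {g : ℝ → ℝ} (hg : Measurable g)
    (hg0 : ∀ s, 0 ≤ g s) (hg1 : ∀ s, g s ≤ 1) (hgL : ∀ s t, |g s - g t| ≤ L * |s - t|)
    {N : ℕ} (hN : 0 < N) :
    ∫ ω, g (S ω + X ω) ∂P ≤
      ∫ ω, (∫ ω', g (S ω + X ω') ∂P) ∂P + ((N + 1) * α + 4 * L * M / N) := by
  have hS' : Measurable S := hS.mono hm₁ le_rfl
  have hX' : Measurable X := hX.mono hm₂ le_rfl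
  have hNpos : (0 : ℝ) < N := by exact_mod_cast hN
  -- `X` is rounded down to a grid of mesh `d`. On each of the `N + 1` cells the rounded value is
  -- constant, so mixing decouples it from `S` at cost `α`; rounding, and undoing it afterwards,
  -- each cost `L * d`.
  set d : ℝ := 2 * M / N with hd
  have hdpos : 0 < d := by positivity
  set b : Ω → ℕ := fun ω => ⌊(X ω + M) / d⌋₊ with hb
  set c : ℕ → ℝ := fun k => -M + k * d with hc
  have hbm : Measurable[m₂] b := (Nat.measurable_floor).comp ((hX.add_const M).div_const d)
  have hbm' : Measurable b := hbm.mono hm₂ le_rfl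
  have hDm : ∀ k, MeasurableSet[m₂] (b ⁻¹' {k}) := fun k => hbm (MeasurableSet.of_discrete)
  have hDm' : ∀ k, MeasurableSet (b ⁻¹' {k}) := fun k => hm₂ _ (hDm k)
  have hbN : ∀ ω, b ω ∈ Finset.range (N + 1) := fun ω => by
    rw [Finset.mem_range, Nat.lt_succ_iff]
    apply Nat.floor_le_of_le
    rw [div_le_iff₀ hdpos, hd]
    have := (abs_le.1 (hXM ω)).2
    field_simp
    linarith
  have hclose : ∀ ω, |X ω - c (b ω)| ≤ d := fun ω => by
    have h0 : 0 ≤ (X ω + M) / d := div_nonneg (by linarith [(abs_le.1 (hXM ω)).1]) hdpos.le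
    have h1 := Nat.floor_le h0
    have h2 := (Nat.lt_floor_add_one ((X ω + M) / d)).le
    rw [le_div_iff₀ hdpos] at h1
    rw [div_le_iff₀ hdpos] at h2
    simp only [hc, hb, abs_le]
    constructor <;> nlinarith
  have hgabs : ∀ s, |g s| ≤ 1 := fun s => by rw [abs_of_nonneg (hg0 s)]; exact hg1 s
  have hgi : ∀ Y : Ω → ℝ, Measurable Y → Integrable (fun ω => g (Y ω)) P := fun Y hY =>
    integrable_of_abs_le (hg.comp hY) fun ω => hgabs _
  have hsum : ∀ (F : ℕ → ℝ) ω, ∑ k ∈ Finset.range (N + 1),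
      (b ⁻¹' {k}).indicator (fun _ => F k) ω = F (b ω) := fun F ω => by
    rw [Finset.sum_eq_single_of_mem (b ω) (hbN ω)]
    · simp
    · intro k _ hk
      simp [Set.indicator, hk.symm]
  have hprob : ∑ k ∈ Finset.range (N + 1), P.real (b ⁻¹' {k}) = 1 := by
    have := congrArg (fun f : Ω → ℝ => ∫ ω, f ω ∂P) (funext (hsum fun _ => 1))
    simp only at this
    rw [integral_finsetSum _ fun k _ => (integrable_const _).indicator (hDm' k)] at this
    simpa [integral_indicator_const _ (hDm' _)] using this
  have hgstep : ∀ s x y, |x - y| ≤ d → g (s + x) ≤ g (s + y) + L * d := fun s x y hxy => by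
    have := (abs_le.1 (hgL (s + x) (s + y))).2
    rw [show s + x - (s + y) = x - y by ring] at this
    nlinarith [mul_le_mul_of_nonneg_left hxy hL]
  have step1 : ∫ ω, g (S ω + X ω) ∂P ≤
      ∑ k ∈ Finset.range (N + 1), ∫ ω in b ⁻¹' {k}, g (S ω + c k) ∂P + L * d := by
    have hi : ∀ k ∈ Finset.range (N + 1),
        Integrable ((b ⁻¹' {k}).indicator fun ω => g (S ω + c k)) P :=
      fun k _ => (hgi _ (hS'.add_const _)).indicator (hDm' k)
    have : ∫ ω, g (S ω + X ω) ∂P ≤ ∫ ω, (∑ k ∈ Finset.range (N + 1),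
        (b ⁻¹' {k}).indicator (fun ω => g (S ω + c k)) ω + L * d) ∂P := by
      refine integral_mono (hgi _ (hS'.add hX'))
        ((integrable_finsetSum _ hi).add (integrable_const _)) fun ω => ?_
      have e := hsum (fun k => g (S ω + c k)) ω
      simp only [Set.indicator] at e ⊢
      rw [e]
      exact hgstep _ _ _ (hclose ω)
    rw [integral_add (integrable_finsetSum _ hi) (integrable_const _),
      integral_finsetSum _ hi] at this
    simpa only [integral_indicator (hDm' _), integral_const, probReal_univ, one_smul] using this
  have step2 : ∀ k, ∫ ω in b ⁻¹' {k}, g (S ω + c k) ∂P ≤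
      P.real (b ⁻¹' {k}) * ∫ ω, g (S ω + c k) ∂P + α := fun k => by
    have := h.abs_setIntegral_sub_le hm₁ (U := fun ω => g (S ω + c k))
      (hg.comp (hS.add_const _)) (fun ω => hg0 _) (fun ω => hg1 _) (hDm k)
    linarith [(abs_le.1 this).2]
  have step3 : ∀ s, ∑ k ∈ Finset.range (N + 1), P.real (b ⁻¹' {k}) * g (s + c k) ≤
      ∫ ω', g (s + X ω') ∂P + L * d := fun s => by
    have hi : ∀ k ∈ Finset.range (N + 1),
        Integrable ((b ⁻¹' {k}).indicator fun _ : Ω => g (s + c k)) P :=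
      fun k _ => (integrable_const _).indicator (hDm' k)
    have : ∫ ω, (∑ k ∈ Finset.range (N + 1), (b ⁻¹' {k}).indicator (fun _ => g (s + c k)) ω) ∂P
        ≤ ∫ ω', (g (s + X ω') + L * d) ∂P := by
      refine integral_mono (integrable_finsetSum _ hi)
        ((hgi _ (hX'.const_add s)).add (integrable_const _)) fun ω => ?_
      rw [hsum (fun k => g (s + c k)) ω]
      exact hgstep _ _ _ (by rw [abs_sub_comm]; exact hclose ω)
    rw [integral_add (hgi _ (hX'.const_add s)) (integrable_const _),
      integral_finsetSum _ hi] at this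
    simpa only [integral_indicator_const _ (hDm' _), integral_const, probReal_univ, smul_eq_mul,
      one_mul] using this
  have hGi : Integrable (fun ω => ∫ ω', g (S ω + X ω') ∂P) P := by
    have hGm : StronglyMeasurable fun s : ℝ => ∫ ω', g (s + X ω') ∂P :=
      StronglyMeasurable.integral_prod_right
        (f := fun s ω' => g (s + X ω'))
        (hg.comp (measurable_fst.add (hX'.comp measurable_snd))).stronglyMeasurable
    refine integrable_of_abs_le (hGm.measurable.comp hS') (B := 1) fun ω => ?_
    rw [abs_of_nonneg (integral_nonneg fun _ => hg0 _)]
    calc ∫ ω', g (S ω + X ω') ∂P ≤ ∫ ω', (1 : ℝ) ∂P :=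
          integral_mono (hgi _ (hX'.const_add _)) (integrable_const _) fun ω' => hg1 _
      _ = 1 := by simp
  have step4 : ∑ k ∈ Finset.range (N + 1), P.real (b ⁻¹' {k}) * ∫ ω, g (S ω + c k) ∂P ≤
      ∫ ω, (∫ ω', g (S ω + X ω') ∂P) ∂P + L * d := by
    have hi : ∀ k ∈ Finset.range (N + 1),
        Integrable (fun ω => P.real (b ⁻¹' {k}) * g (S ω + c k)) P :=
      fun k _ => (hgi _ (hS'.add_const _)).const_mul _
    have : ∫ ω, (∑ k ∈ Finset.range (N + 1), P.real (b ⁻¹' {k}) * g (S ω + c k)) ∂P ≤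
        ∫ ω, ((∫ ω', g (S ω + X ω') ∂P) + L * d) ∂P :=
      integral_mono (integrable_finsetSum _ hi) (hGi.add (integrable_const _))
        fun ω => step3 (S ω)
    rw [integral_finsetSum _ hi, integral_add hGi (integrable_const _)] at this
    simpa [integral_const_mul] using this
  have step5 : ∑ k ∈ Finset.range (N + 1), ∫ ω in b ⁻¹' {k}, g (S ω + c k) ∂P ≤
      ∑ k ∈ Finset.range (N + 1), P.real (b ⁻¹' {k}) * ∫ ω, g (S ω + c k) ∂P + (N + 1) * α := by
    refine (Finset.sum_le_sum fun k _ => step2 k).trans_eq ?_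
    rw [Finset.sum_add_distrib]
    simp
  have : 4 * L * M / N = 2 * (L * d) := by rw [hd]; ring
  linarith

end IsAlphaMixing

/-- Integrate `exp y ≤ 1 + y + y ^ 2`, valid for `|y| ≤ 1`; the linear term vanishes because `X` is
centred. -/
theorem integral_exp_mul_le {P : Measure Ω} [IsProbabilityMeasure P] {X : Ω → ℝ} {M v l : ℝ}
    (hX : Measurable X) (hXM : ∀ ω, |X ω| ≤ M) (hmean : ∫ ω, X ω ∂P = 0)
    (hv : ∫ ω, X ω ^ 2 ∂P ≤ v) (hl : 0 ≤ l) (hlM : l * M ≤ 1) :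
    ∫ ω, Real.exp (l * X ω) ∂P ≤ Real.exp (l ^ 2 * v) := by
  have hXi : Integrable X P := integrable_of_abs_le hX hXM
  have hX2 : Integrable (fun ω => X ω ^ 2) P := integrable_of_abs_le (hX.pow_const 2) (B := M ^ 2)
    fun ω => by rw [abs_pow]; exact pow_le_pow_left₀ (abs_nonneg _) (hXM ω) 2
  have habs : ∀ ω, |l * X ω| ≤ 1 := fun ω => by
    rw [abs_mul, abs_of_nonneg hl]
    exact (mul_le_mul_of_nonneg_left (hXM ω) hl).trans hlM
  have hei : Integrable (fun ω => Real.exp (l * X ω)) P :=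
    integrable_of_abs_le (hX.const_mul l).exp (B := Real.exp 1) fun ω => by
      rw [abs_of_pos (Real.exp_pos _)]
      exact Real.exp_le_exp.2 ((le_abs_self _).trans (habs ω))
  have h1 : ∫ ω, Real.exp (l * X ω) ∂P ≤ ∫ ω, (1 + l * X ω + l ^ 2 * X ω ^ 2) ∂P := by
    refine integral_mono hei (((integrable_const 1).add (hXi.const_mul l)).add
      (hX2.const_mul (l ^ 2))) fun ω => ?_
    have := (abs_le.1 (Real.abs_exp_sub_one_sub_id_le (habs ω))).2
    simp only
    nlinarith
  rw [integral_add ((integrable_const 1).fun_add (hXi.const_mul l)) (hX2.const_mul (l ^ 2)),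
    integral_add (integrable_const 1) (hXi.const_mul l), integral_const_mul, integral_const_mul,
    hmean] at h1
  simp only [integral_const, probReal_univ, smul_eq_mul, mul_one, mul_zero, add_zero] at h1
  have h2 := Real.add_one_le_exp (l ^ 2 * v)
  nlinarith [mul_le_mul_of_nonneg_left hv (sq_nonneg l)]

/-- Exponential bound for Lipschitz functions of sums of weakly dependent bounded variables. -/
theorem integral_comp_sum_le {P : Measure Ω} [IsProbabilityMeasure P] {K : ℕ} {X : ℕ → Ω → ℝ}
    {mp mf : ℕ → MeasurableSpace Ω} {α M L l : ℝ} {v : ℕ → ℝ} {N : ℕ}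
    (hM : 0 < M) (hL : 0 ≤ L) (hl : 0 ≤ l) (hlM : l * M ≤ 1) (hN : 0 < N)
    (hmp : ∀ i, mp i ≤ m0) (hmf : ∀ i, mf i ≤ m0)
    (hpast : ∀ i < K, ∀ j < i, Measurable[mp i] (X j))
    (hfut : ∀ i < K, Measurable[mf i] (X i))
    (hmix : ∀ i < K, IsAlphaMixing P (mp i) (mf i) α)
    (hXM : ∀ i < K, ∀ ω, |X i ω| ≤ M) (hmean : ∀ i < K, ∫ ω, X i ω ∂P = 0)
    (hv : ∀ i < K, ∫ ω, X i ω ^ 2 ∂P ≤ v i)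
    {g : ℝ → ℝ} {A : ℝ} (hA : 0 ≤ A) (hg : Measurable g)
    (hg0 : ∀ s, 0 ≤ g s) (hg1 : ∀ s, g s ≤ 1) (hgL : ∀ s t, |g s - g t| ≤ L * |s - t|)
    (hgA : ∀ s, g s ≤ A * Real.exp (l * s)) :
    ∫ ω, g (∑ i ∈ Finset.range K, X i ω) ∂P ≤
      A * Real.exp (l ^ 2 * ∑ i ∈ Finset.range K, v i) +
        K * ((N + 1) * α + 4 * L * M / N) := by
  -- The last variable is decoupled and integrated into the test function. The new `g` keeps its
  -- bounds and Lipschitz constant, while `A` gains the factor `exp (l ^ 2 * v K)`. Using bounded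
  -- Lipschitz `g` instead of the exponential itself keeps the decoupling errors additive.
  induction K generalizing g A with
  | zero => simpa using hgA 0
  | succ K ih =>
    have hKl := Nat.lt_succ_self K
    have hXm : Measurable (X K) := (hfut K hKl).mono (hmf K) le_rfl
    have hSm : Measurable[mp K] fun ω => ∑ i ∈ Finset.range K, X i ω :=
      Finset.measurable_sum _ fun i hi => hpast K hKl i (Finset.mem_range.1 hi)
    have h1 := (hmix K hKl).integral_comp_add_le (hmp K) (hmf K) hM hL hSm (hfut K hKl)
      (hXM K hKl) hg hg0 hg1 hgL hN
    have hgi : ∀ s, Integrable (fun ω => g (s + X K ω)) P := fun s =>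
      integrable_of_abs_le (hg.comp (hXm.const_add s)) (B := 1)
        fun ω => by rw [abs_of_nonneg (hg0 _)]; exact hg1 _
    have hei : Integrable (fun ω => Real.exp (l * X K ω)) P :=
      integrable_of_abs_le (hXm.const_mul l).exp (B := Real.exp 1) fun ω => by
        rw [abs_of_pos (Real.exp_pos _)]
        refine Real.exp_le_exp.2 (le_trans ?_ hlM)
        exact mul_le_mul_of_nonneg_left ((le_abs_self _).trans (hXM K hKl ω)) hl
    have h2 := ih (fun i hi => hpast i (hi.trans hKl)) (fun i hi => hfut i (hi.trans hKl))
      (fun i hi => hmix i (hi.trans hKl)) (fun i hi => hXM i (hi.trans hKl))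
      (fun i hi => hmean i (hi.trans hKl)) (fun i hi => hv i (hi.trans hKl))
      (g := fun s => ∫ ω', g (s + X K ω') ∂P) (A := A * Real.exp (l ^ 2 * v K)) (by positivity)
      (StronglyMeasurable.integral_prod_right (f := fun s ω' => g (s + X K ω'))
        (hg.comp (measurable_fst.add (hXm.comp measurable_snd))).stronglyMeasurable).measurable
      (fun s => integral_nonneg fun _ => hg0 _)
      (fun s => by
        calc ∫ ω', g (s + X K ω') ∂P ≤ ∫ ω', (1 : ℝ) ∂P :=
              integral_mono (hgi s) (integrable_const _) fun ω' => hg1 _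
          _ = 1 := by simp)
      (fun s t => by
        rw [← integral_sub (hgi s) (hgi t)]
        have := norm_integral_le_of_norm_le_const (μ := P) (C := L * |s - t|)
          (f := fun ω => g (s + X K ω) - g (t + X K ω)) (ae_of_all _ fun ω => by
            have := hgL (s + X K ω) (t + X K ω)
            rwa [add_sub_add_right_eq_sub] at this)
        simpa using this)
      (fun s => by
        calc ∫ ω', g (s + X K ω') ∂P ≤ ∫ ω', A * Real.exp (l * s) * Real.exp (l * X K ω') ∂P :=
              integral_mono (hgi s) (hei.const_mul _) fun ω' => by
                simpa only [mul_assoc, ← Real.exp_add, ← mul_add] using hgA (s + X K ω')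
          _ = A * Real.exp (l * s) * ∫ ω', Real.exp (l * X K ω') ∂P := integral_const_mul _ _
          _ ≤ A * Real.exp (l * s) * Real.exp (l ^ 2 * v K) :=
              mul_le_mul_of_nonneg_left (integral_exp_mul_le hXm (hXM K hKl) (hmean K hKl)
                (hv K hKl) hl hlM) (by positivity)
          _ = A * Real.exp (l ^ 2 * v K) * Real.exp (l * s) := by ring)
    simp only [Finset.sum_range_succ]
    rw [mul_add, Real.exp_add]
    push_cast
    nlinarith

/-- A Bernstein-type inequality for weakly dependent bounded variables. -/
theorem measure_sum_ge_le {P : Measure Ω} [IsProbabilityMeasure P] {K : ℕ} {X : ℕ → Ω → ℝ}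
    {mp mf : ℕ → MeasurableSpace Ω} {α M l x : ℝ} {v : ℕ → ℝ} {N : ℕ}
    (hM : 0 < M) (hx : 0 < x) (hl : 0 ≤ l) (hlM : l * M ≤ 1) (hN : 0 < N)
    (hmp : ∀ i, mp i ≤ m0) (hmf : ∀ i, mf i ≤ m0)
    (hpast : ∀ i < K, ∀ j < i, Measurable[mp i] (X j))
    (hfut : ∀ i < K, Measurable[mf i] (X i))
    (hmix : ∀ i < K, IsAlphaMixing P (mp i) (mf i) α)
    (hXM : ∀ i < K, ∀ ω, |X i ω| ≤ M) (hmean : ∀ i < K, ∫ ω, X i ω ∂P = 0)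
    (hv : ∀ i < K, ∫ ω, X i ω ^ 2 ∂P ≤ v i) :
    P.real {ω | 2 * x ≤ ∑ i ∈ Finset.range K, X i ω} ≤
      Real.exp (-(l * x)) * Real.exp (l ^ 2 * ∑ i ∈ Finset.range K, v i) +
        K * ((N + 1) * α + 4 * x⁻¹ * M / N) := by
  -- A ramp rising from `0` at `x` to `1` at `2 * x`: it dominates the indicator of `[2 * x, ∞)`,
  -- lies below `exp (l * (s - x))`, and has Lipschitz constant `x⁻¹`.
  set g : ℝ → ℝ := fun s => max 0 (min 1 (x⁻¹ * (s - x))) with hgdef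
  have hgm : Measurable g :=
    measurable_const.max (measurable_const.min ((measurable_id.sub_const x).const_mul _))
  have hg0 : ∀ s, 0 ≤ g s := fun s => le_max_left _ _
  have hg1 : ∀ s, g s ≤ 1 := fun s => max_le zero_le_one (min_le_left _ _)
  have hgL : ∀ s t, |g s - g t| ≤ x⁻¹ * |s - t| := fun s t => by
    refine (abs_max_sub_max_le_max _ _ _ _).trans ?_
    refine max_le (by simp; positivity) ?_
    refine (abs_min_sub_min_le_max _ _ _ _).trans (max_le (by simp; positivity) ?_)
    rw [← mul_sub, abs_mul, abs_of_pos (inv_pos.2 hx), sub_sub_sub_cancel_right]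
  have hgA : ∀ s, g s ≤ Real.exp (-(l * x)) * Real.exp (l * s) := fun s => by
    rw [← Real.exp_add]
    rcases le_total s x with h | h
    · have : g s = 0 := max_eq_left ((min_le_right _ _).trans
        (mul_nonpos_of_nonneg_of_nonpos (inv_pos.2 hx).le (by linarith)))
      rw [this]; positivity
    · exact (hg1 s).trans (Real.one_le_exp (by nlinarith))
  have hXm : ∀ i < K, Measurable (X i) := fun i hi => (hfut i hi).mono (hmf i) le_rfl
  have hSm : Measurable fun ω => ∑ i ∈ Finset.range K, X i ω :=
    Finset.measurable_sum _ fun i hi => hXm i (Finset.mem_range.1 hi)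
  have hset : MeasurableSet {ω | 2 * x ≤ ∑ i ∈ Finset.range K, X i ω} :=
    measurableSet_le measurable_const hSm
  have h1 := integral_comp_sum_le hM (inv_pos.2 hx).le hl hlM hN hmp hmf hpast hfut hmix hXM hmean
    hv (Real.exp_pos _).le hgm hg0 hg1 hgL hgA
  refine le_trans ?_ h1
  rw [← integral_indicator_one hset]
  refine integral_mono ((integrable_const (1 : ℝ)).indicator hset)
    (integrable_of_abs_le (hgm.comp hSm) (B := 1)
      fun ω => by rw [abs_of_nonneg (hg0 _)]; exact hg1 _) fun ω => ?_
  by_cases hω : 2 * x ≤ ∑ i ∈ Finset.range K, X i ω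
  · simp only [Set.indicator, Set.mem_ofPred_eq, hω, if_true, Pi.one_apply]
    refine le_max_of_le_right (le_min le_rfl ?_)
    rw [← div_eq_inv_mul, le_div_iff₀ hx]
    linarith
  · simp only [Set.indicator, Set.mem_ofPred_eq, hω, if_false]
    exact hg0 _

end Mixing

/-! ### Variance bounds and blocking -/

section Blocks

variable {Ω : Type*} {m0 : MeasurableSpace Ω}

/-- `F s e` plays the role of the σ-algebra of the times `s, …, e` in `1, …, T`, with strong mixing
coefficients bounded by `α`. -/
structure IsMixingFamily (P : Measure Ω) (T : ℕ) (F : ℕ → ℕ → MeasurableSpace Ω) (α : ℕ → ℝ) :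
    Prop where
  le : ∀ s e, 1 ≤ s → e ≤ T → F s e ≤ m0
  mono : ∀ s s' e e', s' ≤ s → e ≤ e' → F s e ≤ F s' e'
  mixing : ∀ t k, 1 ≤ k → t ≤ T → IsAlphaMixing P (F 1 t) (F (t + k) T) (α k)

theorem IsAlphaMixing.of_bot {P : Measure Ω} [IsProbabilityMeasure P] {m : MeasurableSpace Ω}
    {α : ℝ} (hα : 0 ≤ α) : IsAlphaMixing P ⊥ m α := by
  intro A D hA _
  rcases MeasurableSpace.measurableSet_bot_iff.1 hA with rfl | rfl <;> simpa using hα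

variable {P : Measure Ω} [IsProbabilityMeasure P] {T : ℕ} {F : ℕ → ℕ → MeasurableSpace Ω}
  {α : ℕ → ℝ}

namespace IsMixingFamily

omit [IsProbabilityMeasure P] in
theorem measurable (hF : IsMixingFamily P T F α) {Y : ℕ → Ω → ℝ} {t : ℕ}
    (ht : t ∈ Finset.Icc 1 T) (hY : Measurable[F t t] (Y t)) : Measurable (Y t) :=
  hY.mono (hF.le t t (Finset.mem_Icc.1 ht).1 (Finset.mem_Icc.1 ht).2) le_rfl

theorem integral_mul_le_of_lt (hF : IsMixingFamily P T F α) (hα : Antitone α)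
    {Y : ℕ → Ω → ℝ} {B : ℝ} (hB : 0 < B)
    (hYm : ∀ t ∈ Finset.Icc 1 T, Measurable[F t t] (Y t))
    (hYB : ∀ t ∈ Finset.Icc 1 T, ∀ ω, |Y t ω| ≤ B)
    (hY0 : ∀ t ∈ Finset.Icc 1 T, ∫ ω, Y t ω ∂P = 0) {k : ℕ} (hk : 1 ≤ k) {s t : ℕ}
    (hs : s ∈ Finset.Icc 1 T) (ht : t ∈ Finset.Icc 1 T) (hst : s + k ≤ t) :
    ∫ ω, Y s ω * Y t ω ∂P ≤ 4 * B ^ 2 * α k := by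
  have hs' := Finset.mem_Icc.1 hs
  have ht' := Finset.mem_Icc.1 ht
  have h := (hF.mixing s (t - s) (by omega) hs'.2).abs_integral_mul_sub_le
    (hF.le 1 s le_rfl hs'.2) (hF.le _ T (by omega) le_rfl) hB
    ((hYm s hs).mono (hF.mono s 1 s s hs'.1 le_rfl) le_rfl) (hYB s hs)
    ((hYm t ht).mono (hF.mono t (s + (t - s)) t T (by omega) ht'.2) le_rfl) (hYB t ht)
  rw [hY0 s hs, zero_mul, sub_zero] at h
  refine (le_abs_self _).trans (h.trans ?_)
  exact mul_le_mul_of_nonneg_left (hα (by omega)) (by positivity)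

/-- Variance of a partial sum: nearby pairs are bounded by variances, the others by mixing. -/
theorem integral_sum_sq_le (hF : IsMixingFamily P T F α) (hα : Antitone α)
    {Y : ℕ → Ω → ℝ} {B : ℝ} (hB : 0 < B)
    (hYm : ∀ t ∈ Finset.Icc 1 T, Measurable[F t t] (Y t))
    (hYB : ∀ t ∈ Finset.Icc 1 T, ∀ ω, |Y t ω| ≤ B)
    (hY0 : ∀ t ∈ Finset.Icc 1 T, ∫ ω, Y t ω ∂P = 0) {k : ℕ} (hk : 1 ≤ k) {J : Finset ℕ}
    (hJ : J ⊆ Finset.Icc 1 T) :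
    ∫ ω, (∑ t ∈ J, Y t ω) ^ 2 ∂P ≤
      2 * k * ∑ t ∈ J, ∫ ω, Y t ω ^ 2 ∂P + (J.card : ℝ) ^ 2 * (4 * B ^ 2 * α k) := by
  set v : ℕ → ℝ := fun t => ∫ ω, Y t ω ^ 2 ∂P with hv
  -- Pairs at distance less than `k`: each index has fewer than `2 * k` such partners, and their
  -- covariance is at most the mean of the two second moments.
  set near : ℕ → ℕ → Prop := fun s t => s < t + k ∧ t < s + k with hnear
  have hv0 : ∀ t, 0 ≤ v t := fun t => integral_nonneg fun ω => sq_nonneg _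
  have hYi : ∀ s ∈ J, ∀ t ∈ J, Integrable (fun ω => Y s ω * Y t ω) P := fun s hs t ht =>
    integrable_of_abs_le ((hF.measurable (hJ hs) (hYm s (hJ hs))).mul
      (hF.measurable (hJ ht) (hYm t (hJ ht)))) (B := B * B) fun ω => by
        rw [abs_mul]
        exact mul_le_mul (hYB s (hJ hs) ω) (hYB t (hJ ht) ω) (abs_nonneg _) hB.le
  classical
  have hα0 : J.Nonempty → 0 ≤ α k := fun ⟨t, ht⟩ =>
    (hF.mixing t k hk (Finset.mem_Icc.1 (hJ ht)).2).nonneg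
  have hpair : ∀ s ∈ J, ∀ t ∈ J, ∫ ω, Y s ω * Y t ω ∂P ≤
      (if near s t then (v s + v t) / 2 else 0) + 4 * B ^ 2 * α k := fun s hs t ht => by
    have hpos : 0 ≤ 4 * B ^ 2 * α k := mul_nonneg (by positivity) (hα0 ⟨t, ht⟩)
    by_cases h : near s t
    · rw [if_pos h]
      have hsq : ∀ t ∈ J, Integrable (fun ω => Y t ω ^ 2) P := fun t ht => by
        simpa only [sq] using hYi t ht t ht
      have : ∫ ω, Y s ω * Y t ω ∂P ≤ ∫ ω, (Y s ω ^ 2 / 2 + Y t ω ^ 2 / 2) ∂P :=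
        integral_mono (hYi s hs t ht) (((hsq s hs).div_const 2).fun_add ((hsq t ht).div_const 2))
          fun ω => by simp only; nlinarith [sq_nonneg (Y s ω - Y t ω)]
      rw [integral_add ((hsq s hs).div_const 2) ((hsq t ht).div_const 2), integral_div,
        integral_div] at this
      linarith
    · rw [if_neg h, zero_add]
      rcases not_and_or.1 h with h | h
      · simp_rw [mul_comm (Y s _)]
        exact hF.integral_mul_le_of_lt hα hB hYm hYB hY0 hk (hJ ht) (hJ hs) (by omega)
      · exact hF.integral_mul_le_of_lt hα hB hYm hYB hY0 hk (hJ hs) (hJ ht) (by omega)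
  have hcard : ∀ s, ((J.filter fun t => near s t).card : ℝ) ≤ 2 * k := fun s => by
    have h1 : (J.filter fun t => near s t) ⊆ Finset.Ico (s + 1 - k) (s + k) := fun t ht => by
      have := (Finset.mem_filter.1 ht).2
      rw [Finset.mem_Ico]
      exact ⟨by have := this.1; omega, this.2⟩
    have h2 := Finset.card_le_card h1
    rw [Nat.card_Ico] at h2
    exact_mod_cast h2.trans (by omega)
  have hsumnear : ∑ s ∈ J, ∑ t ∈ J, (if near s t then v s else 0) ≤ 2 * k * ∑ t ∈ J, v t := by
    rw [Finset.mul_sum]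
    refine Finset.sum_le_sum fun s _ => ?_
    rw [← Finset.sum_filter, Finset.sum_const, nsmul_eq_mul]
    exact mul_le_mul_of_nonneg_right (hcard s) (hv0 s)
  have hsymm : ∑ s ∈ J, ∑ t ∈ J, (if near s t then v t else 0) =
      ∑ s ∈ J, ∑ t ∈ J, (if near s t then v s else 0) := by
    rw [Finset.sum_comm]
    refine Finset.sum_congr rfl fun s _ => Finset.sum_congr rfl fun t _ => ?_
    simp only [hnear, and_comm]
  calc ∫ ω, (∑ t ∈ J, Y t ω) ^ 2 ∂P = ∑ s ∈ J, ∑ t ∈ J, ∫ ω, Y s ω * Y t ω ∂P := by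
        simp_rw [sq, Finset.sum_mul_sum]
        rw [integral_finsetSum _ fun s hs => integrable_finsetSum _ fun t ht => hYi s hs t ht]
        exact Finset.sum_congr rfl fun s hs => integral_finsetSum _ fun t ht => hYi s hs t ht
    _ ≤ ∑ s ∈ J, ∑ t ∈ J, ((if near s t then (v s + v t) / 2 else 0) + 4 * B ^ 2 * α k) :=
        Finset.sum_le_sum fun s hs => Finset.sum_le_sum fun t ht => hpair s hs t ht
    _ = (∑ s ∈ J, ∑ t ∈ J, (if near s t then v s else 0) +
          ∑ s ∈ J, ∑ t ∈ J, (if near s t then v t else 0)) / 2 +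
          (J.card : ℝ) ^ 2 * (4 * B ^ 2 * α k) := by
        simp_rw [Finset.sum_add_distrib, Finset.sum_const, nsmul_eq_mul]
        rw [← Finset.sum_add_distrib, Finset.sum_div]
        congr 1
        · refine Finset.sum_congr rfl fun s _ => ?_
          rw [← Finset.sum_add_distrib, Finset.sum_div]
          refine Finset.sum_congr rfl fun t _ => ?_
          split_ifs <;> simp
        · ring
    _ ≤ _ := by rw [hsymm]; linarith

/-- Time is cut into blocks of length `m` and only those of parity `p` are kept. Consecutive kept
blocks are then separated by a whole block, so their sums satisfy the general inequality with
coefficient `α m`. -/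
theorem measure_block_sum_ge_le (hF : IsMixingFamily P T F α) (hα : Antitone α)
    (hα0 : ∀ k, 0 ≤ α k) {Y : ℕ → Ω → ℝ} {B : ℝ} (hB : 0 < B)
    (hYm : ∀ t ∈ Finset.Icc 1 T, Measurable[F t t] (Y t))
    (hYB : ∀ t ∈ Finset.Icc 1 T, ∀ ω, |Y t ω| ≤ B)
    (hY0 : ∀ t ∈ Finset.Icc 1 T, ∫ ω, Y t ω ∂P = 0) {k m N : ℕ} (hk : 1 ≤ k) (hm : 1 ≤ m)
    (hN : 0 < N) {l x : ℝ} (hl : 0 ≤ l) (hlB : l * (m * B) ≤ 1) (hx : 0 < x) (p : ℕ) (hp : p < 2) :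
    P.real {ω | 2 * x ≤ ∑ t ∈ Finset.Icc 1 T with (t - 1) / m % 2 = p, Y t ω} ≤
      Real.exp (-(l * x)) * Real.exp (l ^ 2 * (2 * k * ∑ t ∈ Finset.Icc 1 T, ∫ ω, Y t ω ^ 2 ∂P +
        T * ((m : ℝ) ^ 2 * (4 * B ^ 2 * α k)))) +
        T * ((N + 1) * α m + 4 * x⁻¹ * (m * B) / N) := by
  set J : ℕ → Finset ℕ := fun i => (Finset.Icc 1 T).filter fun t => (t - 1) / m = 2 * i + p
    with hJdef
  have hJ : ∀ i, J i ⊆ Finset.Icc 1 T := fun i => Finset.filter_subset _ _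
  have hJb : ∀ i, ∀ t ∈ J i, (2 * i + p) * m + 1 ≤ t ∧ t ≤ (2 * i + p) * m + m := by
    intro i t ht
    obtain ⟨h1, h2⟩ := Finset.mem_filter.1 ht
    have h3 := (Nat.div_eq_iff (by omega)).1 h2
    have h4 := (Finset.mem_Icc.1 h1).1
    rw [mul_comm] at h3
    rw [mul_comm] at h3
    constructor <;> omega
  have hJcard : ∀ i, ((J i).card : ℝ) ≤ m := fun i => by
    have h1 : J i ⊆ Finset.Icc ((2 * i + p) * m + 1) ((2 * i + p) * m + m) := fun t ht =>
      Finset.mem_Icc.2 (hJb i t ht)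
    have h2 := Finset.card_le_card h1
    rw [Nat.card_Icc] at h2
    exact_mod_cast h2.trans (by omega)
  have hYm' : ∀ t ∈ Finset.Icc 1 T, Measurable (Y t) := fun t ht => hF.measurable ht (hYm t ht)
  have hdecomp : ∀ f : ℕ → ℝ, ∑ t ∈ Finset.Icc 1 T with (t - 1) / m % 2 = p, f t =
      ∑ i ∈ Finset.range T, ∑ t ∈ J i, f t := fun f => by
    rw [← Finset.sum_fiberwise_of_maps_to (g := fun t => (t - 1) / m / 2) (t := Finset.range T)]
    · refine Finset.sum_congr rfl fun i _ => Finset.sum_congr ?_ fun _ _ => rfl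
      ext t
      simp only [hJdef, Finset.mem_filter]
      constructor
      · rintro ⟨⟨h1, h2⟩, h3⟩
        exact ⟨h1, by omega⟩
      · rintro ⟨h1, h2⟩
        exact ⟨⟨h1, by omega⟩, by omega⟩
    · intro t ht
      have h1 := Finset.mem_Icc.1 (Finset.mem_filter.1 ht).1
      have h2 : (t - 1) / m ≤ t - 1 := Nat.div_le_self _ _
      rw [Finset.mem_range]
      omega
  simp_rw [hdecomp fun t => Y t _]
  -- The last time of the kept block before the `i`-th, capped at `T`. For `i = 0` there is no past;
  -- the subtraction would truncate when `p = 0`, so the trivial σ-algebra is used instead.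
  set t0 : ℕ → ℕ := fun i => min ((2 * i + p - 1) * m) T with ht0
  set mp : ℕ → MeasurableSpace Ω := fun i => if i = 0 then ⊥ else F 1 (t0 i) with hmpdef
  set mf : ℕ → MeasurableSpace Ω := fun i => if i = 0 then F 1 T else F (t0 i + m) T with hmfdef
  -- Using `T` as the number of blocks is crude but harmless: blocks beyond time `T` are empty sums.
  have hmain := measure_sum_ge_le (P := P) (K := T) (X := fun i ω => ∑ t ∈ J i, Y t ω) (mp := mp)
    (mf := mf) (α := α m) (M := m * B) (l := l) (x := x) (N := N)
    (v := fun i => 2 * k * ∑ t ∈ J i, ∫ ω, Y t ω ^ 2 ∂P + (m : ℝ) ^ 2 * (4 * B ^ 2 * α k))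
    (mul_pos (by exact_mod_cast hm) hB) hx hl hlB hN
    (fun i => by
      simp only [hmpdef]
      split_ifs
      · exact bot_le
      · exact hF.le _ _ le_rfl (min_le_right _ _))
    (fun i => by
      simp only [hmfdef]
      split_ifs
      · exact hF.le _ _ le_rfl le_rfl
      · exact hF.le _ _ (by omega) le_rfl)
    (fun i _ j hj => Finset.measurable_sum _ fun t ht => by
      have h1 := Finset.mem_Icc.1 (hJ j ht)
      have h2 := hJb j t ht
      refine (hYm t (hJ j ht)).mono ?_ le_rfl
      simp only [hmpdef, if_neg (show i ≠ 0 by omega)]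
      refine hF.mono _ _ _ _ h1.1 (le_min (h2.2.trans ?_) h1.2)
      rw [← Nat.succ_mul]
      exact Nat.mul_le_mul_right m (by omega))
    (fun i _ => Finset.measurable_sum _ fun t ht => by
      have h1 := Finset.mem_Icc.1 (hJ i ht)
      have h2 := hJb i t ht
      refine (hYm t (hJ i ht)).mono ?_ le_rfl
      simp only [hmfdef]
      split_ifs with hi
      · exact hF.mono _ _ _ _ h1.1 h1.2
      · refine hF.mono _ _ _ _ ?_ h1.2
        have h3 : t0 i ≤ (2 * i + p - 1) * m := min_le_left _ _
        have h4 : (2 * i + p) * m = (2 * i + p - 1) * m + m := by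
          rw [← Nat.succ_mul]; congr 1; omega
        omega)
    (fun i _ => by
      simp only [hmpdef, hmfdef]
      split_ifs
      · exact IsAlphaMixing.of_bot (hα0 m)
      · exact hF.mixing _ _ hm (min_le_right _ _))
    (fun i _ ω => by
      refine (Finset.abs_sum_le_sum_abs _ _).trans ?_
      refine (Finset.sum_le_sum fun t ht => hYB t (hJ i ht) ω).trans ?_
      rw [Finset.sum_const, nsmul_eq_mul]
      exact mul_le_mul_of_nonneg_right (hJcard i) hB.le)
    (fun i _ => by
      rw [integral_finsetSum _ fun t ht =>
        integrable_of_abs_le (hYm' t (hJ i ht)) (hYB t (hJ i ht))]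
      exact Finset.sum_eq_zero fun t ht => hY0 t (hJ i ht))
    (fun i _ => by
      refine (hF.integral_sum_sq_le hα hB hYm hYB hY0 hk (hJ i)).trans ?_
      have : ((J i).card : ℝ) ^ 2 ≤ (m : ℝ) ^ 2 :=
        pow_le_pow_left₀ (Nat.cast_nonneg _) (hJcard i) 2
      have h0 : 0 ≤ 4 * B ^ 2 * α k := mul_nonneg (by positivity) (hα0 k)
      nlinarith)
  refine hmain.trans ?_
  gcongr
  rw [Finset.sum_add_distrib, ← Finset.mul_sum, Finset.sum_const, Finset.card_range, nsmul_eq_mul]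
  have : ∑ i ∈ Finset.range T, ∑ t ∈ J i, ∫ ω, Y t ω ^ 2 ∂P ≤
      ∑ t ∈ Finset.Icc 1 T, ∫ ω, Y t ω ^ 2 ∂P := by
    rw [← hdecomp]
    exact Finset.sum_le_sum_of_subset_of_nonneg (Finset.filter_subset _ _)
      fun t _ _ => integral_nonneg fun ω => sq_nonneg _
  gcongr

/-- A Bernstein-type inequality for bounded variables with geometric mixing, by blocking. -/
theorem measure_sum_ge_le (hF : IsMixingFamily P T F α) (hα : Antitone α)
    (hα0 : ∀ k, 0 ≤ α k) {Y : ℕ → Ω → ℝ} {B : ℝ} (hB : 0 < B)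
    (hYm : ∀ t ∈ Finset.Icc 1 T, Measurable[F t t] (Y t))
    (hYB : ∀ t ∈ Finset.Icc 1 T, ∀ ω, |Y t ω| ≤ B)
    (hY0 : ∀ t ∈ Finset.Icc 1 T, ∫ ω, Y t ω ∂P = 0) {k m N : ℕ} (hk : 1 ≤ k) (hm : 1 ≤ m)
    (hN : 0 < N) {l x : ℝ} (hl : 0 ≤ l) (hlB : l * (m * B) ≤ 1) (hx : 0 < x) :
    P.real {ω | 4 * x ≤ ∑ t ∈ Finset.Icc 1 T, Y t ω} ≤
      2 * (Real.exp (-(l * x)) *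
        Real.exp (l ^ 2 * (2 * k * ∑ t ∈ Finset.Icc 1 T, ∫ ω, Y t ω ^ 2 ∂P +
          T * ((m : ℝ) ^ 2 * (4 * B ^ 2 * α k)))) +
        T * ((N + 1) * α m + 4 * x⁻¹ * (m * B) / N)) := by
  have h := fun p hp => hF.measure_block_sum_ge_le hα hα0 hB hYm hYB hY0 hk hm hN hl hlB hx p hp
  have hsub : {ω | 4 * x ≤ ∑ t ∈ Finset.Icc 1 T, Y t ω} ⊆
      {ω | 2 * x ≤ ∑ t ∈ Finset.Icc 1 T with (t - 1) / m % 2 = 0, Y t ω} ∪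
      {ω | 2 * x ≤ ∑ t ∈ Finset.Icc 1 T with (t - 1) / m % 2 = 1, Y t ω} := by
    intro ω hω
    have hω : 4 * x ≤ ∑ t ∈ Finset.Icc 1 T, Y t ω := hω
    rw [← Finset.sum_filter_add_sum_filter_not _ fun t => (t - 1) / m % 2 = 0] at hω
    simp only [Nat.mod_two_not_eq_zero] at hω
    by_contra hcon
    rw [Set.mem_union, not_or] at hcon
    have h1 : ¬ (2 * x ≤ ∑ t ∈ Finset.Icc 1 T with (t - 1) / m % 2 = 0, Y t ω) := hcon.1
    have h2 : ¬ (2 * x ≤ ∑ t ∈ Finset.Icc 1 T with (t - 1) / m % 2 = 1, Y t ω) := hcon.2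
    linarith
  have := (measureReal_mono hsub).trans (measureReal_union_le (μ := P) _ _)
  linarith [h 0 (by norm_num), h 1 (by norm_num)]

end IsMixingFamily

end Blocks

/-! ### Concentration at logarithmic scales -/

section Concentration

theorem eventually_rpow_le_exp {β c : ℝ} (hβ : 0 < β) (hc : 0 < c) (s : ℝ) :
    ∀ᶠ u : ℝ in atTop, u ^ s ≤ Real.exp (c * u ^ β) := by
  have h := (tendsto_rpow_mul_exp_neg_mul_atTop_nhds_zero (s / β) c hc).comp (tendsto_rpow_atTop hβ)
  filter_upwards [h.eventually_le_const one_pos, eventually_ge_atTop 0] with u hu hu0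
  simp only [Function.comp] at hu
  rw [← Real.rpow_mul hu0, mul_div_cancel₀ _ hβ.ne', neg_mul, Real.exp_neg,
    mul_inv_le_iff₀ (Real.exp_pos _), one_mul] at hu
  exact hu

/-- To be read with `u = log T`. Blocks of length `u ^ (2 / β)` make the mixing coefficient at most
`exp (-c * u ^ 2)`, smaller than every power of `T`, and thus able to absorb a grid of about `T ^ (q
+ 2)` cells. In the variance bound the lag `⌈u⌉` suffices, since there mixing only has to beat
powers of `u`. -/
theorem eventually_block_parameters {a c β q : ℝ} (hc : 0 < c) (hβ : 0 < β) (hq : 0 ≤ q) :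
    ∀ᶠ u : ℝ in atTop, 16 ≤ u ∧
      (⌈u ^ (2 / β)⌉₊ : ℝ) * u ^ a ≤ Real.exp (u / 2) ∧
      (⌈u ^ (2 / β)⌉₊ : ℝ) ^ 2 * (4 * (u ^ a) ^ 2 * Real.exp (-c * (⌈u⌉₊ : ℝ) ^ β)) ≤ u ∧
      2 * (Real.exp (-((q + 7) * u)) * Real.exp (4 * u) +
        Real.exp u * (((⌈Real.exp ((q + 2) * u)⌉₊ : ℝ) + 1) *
          Real.exp (-c * (⌈u ^ (2 / β)⌉₊ : ℝ) ^ β) + 4 / (⌈Real.exp ((q + 2) * u)⌉₊ : ℝ))) ≤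
        Real.exp (-(q * u)) := by
  filter_upwards [eventually_ge_atTop (16 : ℝ),
    eventually_rpow_le_exp (β := 1) one_pos (c := 1 / 2) (by norm_num) (2 / β + a + 1),
    eventually_rpow_le_exp hβ hc (2 * (2 / β) + 2 * a + 3),
    tendsto_atTop.1 ((tendsto_id (α := ℝ)).const_mul_atTop hc) (2 * q + 4)] with u hu h1 h2 h3
  have hu0 : 0 < u := by linarith
  have hm1 : (1 : ℝ) ≤ u ^ (2 / β) := Real.one_le_rpow (by linarith) (by positivity)
  have hm : (⌈u ^ (2 / β)⌉₊ : ℝ) ≤ u ^ (2 / β) * u := by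
    have := (Nat.ceil_lt_add_one (a := u ^ (2 / β)) (by positivity)).le
    nlinarith
  have ha : 0 < u ^ a := by positivity
  refine ⟨hu, ?_, ?_, ?_⟩
  · calc (⌈u ^ (2 / β)⌉₊ : ℝ) * u ^ a ≤ u ^ (2 / β) * u * u ^ a := by gcongr
      _ = u ^ (2 / β + a + 1) := by rw [Real.rpow_add_one hu0.ne', Real.rpow_add hu0]; ring
      _ ≤ Real.exp (1 / 2 * u ^ (1 : ℝ)) := h1
      _ = Real.exp (u / 2) := by rw [Real.rpow_one]; ring_nf
  · have hk : Real.exp (-c * (⌈u⌉₊ : ℝ) ^ β) ≤ Real.exp (-(c * u ^ β)) := by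
      rw [neg_mul]
      exact Real.exp_le_exp.2 (neg_le_neg (mul_le_mul_of_nonneg_left
        (Real.rpow_le_rpow hu0.le (Nat.le_ceil u) hβ.le) hc.le))
    have e : u ^ (2 * (2 / β) + 2 * a + 3) = (u ^ (2 / β) * u) ^ 2 * (u ^ a) ^ 2 * u := by
      rw [show (3 : ℝ) = ((3 : ℕ) : ℝ) by norm_num, Real.rpow_add_natCast hu0.ne',
        Real.rpow_add hu0, mul_comm 2 (2 / β), mul_comm 2 a, Real.rpow_mul hu0.le,
        Real.rpow_mul hu0.le]
      simp only [Real.rpow_ofNat]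
      ring
    rw [e] at h2
    have h4 : (u ^ (2 / β) * u) ^ 2 * (u ^ a) ^ 2 * Real.exp (-(c * u ^ β)) ≤ u⁻¹ := by
      rw [Real.exp_neg, mul_inv_le_iff₀ (Real.exp_pos _), ← div_eq_inv_mul, le_div_iff₀ hu0]
      exact h2
    calc (⌈u ^ (2 / β)⌉₊ : ℝ) ^ 2 * (4 * (u ^ a) ^ 2 * Real.exp (-c * (⌈u⌉₊ : ℝ) ^ β))
        ≤ (u ^ (2 / β) * u) ^ 2 * (4 * (u ^ a) ^ 2 * Real.exp (-(c * u ^ β))) := by gcongr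
      _ = 4 * ((u ^ (2 / β) * u) ^ 2 * (u ^ a) ^ 2 * Real.exp (-(c * u ^ β))) := by ring
      _ ≤ 4 * 1 := by
          gcongr
          exact h4.trans (inv_le_one_of_one_le₀ (by linarith))
      _ ≤ u := by linarith
  · have hN1 := Nat.le_ceil (Real.exp ((q + 2) * u))
    have hN2 := (Nat.ceil_lt_add_one (Real.exp_pos ((q + 2) * u)).le).le
    set N : ℝ := (⌈Real.exp ((q + 2) * u)⌉₊ : ℝ)
    have hmb : Real.exp (-c * (⌈u ^ (2 / β)⌉₊ : ℝ) ^ β) ≤ Real.exp (-((2 * q + 4) * u)) := by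
      have e : u ^ (2 : ℕ) ≤ (⌈u ^ (2 / β)⌉₊ : ℝ) ^ β := by
        calc u ^ (2 : ℕ) = (u ^ (2 / β)) ^ β := by
              rw [← Real.rpow_mul hu0.le, div_mul_cancel₀ _ hβ.ne', Real.rpow_ofNat]
          _ ≤ _ := Real.rpow_le_rpow (by positivity) (Nat.le_ceil _) hβ.le
      refine Real.exp_le_exp.2 ?_
      simp only [id] at h3
      nlinarith [mul_le_mul_of_nonneg_left e hc.le, mul_le_mul_of_nonneg_right h3 hu0.le]
    have h16 : 16 ≤ Real.exp u := by linarith [Real.add_one_le_exp u]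
    have t1 : Real.exp (-((q + 7) * u)) * Real.exp (4 * u) ≤ Real.exp (-((q + 1) * u)) := by
      rw [← Real.exp_add]; exact Real.exp_le_exp.2 (by nlinarith)
    have t2 : Real.exp u * (4 / N) ≤ 4 * Real.exp (-((q + 1) * u)) := by
      have : 4 / N ≤ 4 / Real.exp ((q + 2) * u) := by gcongr
      calc Real.exp u * (4 / N) ≤ Real.exp u * (4 / Real.exp ((q + 2) * u)) := by gcongr
        _ = 4 * (Real.exp u * Real.exp (-((q + 2) * u))) := by rw [Real.exp_neg]; ring
        _ = _ := by rw [← Real.exp_add]; ring_nf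
    have t3 : Real.exp u * ((N + 1) * Real.exp (-c * (⌈u ^ (2 / β)⌉₊ : ℝ) ^ β)) ≤
        3 * Real.exp (-((q + 1) * u)) := by
      have : N + 1 ≤ 3 * Real.exp ((q + 2) * u) := by
        linarith [Real.one_le_exp (show 0 ≤ (q + 2) * u by positivity)]
      calc _ ≤ Real.exp u * ((3 * Real.exp ((q + 2) * u)) * Real.exp (-((2 * q + 4) * u))) := by
            gcongr
        _ = 3 * (Real.exp u * Real.exp ((q + 2) * u) * Real.exp (-((2 * q + 4) * u))) := by ring
        _ = _ := by rw [← Real.exp_add, ← Real.exp_add]; ring_nf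
    have t4 : 16 * Real.exp (-((q + 1) * u)) ≤ Real.exp (-(q * u)) := by
      have : Real.exp (-(q * u)) = Real.exp u * Real.exp (-((q + 1) * u)) := by
        rw [← Real.exp_add]; ring_nf
      rw [this]
      gcongr
    rw [mul_add (Real.exp u)]
    linarith

universe u

theorem antitone_exp_neg_mul_rpow {c β : ℝ} (hc : 0 < c) (hβ : 0 < β) :
    Antitone fun k : ℕ => Real.exp (-c * (k : ℝ) ^ β) := fun k k' h => by
  simp only [neg_mul]
  exact Real.exp_le_exp.2 (neg_le_neg (mul_le_mul_of_nonneg_left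
    (Real.rpow_le_rpow (Nat.cast_nonneg _) (by exact_mod_cast h) hβ.le) hc.le))

/-- Concentration of sums of exponentially mixing variables that are bounded by a power of `log T`:
the deviations are of order `√(V T) log T` up to polynomially small probability. -/
theorem eventually_measure_sum_ge_le (a : ℝ) {c β : ℝ} (q : ℝ) (hc : 0 < c) (hβ : 0 < β)
    (hq : 0 ≤ q) :
    ∀ᶠ T : ℕ in atTop, ∀ (Ω : Type u) (_ : MeasurableSpace Ω) (P : Measure Ω)
      [IsProbabilityMeasure P] (F : ℕ → ℕ → MeasurableSpace Ω)
      (_ : IsMixingFamily P T F fun k => Real.exp (-c * (k : ℝ) ^ β)) (Y : ℕ → Ω → ℝ) (V : ℝ),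
      1 ≤ V → (∀ t ∈ Finset.Icc 1 T, Measurable[F t t] (Y t)) →
      (∀ t ∈ Finset.Icc 1 T, ∀ ω, |Y t ω| ≤ Real.log T ^ a) →
      (∀ t ∈ Finset.Icc 1 T, ∫ ω, Y t ω ∂P = 0) →
      ∑ t ∈ Finset.Icc 1 T, ∫ ω, Y t ω ^ 2 ∂P ≤ V * T →
      P.real {ω | 4 * ((q + 7) * Real.sqrt (V * T) * Real.log T) ≤ ∑ t ∈ Finset.Icc 1 T, Y t ω} ≤
        (T : ℝ) ^ (-q) := by
  have hlog : Tendsto (fun T : ℕ => Real.log T) atTop atTop :=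
    Real.tendsto_log_atTop.comp tendsto_natCast_atTop_atTop
  filter_upwards [hlog.eventually (eventually_block_parameters (a := a) (q := q) hc hβ hq),
    eventually_ge_atTop 1] with T ⟨h16, h2, h3, h4⟩ hT1 Ω m0 P _ F hF Y V hV hYm hYB hY0 hvar
  have hT : (0 : ℝ) < T := by exact_mod_cast hT1
  set u := Real.log T with hu
  have hexp : Real.exp u = T := Real.exp_log hT
  set w := Real.sqrt (V * T) with hw
  have hw2 : w ^ 2 = V * T := Real.sq_sqrt (by positivity)
  have hwpos : 0 < w := Real.sqrt_pos.2 (by positivity)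
  have hexpw : Real.exp (u / 2) ≤ w := by
    have : Real.exp (u / 2) ^ 2 = T := by
      rw [← Real.exp_nat_mul, ← hexp]; push_cast; ring_nf
    refine le_of_sq_le_sq ?_ hwpos.le
    rw [this, hw2]
    nlinarith
  have hk1 : 1 ≤ ⌈u⌉₊ := Nat.one_le_iff_ne_zero.2 (Nat.ceil_pos.2 (by linarith)).ne'
  have hm1 : 1 ≤ ⌈u ^ (2 / β)⌉₊ :=
    Nat.one_le_iff_ne_zero.2 (Nat.ceil_pos.2 (Real.rpow_pos_of_pos (by linarith) _)).ne'
  have hN1 : 0 < ⌈Real.exp ((q + 2) * u)⌉₊ := Nat.ceil_pos.2 (Real.exp_pos _)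
  have hxw : w ≤ (q + 7) * w * u := by nlinarith [mul_pos hwpos (by linarith : 0 < u)]
  have hx : 0 < (q + 7) * w * u := hwpos.trans_le hxw
  have hmB : (⌈u ^ (2 / β)⌉₊ : ℝ) * u ^ a ≤ w := h2.trans hexpw
  -- With `l = w⁻¹` the linear term of the exponent is `(q + 7) * u` and the quadratic one at most
  -- `4 * u`: up to `3 * u` from near pairs and `u` from distant ones.
  have hmain := hF.measure_sum_ge_le (antitone_exp_neg_mul_rpow hc hβ)
    (fun k => (Real.exp_pos _).le) (Real.rpow_pos_of_pos (by linarith) a) hYm hYB hY0 hk1 hm1 hN1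
    (l := w⁻¹) (inv_pos.2 hwpos).le
    (by rw [inv_mul_le_iff₀ hwpos, mul_one]; exact hmB) hx
  refine hmain.trans ?_
  have hpow : (T : ℝ) ^ (-q) = Real.exp (-(q * u)) := by
    rw [Real.rpow_def_of_pos hT, ← hu]; ring_nf
  rw [hpow]
  refine le_trans ?_ h4
  have e1 : w⁻¹ * ((q + 7) * w * u) = (q + 7) * u := by field_simp
  rw [e1, hexp]
  have hceil : (⌈u⌉₊ : ℝ) ≤ u + 1 := (Nat.ceil_lt_add_one (by linarith)).le
  have hE : w⁻¹ ^ 2 * (2 * (⌈u⌉₊ : ℝ) * ∑ t ∈ Finset.Icc 1 T, ∫ ω, Y t ω ^ 2 ∂P +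
      T * ((⌈u ^ (2 / β)⌉₊ : ℝ) ^ 2 *
        (4 * (u ^ a) ^ 2 * Real.exp (-c * (⌈u⌉₊ : ℝ) ^ β)))) ≤ 4 * u := by
    rw [inv_pow, hw2, inv_mul_le_iff₀ (by positivity)]
    have b1 : 2 * (⌈u⌉₊ : ℝ) * ∑ t ∈ Finset.Icc 1 T, ∫ ω, Y t ω ^ 2 ∂P ≤ 3 * u * (V * T) := by
      have : 2 * (⌈u⌉₊ : ℝ) ≤ 3 * u := by linarith
      have hs : 0 ≤ ∑ t ∈ Finset.Icc 1 T, ∫ ω, Y t ω ^ 2 ∂P :=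
        Finset.sum_nonneg fun t _ => integral_nonneg fun ω => sq_nonneg _
      exact mul_le_mul this hvar hs (by linarith)
    have b2 : (T : ℝ) * u ≤ u * (V * T) := by nlinarith [mul_pos hT (by linarith : 0 < u)]
    linarith [mul_le_mul_of_nonneg_left h3 hT.le]
  have hX : 4 * ((q + 7) * w * u)⁻¹ * (⌈u ^ (2 / β)⌉₊ * u ^ a) ≤ 4 := by
    have : ((q + 7) * w * u)⁻¹ * (⌈u ^ (2 / β)⌉₊ * u ^ a) ≤ 1 := by
      rw [inv_mul_le_iff₀ hx, mul_one]
      exact hmB.trans hxw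
    linarith
  exact mul_le_mul_of_nonneg_left (add_le_add
    (mul_le_mul_of_nonneg_left (Real.exp_le_exp.2 hE) (Real.exp_pos _).le)
    (mul_le_mul_of_nonneg_left (add_le_add le_rfl
      (div_le_div_of_nonneg_right hX (Nat.cast_nonneg _))) hT.le)) zero_le_two

/-- Beyond the level the error is at most `|z|`, and `|z| ≤ z ^ 2 / (2 * w) + w / 2`. The free
weight `w` lets second moments and exceedance probabilities jointly control the bias of truncation.
-/
theorem abs_sub_clamp_le {B w z : ℝ} (hB : 0 ≤ B) (hw : 0 < w) :
    |z - max (-B) (min B z)| ≤ z ^ 2 / (2 * w) + w / 2 * (if B < |z| then 1 else 0) := by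
  split_ifs with h
  · have h1 : |z - max (-B) (min B z)| ≤ |z| := by
      rcases le_total 0 z with hz | hz
      · rw [abs_of_nonneg hz] at h ⊢
        rw [min_eq_left h.le, max_eq_right (by linarith), abs_le]
        constructor <;> linarith
      · rw [abs_of_nonpos hz] at h ⊢
        rw [min_eq_right (by linarith), max_eq_left (by linarith), abs_le]
        constructor <;> linarith
    refine h1.trans ?_
    rw [← sq_abs z]
    have : |z| ^ 2 / (2 * w) + w / 2 * 1 - |z| = (|z| - w) ^ 2 / (2 * w) := by
      field_simp; ring
    have h2 : 0 ≤ (|z| - w) ^ 2 / (2 * w) := by positivity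
    linarith
  · rw [not_lt, abs_le] at h
    rw [min_eq_right h.2, max_eq_right h.1, sub_self, abs_zero]
    positivity

theorem sq_clamp_le {B z : ℝ} (hB : 0 ≤ B) : max (-B) (min B z) ^ 2 ≤ z ^ 2 := by
  rw [sq_le_sq]
  rcases le_total 0 z with hz | hz
  · rw [max_eq_right (by linarith [le_min hB hz]), abs_of_nonneg (le_min hB hz), abs_of_nonneg hz]
    exact min_le_right _ _
  · rw [min_eq_right (hz.trans hB), abs_of_nonpos (max_le (by linarith) hz), abs_of_nonpos hz]
    exact neg_le_neg (le_max_right _ _)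

/-- Concentration of sums of exponentially mixing variables with light tails. -/
theorem eventually_measure_abs_sum_sub_ge_le (a : ℝ) {c β : ℝ} (q : ℝ) (hc : 0 < c) (hβ : 0 < β)
    (hq : 0 ≤ q) :
    ∀ᶠ T : ℕ in atTop, ∀ (Ω : Type u) (_ : MeasurableSpace Ω) (P : Measure Ω)
      [IsProbabilityMeasure P] (F : ℕ → ℕ → MeasurableSpace Ω)
      (_ : IsMixingFamily P T F fun k => Real.exp (-c * (k : ℝ) ^ β)) (Z : ℕ → Ω → ℝ) (V : ℝ),
      1 ≤ V → (∀ t ∈ Finset.Icc 1 T, Measurable[F t t] (Z t)) →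
      (∀ t ∈ Finset.Icc 1 T, Integrable (fun ω => Z t ω ^ 2) P) →
      (∀ t ∈ Finset.Icc 1 T, P.real {ω | Real.log T ^ a < |Z t ω|} ≤ (T : ℝ) ^ (-(q + 2))) →
      ∑ t ∈ Finset.Icc 1 T, ∫ ω, Z t ω ^ 2 ∂P ≤ V * T →
      P.real {ω | (4 * q + 33) * (Real.sqrt (V * T) * Real.log T) <
        |∑ t ∈ Finset.Icc 1 T, (Z t ω - ∫ ω, Z t ω ∂P)|} ≤ (T : ℝ) ^ (-q) := by
  have hlog : Tendsto (fun T : ℕ => Real.log T) atTop atTop :=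
    Real.tendsto_log_atTop.comp tendsto_natCast_atTop_atTop
  -- The larger power `a + 1` absorbs the bound `2 * B` of the recentred clamped variables. The
  -- larger exponent `q + 1` pays for three exceptional events: two one-sided deviations and an
  -- actual truncation.
  filter_upwards [eventually_measure_sum_ge_le.{u} (a + 1) (q + 1) hc hβ (by linarith),
    hlog.eventually_ge_atTop 2, eventually_ge_atTop 3]
    with T hconc hu2 hT3 Ω m0 P _ F hF Z V hV hZm hZ2 hZB hvar
  have hT3' : (3 : ℝ) ≤ T := by exact_mod_cast hT3
  have hT : (0 : ℝ) < T := by linarith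
  set u := Real.log T with hu
  set w := Real.sqrt (V * T) with hw
  have hw2 : w ^ 2 = V * T := Real.sq_sqrt (by positivity)
  have hwpos : 0 < w := Real.sqrt_pos.2 (by positivity)
  set B := u ^ a with hB
  have hBpos : 0 < B := Real.rpow_pos_of_pos (by linarith) a
  set Z' : ℕ → Ω → ℝ := fun t ω => max (-B) (min B (Z t ω)) with hZ'
  have hZ'm : ∀ t ∈ Finset.Icc 1 T, Measurable[F t t] (Z' t) := fun t ht =>
    measurable_const.max (measurable_const.min (hZm t ht))
  have hZ'B : ∀ t ω, |Z' t ω| ≤ B := fun t ω =>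
    abs_le.2 ⟨le_max_left _ _, max_le (by linarith) (min_le_left _ _)⟩
  have hZ'i : ∀ t ∈ Finset.Icc 1 T, Integrable (Z' t) P := fun t ht =>
    integrable_of_abs_le (hF.measurable ht (hZ'm t ht)) (hZ'B t)
  have hZmeas : ∀ t ∈ Finset.Icc 1 T, Measurable (Z t) := fun t ht => hF.measurable ht (hZm t ht)
  have hZi : ∀ t ∈ Finset.Icc 1 T, Integrable (Z t) P := fun t ht =>
    ((memLp_two_iff_integrable_sq (hZmeas t ht).aestronglyMeasurable).2 (hZ2 t ht)).integrable
      one_le_two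
  set μ' : ℕ → ℝ := fun t => ∫ ω, Z' t ω ∂P with hμ'
  have hμ'B : ∀ t, |μ' t| ≤ B := fun t => by
    have := norm_integral_le_of_norm_le_const (μ := P) (f := Z' t) (C := B)
      (ae_of_all _ fun ω => by simpa using hZ'B t ω)
    simpa using this
  have hBu : B + B ≤ u ^ (a + 1) := by
    rw [Real.rpow_add_one (by linarith)]
    nlinarith
  have hY0 : ∀ t ∈ Finset.Icc 1 T, ∫ ω, (Z' t ω - μ' t) ∂P = 0 := fun t ht => by
    rw [integral_sub (hZ'i t ht) (integrable_const _)]; simp [hμ']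
  have hYvar : ∀ t ∈ Finset.Icc 1 T, ∫ ω, (Z' t ω - μ' t) ^ 2 ∂P ≤ ∫ ω, Z t ω ^ 2 ∂P :=
    fun t ht => by
      have hZ'2 : Integrable (fun ω => Z' t ω ^ 2) P :=
        integrable_of_abs_le ((hF.measurable ht (hZ'm t ht)).pow_const 2) (B := B ^ 2)
          fun ω => by rw [abs_pow]; exact pow_le_pow_left₀ (abs_nonneg _) (hZ'B t ω) 2
      have e : ∀ ω, (Z' t ω - μ' t) ^ 2 = Z' t ω ^ 2 + -2 * μ' t * Z' t ω + μ' t ^ 2 := fun ω => by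
        ring
      simp_rw [e]
      rw [integral_add (hZ'2.fun_add ((hZ'i t ht).const_mul _)) (integrable_const _),
        integral_add hZ'2 ((hZ'i t ht).const_mul _), integral_const_mul]
      have h1 : ∫ ω, Z' t ω ^ 2 ∂P ≤ ∫ ω, Z t ω ^ 2 ∂P :=
        integral_mono hZ'2 (hZ2 t ht) fun ω => sq_clamp_le hBpos.le
      simp only [integral_const, probReal_univ, one_smul]
      change ∫ ω, Z' t ω ^ 2 ∂P + -2 * μ' t * μ' t + μ' t ^ 2 ≤ _
      nlinarith [sq_nonneg (μ' t)]
  have hvar' : ∑ t ∈ Finset.Icc 1 T, ∫ ω, (Z' t ω - μ' t) ^ 2 ∂P ≤ V * T :=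
    (Finset.sum_le_sum hYvar).trans hvar
  have hup := hconc Ω m0 P F hF (fun t ω => Z' t ω - μ' t) V hV
    (fun t ht => (hZ'm t ht).sub_const _)
    (fun t _ ω => (abs_sub _ _).trans ((add_le_add (hZ'B t ω) (hμ'B t)).trans hBu)) hY0 hvar'
  have hdown := hconc Ω m0 P F hF (fun t ω => -(Z' t ω - μ' t)) V hV
    (fun t ht => ((hZ'm t ht).sub_const _).neg)
    (fun t _ ω => by
      rw [abs_neg]; exact (abs_sub _ _).trans ((add_le_add (hZ'B t ω) (hμ'B t)).trans hBu))
    (fun t ht => by rw [integral_neg, hY0 t ht, neg_zero])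
    (by simpa only [neg_sq] using hvar')
  -- Taking `w` as the weight balances the total truncation bias: second moments and exceedance
  -- probabilities contribute at most `w / 2` each. This adds the last unit in `4 * q + 33 = 4 * (q
  -- + 1 + 7) + 1`.
  have hshift : ∑ t ∈ Finset.Icc 1 T, |∫ ω, Z t ω ∂P - μ' t| ≤ w := by
    have h1 : ∀ t ∈ Finset.Icc 1 T, |∫ ω, Z t ω ∂P - μ' t| ≤
        (∫ ω, Z t ω ^ 2 ∂P) / (2 * w) + w / 2 * (T : ℝ) ^ (-(q + 2)) := fun t ht => by
      have hset : MeasurableSet {ω | B < |Z t ω|} :=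
        measurableSet_lt measurable_const (hZmeas t ht).abs
      have hind : Integrable ({ω | B < |Z t ω|}.indicator fun _ => (1 : ℝ)) P :=
        (integrable_const 1).indicator hset
      rw [← integral_sub (hZi t ht) (hZ'i t ht)]
      refine (abs_integral_le_integral_abs).trans ?_
      have : ∫ ω, |Z t ω - Z' t ω| ∂P ≤ ∫ ω, (Z t ω ^ 2 / (2 * w) +
          w / 2 * {ω | B < |Z t ω|}.indicator (fun _ => (1 : ℝ)) ω) ∂P :=
        integral_mono ((hZi t ht).sub (hZ'i t ht)).abs
          (((hZ2 t ht).div_const _).add (hind.const_mul _)) fun ω =>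
            abs_sub_clamp_le hBpos.le hwpos
      rw [integral_add ((hZ2 t ht).div_const _) (hind.const_mul _), integral_div,
        integral_const_mul, integral_indicator_const _ hset, smul_eq_mul, mul_one] at this
      refine this.trans ?_
      gcongr
      exact hZB t ht
    refine (Finset.sum_le_sum h1).trans ?_
    rw [Finset.sum_add_distrib, ← Finset.sum_div, Finset.sum_const, Nat.card_Icc, nsmul_eq_mul]
    have h2 : (∑ t ∈ Finset.Icc 1 T, ∫ ω, Z t ω ^ 2 ∂P) / (2 * w) ≤ w / 2 := by
      rw [div_le_iff₀ (by positivity)]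
      nlinarith
    have h3 : ((T + 1 - 1 : ℕ) : ℝ) * (w / 2 * (T : ℝ) ^ (-(q + 2))) ≤ w / 2 := by
      have e : (T : ℝ) * (T : ℝ) ^ (-(q + 2)) ≤ 1 := by
        rw [mul_comm, ← Real.rpow_add_one hT.ne']
        exact Real.rpow_le_one_of_one_le_of_nonpos (by linarith) (by linarith)
      rw [Nat.add_sub_cancel]
      calc (T : ℝ) * (w / 2 * (T : ℝ) ^ (-(q + 2))) = w / 2 * (T * (T : ℝ) ^ (-(q + 2))) := by ring
        _ ≤ w / 2 * 1 := by gcongr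
        _ = w / 2 := mul_one _
    linarith
  set A : Set Ω := {ω | 4 * ((q + 1 + 7) * w * u) ≤ ∑ t ∈ Finset.Icc 1 T, (Z' t ω - μ' t)}
  set A' : Set Ω := {ω | 4 * ((q + 1 + 7) * w * u) ≤ ∑ t ∈ Finset.Icc 1 T, -(Z' t ω - μ' t)}
  set E : Set Ω := ⋃ t ∈ Finset.Icc 1 T, {ω | B < |Z t ω|}
  have hE : P.real E ≤ T * (T : ℝ) ^ (-(q + 2)) := by
    refine (measureReal_biUnion_finset_le _ _).trans ((Finset.sum_le_sum hZB).trans ?_)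
    rw [Finset.sum_const, Nat.card_Icc, nsmul_eq_mul, Nat.add_sub_cancel]
  have hsub : {ω | (4 * q + 33) * (w * u) < |∑ t ∈ Finset.Icc 1 T, (Z t ω - ∫ ω, Z t ω ∂P)|} ⊆
      A ∪ A' ∪ E := by
    intro ω hω
    by_contra hcon
    simp only [Set.mem_union, not_or] at hcon
    obtain ⟨⟨hA, hA'⟩, hE'⟩ := hcon
    have hω : (4 * q + 33) * (w * u) < |∑ t ∈ Finset.Icc 1 T, (Z t ω - ∫ ω, Z t ω ∂P)| := hω
    have hA : ¬ 4 * ((q + 1 + 7) * w * u) ≤ ∑ t ∈ Finset.Icc 1 T, (Z' t ω - μ' t) := hA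
    have hA' : ¬ 4 * ((q + 1 + 7) * w * u) ≤ ∑ t ∈ Finset.Icc 1 T, -(Z' t ω - μ' t) := hA'
    rw [Finset.sum_neg_distrib] at hA'
    have hZZ' : ∀ t ∈ Finset.Icc 1 T, Z' t ω = Z t ω := fun t ht => by
      have : ¬ B < |Z t ω| := fun h => hE' (Set.mem_biUnion ht h)
      rw [not_lt, abs_le] at this
      simp only [hZ']
      rw [min_eq_right this.2, max_eq_right this.1]
    have e : ∑ t ∈ Finset.Icc 1 T, (Z t ω - ∫ ω, Z t ω ∂P) =
        ∑ t ∈ Finset.Icc 1 T, (Z' t ω - μ' t) - ∑ t ∈ Finset.Icc 1 T, (∫ ω, Z t ω ∂P - μ' t) := by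
      rw [← Finset.sum_sub_distrib]
      exact Finset.sum_congr rfl fun t ht => by rw [hZZ' t ht]; ring
    have h1 : |∑ t ∈ Finset.Icc 1 T, (∫ ω, Z t ω ∂P - μ' t)| ≤ w :=
      (Finset.abs_sum_le_sum_abs _ _).trans hshift
    have h2 : |∑ t ∈ Finset.Icc 1 T, (Z' t ω - μ' t)| ≤ 4 * ((q + 1 + 7) * w * u) :=
      abs_le.2 ⟨by linarith, by linarith⟩
    rw [e] at hω
    have h3 := abs_sub (∑ t ∈ Finset.Icc 1 T, (Z' t ω - μ' t))
      (∑ t ∈ Finset.Icc 1 T, (∫ ω, Z t ω ∂P - μ' t))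
    nlinarith
  have hfin : P.real (A ∪ A' ∪ E) ≤ 3 * (T : ℝ) ^ (-(q + 1)) := by
    have h1 := measureReal_union_le (μ := P) (A ∪ A') E
    have h2 := measureReal_union_le (μ := P) A A'
    have h3 : (T : ℝ) * (T : ℝ) ^ (-(q + 2)) = (T : ℝ) ^ (-(q + 1)) := by
      rw [mul_comm, ← Real.rpow_add_one hT.ne']; ring_nf
    rw [h3] at hE
    linarith
  refine (measureReal_mono hsub).trans (hfin.trans ?_)
  have : (T : ℝ) ^ (-q) = (T : ℝ) ^ (-(q + 1)) * T := by
    rw [← Real.rpow_add_one hT.ne']; ring_nf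
  rw [this, mul_comm]
  gcongr

end Concentration

/-! ### Deterministic perturbation theory for principal components -/

section Perturbation

theorem abs_sum_mul_le_card {ι : Type*} [Fintype ι] {x y : ι → ℝ} {a b : ℝ} (ha : 0 ≤ a)
    (hx : ∀ i, |x i| ≤ a) (hy : ∀ i, |y i| ≤ b) :
    |∑ i, x i * y i| ≤ Fintype.card ι * (a * b) := by
  refine (Finset.abs_sum_le_sum_abs _ _).trans ?_
  refine (Finset.sum_le_card_nsmul _ _ (a * b) fun i _ => ?_).trans_eq (by simp)
  rw [abs_mul]
  exact mul_le_mul (hx i) (hy i) (abs_nonneg _) ha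

theorem abs_sum_mul_le_of_sum_sq {ι : Type*} [Fintype ι] {x y : ι → ℝ} {a b : ℝ} (ha : 0 ≤ a)
    (hb : 0 ≤ b) (hx : ∑ i, x i ^ 2 ≤ a ^ 2) (hy : ∑ i, y i ^ 2 ≤ b ^ 2) :
    |∑ i, x i * y i| ≤ a * b := by
  refine abs_le_of_sq_le_sq ?_ (by positivity)
  refine (Finset.sum_mul_sq_le_sq_mul_sq _ _ _).trans ?_
  rw [mul_pow]
  exact mul_le_mul hx hy (Finset.sum_nonneg fun i _ => sq_nonneg _) (sq_nonneg _)

theorem dotProduct_self_eq_sum_sq {ι : Type*} [Fintype ι] (v : ι → ℝ) :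
    v ⬝ᵥ v = ∑ i, v i ^ 2 := by
  simp [dotProduct, sq]

theorem abs_quadratic_le {r : ℕ} {D : Fin r → Fin r → ℝ} {η : ℝ} (hD : ∀ i k, |D i k| ≤ η)
    (q : Fin r → ℝ) : |∑ i, q i * ∑ k, q k * D i k| ≤ η * r * (q ⬝ᵥ q) := by
  rcases Nat.eq_zero_or_pos r with rfl | hr
  · simp
  have hη : 0 ≤ η := (abs_nonneg _).trans (hD ⟨0, hr⟩ ⟨0, hr⟩)
  have hs1 : (∑ i, |q i|) ^ 2 ≤ r * (q ⬝ᵥ q) := by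
    have := sq_sum_le_card_mul_sum_sq (s := Finset.univ) (f := fun i => |q i|)
    simpa [dotProduct_self_eq_sum_sq] using this
  have h1 : ∀ i, |∑ k, q k * D i k| ≤ (∑ k, |q k|) * η := fun i => by
    refine (Finset.abs_sum_le_sum_abs _ _).trans ?_
    rw [Finset.sum_mul]
    refine Finset.sum_le_sum fun k _ => ?_
    rw [abs_mul]
    exact mul_le_mul_of_nonneg_left (hD i k) (abs_nonneg _)
  have h2 : |∑ i, q i * ∑ k, q k * D i k| ≤ (∑ i, |q i|) * ((∑ k, |q k|) * η) := by
    refine (Finset.abs_sum_le_sum_abs _ _).trans ?_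
    rw [Finset.sum_mul]
    refine Finset.sum_le_sum fun i _ => ?_
    rw [abs_mul]
    exact mul_le_mul_of_nonneg_left (h1 i) (abs_nonneg _)
  nlinarith [mul_le_mul_of_nonneg_left hs1 hη]

/-- Courant–Fischer lower bound: if the quadratic form of `S` is at least `κ |v|²` on the range of
an injective `Λ` of rank `r`, the leading `r` eigenvalues of `S` are at least `κ`. -/
theorem le_eigenvalue_of_forall_range {n r : ℕ} {S : Matrix (Fin n) (Fin n) ℝ}
    {w : Fin n → Fin n → ℝ} {μ : Fin n → ℝ}
    (horth : ∀ j k, w j ⬝ᵥ w k = if j = k then 1 else 0) (hμ : Antitone μ)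
    (heig : ∀ j, S *ᵥ w j = μ j • w j) (Λ : Matrix (Fin n) (Fin r) ℝ) {κ : ℝ}
    (hinj : ∀ u, Λ *ᵥ u = 0 → u = 0)
    (hquad : ∀ u, κ * (Λ *ᵥ u ⬝ᵥ Λ *ᵥ u) ≤ Λ *ᵥ u ⬝ᵥ S *ᵥ (Λ *ᵥ u)) {j : Fin n} (hj : j.val < r) :
    κ ≤ μ j := by
  -- Dimension count: `j < r` orthogonality conditions on `r` unknowns leave a nonzero solution. Its
  -- image under `Λ` sees only eigenvalues at most `μ j`.
  obtain ⟨u, hu0, hu⟩ : ∃ u : Fin r → ℝ, u ≠ 0 ∧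
      ∀ k : Fin j.val, w (Fin.castLE j.isLt.le k) ⬝ᵥ Λ *ᵥ u = 0 := by
    have hker := LinearMap.ker_ne_bot_of_finrank_lt
      (f := (Matrix.of (fun (k : Fin j.val) => w (Fin.castLE j.isLt.le k)) * Λ).mulVecLin)
      (by simpa using hj)
    obtain ⟨u, hu, hu0⟩ := (Submodule.ne_bot_iff _).1 hker
    refine ⟨u, hu0, fun k => ?_⟩
    rw [LinearMap.mem_ker, Matrix.mulVecLin_apply, ← Matrix.mulVec_mulVec] at hu
    exact congrFun hu k
  set v := Λ *ᵥ u with hv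
  have hv0 : v ≠ 0 := fun h => hu0 (hinj u h)
  set c : Fin n → ℝ := fun k => w k ⬝ᵥ v with hc
  have hW : Matrix.of w * (Matrix.of w)ᵀ = 1 := by
    ext a b
    rw [Matrix.mul_apply', Matrix.one_apply]
    exact horth a b
  have hW' : (Matrix.of w)ᵀ * Matrix.of w = 1 := mul_eq_one_comm.1 hW
  have hexp : v = ∑ k, c k • w k := by
    have : v = (Matrix.of w)ᵀ *ᵥ (Matrix.of w *ᵥ v) := by
      rw [Matrix.mulVec_mulVec, hW', Matrix.one_mulVec]
    rw [this]
    ext i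
    simp only [Matrix.mulVec, dotProduct, Matrix.transpose_apply, Matrix.of_apply,
      Finset.sum_apply, Pi.smul_apply, smul_eq_mul, hc]
    exact Finset.sum_congr rfl fun k _ => mul_comm _ _
  have hnorm : v ⬝ᵥ v = ∑ k, c k ^ 2 := by
    nth_rw 2 [hexp]
    rw [dotProduct_sum]
    refine Finset.sum_congr rfl fun k _ => ?_
    rw [dotProduct_smul, dotProduct_comm, smul_eq_mul, sq]
  have hS : v ⬝ᵥ S *ᵥ v = ∑ k, μ k * c k ^ 2 := by
    nth_rw 2 [hexp]
    rw [Matrix.mulVec_sum, dotProduct_sum]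
    refine Finset.sum_congr rfl fun k _ => ?_
    rw [Matrix.mulVec_smul, heig, dotProduct_smul, dotProduct_smul, dotProduct_comm, smul_eq_mul,
      smul_eq_mul]
    ring
  have hle : v ⬝ᵥ S *ᵥ v ≤ μ j * (v ⬝ᵥ v) := by
    rw [hS, hnorm, Finset.mul_sum]
    refine Finset.sum_le_sum fun k _ => ?_
    by_cases hk : k < j
    · have : c k = 0 := hu ⟨k.val, hk⟩
      simp [this]
    · exact mul_le_mul_of_nonneg_right (hμ (not_lt.1 hk)) (sq_nonneg _)
  have hpos : 0 < v ⬝ᵥ v := by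
    rw [dotProduct_self_eq_sum_sq]
    obtain ⟨i, hi⟩ := Function.ne_iff.1 hv0
    exact Finset.sum_pos' (fun i _ => sq_nonneg _) ⟨i, Finset.mem_univ _, by
      have : v i ≠ 0 := hi
      positivity⟩
  exact le_of_mul_le_mul_right ((hquad u).trans hle) hpos

theorem dotProduct_sampleCov_mulVec {n : ℕ} (T : ℕ) (x : ℕ → Fin n → ℝ) (v : Fin n → ℝ) :
    v ⬝ᵥ sampleCov T x *ᵥ v = (T : ℝ)⁻¹ * ∑ t ∈ Finset.Icc 1 T, (v ⬝ᵥ x t) ^ 2 := by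
  rw [sampleCov, Matrix.smul_mulVec, dotProduct_smul, Matrix.sum_mulVec, dotProduct_sum,
    smul_eq_mul]
  congr 1
  refine Finset.sum_congr rfl fun t _ => ?_
  rw [Matrix.vecMulVec_mulVec, dotProduct_smul, dotProduct_comm (x t) v]
  simp [sq]

section

variable {n r T : ℕ} {Λ : Matrix (Fin n) (Fin r) ℝ} {f : ℕ → Fin r → ℝ} {ε : ℕ → Fin n → ℝ}

/-- From `(a + b) ^ 2 ≥ a ^ 2 / 2 - b ^ 2`, the factor part contributes at least `c / 4 * n` times
the squared norm of `Λ *ᵥ u`. The idiosyncratic second-moment matrix has Frobenius norm at most `n *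
ρ`, hence removes at most `c / 8 * n`. -/
theorem mul_le_dotProduct_sampleCov {c ρ : ℝ} (hρ : 0 ≤ ρ) (hρc : ρ ≤ c / 8)
    (hΛ : ∀ u, c * n * (u ⬝ᵥ u) ≤ Λ *ᵥ u ⬝ᵥ Λ *ᵥ u)
    (hF : ∀ j k, |(T : ℝ)⁻¹ * ∑ t ∈ Finset.Icc 1 T, f t j * f t k - if j = k then 1 else 0| ≤
      1 / (2 * (r + 1)))
    (hE : ∀ i, ∑ k, ((T : ℝ)⁻¹ * ∑ t ∈ Finset.Icc 1 T, ε t i * ε t k) ^ 2 ≤ n * ρ ^ 2)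
    (u : Fin r → ℝ) :
    c / 8 * n * (Λ *ᵥ u ⬝ᵥ Λ *ᵥ u) ≤
      Λ *ᵥ u ⬝ᵥ sampleCov T (fun t => Λ *ᵥ f t + ε t) *ᵥ (Λ *ᵥ u) := by
  rw [dotProduct_sampleCov_mulVec]
  set v := Λ *ᵥ u with hv
  set q : Fin r → ℝ := v ᵥ* Λ with hq
  have hT0 : (0 : ℝ) ≤ (T : ℝ)⁻¹ := by positivity
  have hvv : 0 ≤ v ⬝ᵥ v := by rw [dotProduct_self_eq_sum_sq]; positivity
  have hqq : 0 ≤ q ⬝ᵥ q := by rw [dotProduct_self_eq_sum_sq]; positivity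
  have hsplit : (T : ℝ)⁻¹ * ∑ t ∈ Finset.Icc 1 T, (v ⬝ᵥ (Λ *ᵥ f t + ε t)) ^ 2 ≥
      1 / 2 * ((T : ℝ)⁻¹ * ∑ t ∈ Finset.Icc 1 T, (q ⬝ᵥ f t) ^ 2) -
        (T : ℝ)⁻¹ * ∑ t ∈ Finset.Icc 1 T, (v ⬝ᵥ ε t) ^ 2 := by
    rw [ge_iff_le, mul_left_comm, ← mul_sub]
    refine mul_le_mul_of_nonneg_left ?_ hT0
    rw [Finset.mul_sum, ← Finset.sum_sub_distrib]
    refine Finset.sum_le_sum fun t _ => ?_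
    rw [dotProduct_add, Matrix.dotProduct_mulVec]
    nlinarith [sq_nonneg (q ⬝ᵥ f t + 2 * (v ⬝ᵥ ε t))]
  have hdouble : ∀ {m : ℕ} (z : Fin m → ℝ) (y : ℕ → Fin m → ℝ),
      (T : ℝ)⁻¹ * ∑ t ∈ Finset.Icc 1 T, (z ⬝ᵥ y t) ^ 2 =
        ∑ i, z i * ∑ k, z k * ((T : ℝ)⁻¹ * ∑ t ∈ Finset.Icc 1 T, y t i * y t k) := by
    intro m z y
    have h1 : ∀ t, (z ⬝ᵥ y t) ^ 2 = ∑ i, ∑ k, z i * (z k * (y t i * y t k)) := fun t => by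
      rw [sq, dotProduct, Finset.sum_mul_sum]
      exact Finset.sum_congr rfl fun i _ => Finset.sum_congr rfl fun k _ => by ring
    simp_rw [h1]
    rw [Finset.sum_comm, Finset.mul_sum]
    refine Finset.sum_congr rfl fun i _ => ?_
    rw [Finset.sum_comm, Finset.mul_sum, Finset.mul_sum]
    refine Finset.sum_congr rfl fun k _ => ?_
    simp_rw [← Finset.mul_sum]
    ring
  have hfac : 1 / 2 * (q ⬝ᵥ q) ≤ (T : ℝ)⁻¹ * ∑ t ∈ Finset.Icc 1 T, (q ⬝ᵥ f t) ^ 2 := by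
    rw [hdouble]
    set D : Fin r → Fin r → ℝ := fun j k =>
      (T : ℝ)⁻¹ * ∑ t ∈ Finset.Icc 1 T, f t j * f t k - if j = k then 1 else 0 with hD
    have e : ∑ i, q i * ∑ k, q k * ((T : ℝ)⁻¹ * ∑ t ∈ Finset.Icc 1 T, f t i * f t k) =
        q ⬝ᵥ q + ∑ i, q i * ∑ k, q k * D i k := by
      rw [dotProduct, ← Finset.sum_add_distrib]
      refine Finset.sum_congr rfl fun i _ => ?_
      have : ∑ k, q k * ((T : ℝ)⁻¹ * ∑ t ∈ Finset.Icc 1 T, f t i * f t k) =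
          ∑ k, q k * D i k + ∑ k, q k * (if i = k then 1 else 0) := by
        rw [← Finset.sum_add_distrib]
        exact Finset.sum_congr rfl fun k _ => by rw [hD]; ring
      rw [this]
      simp
      ring
    have hb : |∑ i, q i * ∑ k, q k * D i k| ≤ 1 / 2 * (q ⬝ᵥ q) := by
      refine (abs_quadratic_le hF q).trans ?_
      rw [one_div_mul_eq_div, div_mul_eq_mul_div, div_le_iff₀ (by positivity)]
      nlinarith
    rw [e]
    linarith [(abs_le.1 hb).1]
  have hidio : (T : ℝ)⁻¹ * ∑ t ∈ Finset.Icc 1 T, (v ⬝ᵥ ε t) ^ 2 ≤ n * ρ * (v ⬝ᵥ v) := by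
    rw [hdouble]
    have hsv : √(v ⬝ᵥ v) ^ 2 = v ⬝ᵥ v := Real.sq_sqrt hvv
    have hsn : √(n : ℝ) ^ 2 = n := Real.sq_sqrt (Nat.cast_nonneg n)
    have h1 : ∀ i, |∑ k, v k * ((T : ℝ)⁻¹ * ∑ t ∈ Finset.Icc 1 T, ε t i * ε t k)| ≤
        √(v ⬝ᵥ v) * (√n * ρ) := fun i => by
      refine abs_sum_mul_le_of_sum_sq (Real.sqrt_nonneg _) (by positivity) ?_ ?_
      · rw [hsv, dotProduct_self_eq_sum_sq]
      · rw [mul_pow, hsn]; exact hE i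
    have h2 := abs_sum_mul_le_of_sum_sq (x := v)
      (y := fun i => ∑ k, v k * ((T : ℝ)⁻¹ * ∑ t ∈ Finset.Icc 1 T, ε t i * ε t k))
      (a := √(v ⬝ᵥ v)) (b := √n * (√(v ⬝ᵥ v) * (√n * ρ))) (Real.sqrt_nonneg _) (by positivity)
      (by rw [hsv, dotProduct_self_eq_sum_sq]) (by
        calc ∑ i, (∑ k, v k * ((T : ℝ)⁻¹ * ∑ t ∈ Finset.Icc 1 T, ε t i * ε t k)) ^ 2
            ≤ ∑ i : Fin n, (√(v ⬝ᵥ v) * (√n * ρ)) ^ 2 := Finset.sum_le_sum fun i _ =>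
              sq_le_sq' (by linarith [(abs_le.1 (h1 i)).1]) (abs_le.1 (h1 i)).2
          _ = (√n * (√(v ⬝ᵥ v) * (√n * ρ))) ^ 2 := by
              rw [Finset.sum_const, Finset.card_univ, Fintype.card_fin, nsmul_eq_mul,
                mul_pow (√(n : ℝ)), hsn])
    refine (le_abs_self _).trans (h2.trans_eq ?_)
    calc √(v ⬝ᵥ v) * (√n * (√(v ⬝ᵥ v) * (√n * ρ))) = √(n : ℝ) ^ 2 * ρ * √(v ⬝ᵥ v) ^ 2 := by ring
      _ = _ := by rw [hsv, hsn]
  -- The lower bound for `Λᵀ Λ` is transferred to `Λ Λᵀ` on the range of `Λ`: `v ⬝ᵥ v = q ⬝ᵥ u`, to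
  -- which Cauchy–Schwarz applies.
  have hqlow : c * n * (v ⬝ᵥ v) ≤ q ⬝ᵥ q := by
    have h1 : q ⬝ᵥ u = v ⬝ᵥ v := by rw [hq, ← Matrix.dotProduct_mulVec]
    have huu : 0 ≤ u ⬝ᵥ u := by rw [dotProduct_self_eq_sum_sq]; positivity
    have h2 : (v ⬝ᵥ v) ^ 2 ≤ (q ⬝ᵥ q) * (u ⬝ᵥ u) := by
      rw [← h1, dotProduct_self_eq_sum_sq, dotProduct_self_eq_sum_sq]
      exact Finset.sum_mul_sq_le_sq_mul_sq _ _ _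
    have h3 := hΛ u
    by_contra hcon
    have h0 : 0 < v ⬝ᵥ v := by
      rcases hvv.eq_or_lt with h | h
      · rw [← h] at hcon; simp only [mul_zero, not_le] at hcon; linarith
      · exact h
    have h4 : (q ⬝ᵥ q) * (u ⬝ᵥ u) ≤ c * n * (v ⬝ᵥ v) * (u ⬝ᵥ u) :=
      mul_le_mul_of_nonneg_right (not_le.1 hcon).le huu
    have huu0 : 0 < u ⬝ᵥ u := by
      rcases huu.eq_or_lt with h | h
      · rw [← h, mul_zero] at h2; nlinarith
      · exact h
    have h5 : (q ⬝ᵥ q) * (u ⬝ᵥ u) < c * n * (v ⬝ᵥ v) * (u ⬝ᵥ u) :=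
      mul_lt_mul_of_pos_right (not_le.1 hcon) huu0
    nlinarith
  have hnρ : n * ρ * (v ⬝ᵥ v) ≤ c / 8 * n * (v ⬝ᵥ v) := by
    refine mul_le_mul_of_nonneg_right ?_ hvv
    rw [mul_comm]
    exact mul_le_mul_of_nonneg_right hρc (Nat.cast_nonneg n)
  linarith

theorem sampleCov_factor_eq :
    sampleCov T (fun t => Λ *ᵥ f t + ε t) =
      Λ * Matrix.of (fun j k => (T : ℝ)⁻¹ * ∑ t ∈ Finset.Icc 1 T, f t j * f t k) * Λᵀ +
      Λ * (Matrix.of fun i j => (T : ℝ)⁻¹ * ∑ t ∈ Finset.Icc 1 T, f t j * ε t i)ᵀ +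
      Matrix.of (fun i j => (T : ℝ)⁻¹ * ∑ t ∈ Finset.Icc 1 T, f t j * ε t i) * Λᵀ +
      Matrix.of (fun i k => (T : ℝ)⁻¹ * ∑ t ∈ Finset.Icc 1 T, ε t i * ε t k) := by
  have hF : Matrix.of (fun j k => (T : ℝ)⁻¹ * ∑ t ∈ Finset.Icc 1 T, f t j * f t k) =
      (T : ℝ)⁻¹ • ∑ t ∈ Finset.Icc 1 T, Matrix.vecMulVec (f t) (f t) := by
    ext j k; simp [Matrix.sum_apply, Matrix.vecMulVec_apply]
  have hG : Matrix.of (fun i j => (T : ℝ)⁻¹ * ∑ t ∈ Finset.Icc 1 T, f t j * ε t i) =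
      (T : ℝ)⁻¹ • ∑ t ∈ Finset.Icc 1 T, Matrix.vecMulVec (ε t) (f t) := by
    ext j k; simp [Matrix.sum_apply, Matrix.vecMulVec_apply, mul_comm]
  have hE : Matrix.of (fun i k => (T : ℝ)⁻¹ * ∑ t ∈ Finset.Icc 1 T, ε t i * ε t k) =
      (T : ℝ)⁻¹ • ∑ t ∈ Finset.Icc 1 T, Matrix.vecMulVec (ε t) (ε t) := by
    ext j k; simp [Matrix.sum_apply, Matrix.vecMulVec_apply]
  rw [hF, hG, hE, sampleCov]
  simp only [Matrix.transpose_smul, Matrix.transpose_sum, Matrix.transpose_vecMulVec,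
    Matrix.mul_smul, Matrix.smul_mul, ← smul_add, Matrix.mul_sum, Matrix.sum_mul,
    ← Finset.sum_add_distrib]
  congr 1
  refine Finset.sum_congr rfl fun t _ => ?_
  simp only [Matrix.mul_vecMulVec, Matrix.vecMulVec_mul, Matrix.vecMul_transpose,
    Matrix.add_vecMulVec, Matrix.vecMulVec_add]
  abel

/-- If the orthonormal columns of `W` are close to the range of `Λ`, entry by entry, then so are the
projection on their span and the identity on the range of `Λ`. -/
theorem abs_projection_sub_le {W R : Matrix (Fin n) (Fin r) ℝ} {A : Matrix (Fin r) (Fin r) ℝ}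
    {s lam CA CR CW ρ φ ψ : ℝ} (hs : 0 < s) (hsn : s ^ 2 = n) (hsρ : 1 / s ≤ ρ)
    (hCA : 0 ≤ CA) (hCR : 0 ≤ CR) (hlam : 0 ≤ lam) (hφ : 0 ≤ φ) (hψ : 0 ≤ ψ)
    (hCW : CW = r * (lam * CA) + CR) (hρ1 : ρ ≤ 1) (hρ : CW * CR * ρ ≤ 1 / (2 * (r + 1)))
    (hWW : Wᵀ * W = 1) (hW : W = Λ * A + R) (hΛ : ∀ i j, |Λ i j| ≤ lam)
    (hA : ∀ i j, |A i j| ≤ CA / s) (hR : ∀ i j, |R i j| ≤ CR * ρ / s)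
    {y : Fin r → ℝ} {e : Fin n → ℝ} (hy : ∀ j, |y j| ≤ φ) (he : ∀ i, |e i| ≤ ψ)
    (hΛe : ∀ j, |(Λᵀ *ᵥ e) j| ≤ s * ψ) (i : Fin n) :
    |(W *ᵥ (Wᵀ *ᵥ (Λ *ᵥ y + e))) i - (Λ *ᵥ y) i| ≤
      (2 * r ^ 2 * (CR * (1 + r * CW ^ 2)) * lam + r * CW * (r * CA + CR)) * (ρ * (φ + ψ)) := by
  have hρ0 : 0 ≤ ρ := le_trans (by positivity) hsρ
  have hCW0 : 0 ≤ CW := by rw [hCW]; positivity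
  have hWb : ∀ i j, |W i j| ≤ CW / s := fun i j => by
    have h1 : |(Λ * A) i j| ≤ r * (lam * (CA / s)) := by
      rw [Matrix.mul_apply]
      simpa using abs_sum_mul_le_card hlam (hΛ i) (fun k => hA k j)
    have h2 : CR * ρ / s ≤ CR / s := by
      gcongr
      exact mul_le_of_le_one_right hCR hρ1
    calc |W i j| = |(Λ * A) i j + R i j| := by rw [hW, Matrix.add_apply]
      _ ≤ r * (lam * (CA / s)) + CR / s :=
        (abs_add_le _ _).trans (add_le_add h1 ((hR i j).trans h2))
      _ = CW / s := by rw [hCW]; ring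
  set Q : Matrix (Fin r) (Fin r) ℝ := Wᵀ * R with hQ
  have hQb : ∀ j k, |Q j k| ≤ CW * CR * ρ := fun j k => by
    rw [hQ, Matrix.mul_apply]
    refine (abs_sum_mul_le_card (by positivity) (fun i => hWb i j) (fun i => hR i k)).trans_eq ?_
    rw [Fintype.card_fin, ← hsn]
    field_simp
  -- Orthonormality makes `A` almost an inverse of `Wᵀ Λ`. The defect `Q` has row sums at most
  -- `1/2`, so `1 - Q` is strictly diagonally dominant and hence invertible.
  have hBA : Wᵀ * Λ * A = 1 - Q := by
    rw [← hWW, hQ]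
    nth_rw 3 [hW]
    rw [Matrix.mul_add, Matrix.mul_assoc, add_sub_cancel_right]
  have hQlt : ∀ j, ∑ k, |Q j k| ≤ 1 / 2 := fun j => by
    calc ∑ k, |Q j k| ≤ ∑ _k : Fin r, 1 / (2 * ((r : ℝ) + 1)) :=
          Finset.sum_le_sum fun k _ => (hQb j k).trans hρ
      _ = r * (1 / (2 * ((r : ℝ) + 1))) := by simp
      _ ≤ 1 / 2 := by rw [mul_one_div, div_le_div_iff₀ (by positivity) (by norm_num)]; linarith
  have hdet : (1 - Q).det ≠ 0 := by
    refine det_ne_zero_of_sum_row_lt_diag fun k => ?_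
    have h1 : ∑ j ∈ Finset.univ.erase k, ‖(1 - Q) k j‖ =
        ∑ j ∈ Finset.univ.erase k, |Q k j| := by
      refine Finset.sum_congr rfl fun j hj => ?_
      rw [Matrix.sub_apply, Matrix.one_apply_ne (Finset.ne_of_mem_erase hj).symm, zero_sub,
        norm_neg, Real.norm_eq_abs]
    have h2 : |Q k k| + ∑ j ∈ Finset.univ.erase k, |Q k j| = ∑ j, |Q k j| :=
      Finset.add_sum_erase Finset.univ (fun j => |Q k j|) (Finset.mem_univ k)
    have h3 : 1 - |Q k k| ≤ ‖(1 - Q) k k‖ := by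
      rw [Matrix.sub_apply, Matrix.one_apply_eq, Real.norm_eq_abs]
      have := abs_sub_abs_le_abs_sub 1 (Q k k)
      rwa [abs_one] at this
    have h4 := hQlt k
    rw [h1]
    linarith
  have hunit : IsUnit (1 - Q).det := isUnit_iff_ne_zero.2 hdet
  -- The part of `Λ` missed by the projection. Multiplication by `A` reduces it to the corresponding
  -- part of `R`, and the invertibility of `1 - Q` allows `A` to be cancelled.
  set Y := Λ - W * (Wᵀ * Λ) with hY
  set Z := R - W * Q with hZ
  have hYA : Y * A = -Z := by
    have h1 : Λ * A = W - R := by rw [eq_sub_iff_add_eq, ← hW]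
    rw [hY, hZ, Matrix.sub_mul, Matrix.mul_assoc, hBA, h1, Matrix.mul_sub, Matrix.mul_one]
    abel
  set U := -Z * (1 - Q)⁻¹ with hU
  have hinv : A * ((1 - Q)⁻¹ * (Wᵀ * Λ)) = 1 := by
    rw [mul_eq_one_comm, Matrix.mul_assoc, hBA, Matrix.nonsing_inv_mul _ hunit]
  have hYU : Y = U * (Wᵀ * Λ) := by
    rw [hU, ← hYA, Matrix.mul_assoc, Matrix.mul_assoc, hinv, Matrix.mul_one]
  have hUQ : U = -Z + U * Q := by
    have : U * (1 - Q) = -Z := by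
      rw [hU, Matrix.mul_assoc, Matrix.nonsing_inv_mul _ hunit, Matrix.mul_one]
    rw [Matrix.mul_sub, Matrix.mul_one, sub_eq_iff_eq_add] at this
    exact this
  set CZ := CR * (1 + r * CW ^ 2) with hCZ
  have hZb : ∀ i j, |Z i j| ≤ CZ * ρ / s := fun i j => by
    have h1 : |(W * Q) i j| ≤ r * (CW / s * (CW * CR * ρ)) := by
      rw [Matrix.mul_apply]
      simpa using abs_sum_mul_le_card (by positivity) (hWb i) (fun k => hQb k j)
    rw [hZ, Matrix.sub_apply]
    refine (abs_sub _ _).trans ((add_le_add (hR i j) h1).trans_eq ?_)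
    rw [hCZ]; ring
  -- The fixed-point equation `U = -Z + U * Q` replaces an estimate of the inverse: `Q` at most
  -- halves row sums, which are then absorbed on the left.
  have hUsum : ∑ j, |U i j| ≤ 2 * (r * (CZ * ρ / s)) := by
    have h1 : ∀ j, |U i j| ≤ CZ * ρ / s + ∑ k, |U i k| * |Q k j| := fun j => by
      have : U i j = -Z i j + ∑ k, U i k * Q k j := by
        conv_lhs => rw [hUQ]
        rw [Matrix.add_apply, Matrix.neg_apply, Matrix.mul_apply]
      rw [this]
      refine (abs_add_le _ _).trans (add_le_add (by rw [abs_neg]; exact hZb i j) ?_)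
      refine (Finset.abs_sum_le_sum_abs _ _).trans_eq ?_
      exact Finset.sum_congr rfl fun k _ => abs_mul _ _
    have h2 : ∑ j, |U i j| ≤ r * (CZ * ρ / s) + (∑ k, |U i k|) * (1 / 2) := by
      refine (Finset.sum_le_sum fun j _ => h1 j).trans ?_
      rw [Finset.sum_add_distrib, Finset.sum_comm, Finset.sum_const, Finset.card_univ,
        Fintype.card_fin, nsmul_eq_mul, Finset.sum_mul]
      gcongr with k _
      rw [← Finset.mul_sum]
      exact mul_le_mul_of_nonneg_left (hQlt k) (abs_nonneg _)
    linarith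
  have hWΛ : ∀ j l, |(Wᵀ * Λ) j l| ≤ s * lam := fun j l => by
    rw [Matrix.mul_apply, ← one_mul (s * lam)]
    refine abs_sum_mul_le_of_sum_sq zero_le_one (by positivity) ?_ ?_
    · have := congrFun (congrFun hWW j) j
      rw [Matrix.mul_apply, Matrix.one_apply_eq] at this
      simp only [Matrix.transpose_apply] at this ⊢
      simp only [sq]
      rw [this, one_mul]
    · calc ∑ i, Λ i l ^ 2 ≤ ∑ _i : Fin n, lam ^ 2 := Finset.sum_le_sum fun i _ =>
            sq_le_sq' (abs_le.1 (hΛ i l)).1 (abs_le.1 (hΛ i l)).2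
        _ = (s * lam) ^ 2 := by simp [mul_pow, hsn]
  have hYb : ∀ l, |Y i l| ≤ 2 * (r * (CZ * ρ)) * lam := fun l => by
    rw [hYU, Matrix.mul_apply]
    refine (Finset.abs_sum_le_sum_abs _ _).trans ?_
    calc ∑ j, |U i j * (Wᵀ * Λ) j l| ≤ ∑ j, |U i j| * (s * lam) := Finset.sum_le_sum fun j _ => by
          rw [abs_mul]; exact mul_le_mul_of_nonneg_left (hWΛ j l) (abs_nonneg _)
      _ = (∑ j, |U i j|) * (s * lam) := by rw [Finset.sum_mul]
      _ ≤ 2 * (r * (CZ * ρ / s)) * (s * lam) := mul_le_mul_of_nonneg_right hUsum (by positivity)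
      _ = _ := by field_simp
  -- Bounding `Wᵀ *ᵥ e` from the entry bounds alone would only give order `s * ψ`. Splitting off `Aᵀ
  -- *ᵥ (Λᵀ *ᵥ e)` gains a factor `s` on the main part, and only the small `R` is bounded entry by
  -- entry.
  have hWe : ∀ j, |(Wᵀ *ᵥ e) j| ≤ (r * CA + s * CR * ρ) * ψ := fun j => by
    have h0 : Wᵀ *ᵥ e = Aᵀ *ᵥ (Λᵀ *ᵥ e) + Rᵀ *ᵥ e := by
      rw [hW, Matrix.transpose_add, Matrix.transpose_mul, Matrix.add_mulVec, Matrix.mulVec_mulVec]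
    have h1 : |(Aᵀ *ᵥ (Λᵀ *ᵥ e)) j| ≤ r * (CA / s * (s * ψ)) := by
      simpa [Matrix.mulVec, dotProduct] using
        abs_sum_mul_le_card (by positivity) (fun k => hA k j) hΛe
    have h2 : |(Rᵀ *ᵥ e) j| ≤ n * (CR * ρ / s * ψ) := by
      simpa [Matrix.mulVec, dotProduct] using
        abs_sum_mul_le_card (by positivity) (fun k => hR k j) he
    rw [h0, Pi.add_apply]
    refine (abs_add_le _ _).trans ((add_le_add h1 h2).trans_eq ?_)
    rw [← hsn]
    field_simp
  have hdec : (W *ᵥ (Wᵀ *ᵥ (Λ *ᵥ y + e))) i - (Λ *ᵥ y) i =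
      (W *ᵥ (Wᵀ *ᵥ e)) i - (Y *ᵥ y) i := by
    rw [hY, Matrix.sub_mulVec, Matrix.mulVec_add, Matrix.mulVec_add, ← Matrix.mulVec_mulVec,
      ← Matrix.mulVec_mulVec, Pi.add_apply, Pi.sub_apply]
    ring
  have hf1 : |(Y *ᵥ y) i| ≤ r * (2 * (r * (CZ * ρ)) * lam * φ) := by
    simpa [Matrix.mulVec, dotProduct] using abs_sum_mul_le_card (by positivity) hYb hy
  have hf2 : |(W *ᵥ (Wᵀ *ᵥ e)) i| ≤ r * (CW / s * ((r * CA + s * CR * ρ) * ψ)) := by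
    simpa only [Matrix.mulVec, dotProduct, Fintype.card_fin] using
      abs_sum_mul_le_card (by positivity) (hWb i) hWe
  have hf3 : r * (CW / s * ((r * CA + s * CR * ρ) * ψ)) ≤ r * CW * (r * CA + CR) * (ρ * ψ) := by
    have e1 : r * (CW / s * ((r * CA + s * CR * ρ) * ψ)) =
        r * CW * ψ * (r * CA * (1 / s) + CR * ρ) := by field_simp
    have e2 : r * CW * (r * CA + CR) * (ρ * ψ) = r * CW * ψ * (r * CA * ρ + CR * ρ) := by ring
    rw [e1, e2]
    gcongr
  rw [hdec]
  refine (abs_sub _ _).trans ((add_le_add (hf2.trans hf3) hf1).trans ?_)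
  have p1 : 0 ≤ 2 * (r : ℝ) ^ 2 * CZ * lam * (ρ * ψ) := by positivity
  have p2 : 0 ≤ r * CW * (r * CA + CR) * (ρ * φ) := by positivity
  nlinarith

theorem sum_filter_val_lt {n r : ℕ} (h : r ≤ n) (g : Fin n → ℝ) :
    ∑ j : Fin n with j.val < r, g j = ∑ j : Fin r, g (Fin.castLE h j) := by
  symm
  refine Finset.sum_bij (fun j _ => Fin.castLE h j) (fun j _ => ?_) (fun a _ b _ hab => ?_)
    (fun b hb => ?_) (fun _ _ => rfl)
  · simp
  · exact Fin.castLE_injective h hab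
  · exact ⟨⟨b.val, (Finset.mem_filter.1 hb).2⟩, Finset.mem_univ _, rfl⟩

/-- Deterministic error bound for the principal component estimator of the common component. -/
theorem exists_pcaEstimator_error_le (r : ℕ) {c lam : ℝ} (hc : 0 < c) (hlam : 0 ≤ lam) :
    ∃ C ρ₁ : ℝ, 0 < C ∧ 0 < ρ₁ ∧ ∀ (n T : ℕ) (Λ : Matrix (Fin n) (Fin r) ℝ) (f : ℕ → Fin r → ℝ)
      (ε x : ℕ → Fin n → ℝ) (w : Fin n → Fin n → ℝ) (ρ φ ψ : ℝ), r ≤ n → 1 ≤ n →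
      1 / √n ≤ ρ → ρ ≤ ρ₁ → 0 ≤ φ → 0 ≤ ψ → (∀ t, x t = Λ *ᵥ f t + ε t) →
      (∀ i j, |Λ i j| ≤ lam) → (∀ u, c * n * (u ⬝ᵥ u) ≤ Λ *ᵥ u ⬝ᵥ Λ *ᵥ u) →
      (∀ j k, |(T : ℝ)⁻¹ * ∑ t ∈ Finset.Icc 1 T, f t j * f t k - if j = k then 1 else 0| ≤
        1 / (2 * (r + 1))) →
      (∀ i j, |(T : ℝ)⁻¹ * ∑ t ∈ Finset.Icc 1 T, f t j * ε t i| ≤ ρ) →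
      (∀ i, ∑ k, ((T : ℝ)⁻¹ * ∑ t ∈ Finset.Icc 1 T, ε t i * ε t k) ^ 2 ≤ n * ρ ^ 2) →
      (∀ t ∈ Finset.Icc 1 T, ∀ j, |f t j| ≤ φ) → (∀ t ∈ Finset.Icc 1 T, ∀ i, |ε t i| ≤ ψ) →
      (∀ t ∈ Finset.Icc 1 T, ∀ j, |(Λᵀ *ᵥ ε t) j| ≤ √n * ψ) →
      IsOrderedEigenbasis (sampleCov T x) w →
      ∀ t ∈ Finset.Icc 1 T, ∀ i, |pcaEstimator r w (x t) i - (Λ *ᵥ f t) i| ≤ C * (ρ * (φ + ψ)) := by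
  -- These constants are the entry bounds of the undivided `A₀` and `R₀` below, times the factor `8
  -- / c` from the lower bound `c / 8 * n` on the leading eigenvalues. `CW` then bounds `s` times
  -- the entries of `W`.
  set CA : ℝ := 8 / c * (2 * r * lam + 1) with hCA
  set CR : ℝ := 8 / c * (r * lam + 1) with hCR
  set CW : ℝ := r * (lam * CA) + CR with hCW
  have hCA0 : 0 ≤ CA := by positivity
  have hCR0 : 0 ≤ CR := by positivity
  have hCW0 : 0 ≤ CW := by positivity
  -- The final `1` only ensures positivity. In the threshold for `ρ`, `c / 8` secures the eigenvalue
  -- bound, and the last fraction keeps the defect of orthogonality `Q` small.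
  refine ⟨2 * r ^ 2 * (CR * (1 + r * CW ^ 2)) * lam + r * CW * (r * CA + CR) + 1,
    min (min 1 (c / 8)) (1 / (2 * (r + 1) * (CW * CR + 1))), by positivity,
    lt_min (lt_min one_pos (by positivity)) (by positivity), ?_⟩
  intro n T Λ f ε x w ρ φ ψ hrn hn1 hsρ hρ₁ hφ hψ hx hΛb hΛq hF hG hE hf hε hΛε hw t ht i
  obtain ⟨horth, μ, hμ, heig⟩ := hw
  obtain rfl : x = fun t => Λ *ᵥ f t + ε t := funext hx
  have hn : (0 : ℝ) < n := by exact_mod_cast hn1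
  set s := √(n : ℝ) with hs
  have hs0 : 0 < s := Real.sqrt_pos.2 hn
  have hsn : s ^ 2 = n := Real.sq_sqrt hn.le
  have hρ0 : 0 ≤ ρ := le_trans (by positivity) hsρ
  have hρ1 : ρ ≤ 1 := hρ₁.trans ((min_le_left _ _).trans (min_le_left _ _))
  have hρc : ρ ≤ c / 8 := hρ₁.trans ((min_le_left _ _).trans (min_le_right _ _))
  have hρQ : CW * CR * ρ ≤ 1 / (2 * (r + 1)) := by
    have h1 := hρ₁.trans (min_le_right _ _)
    have h2 : ρ * (2 * (r + 1) * (CW * CR + 1)) ≤ 1 := by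
      rwa [le_div_iff₀ (by positivity)] at h1
    rw [le_div_iff₀ (by positivity)]
    have : 0 ≤ ρ * (2 * ((r : ℝ) + 1)) := by positivity
    nlinarith
  have hμlow : ∀ j : Fin r, c / 8 * n ≤ μ (Fin.castLE hrn j) := fun j => by
    refine le_eigenvalue_of_forall_range horth hμ heig Λ (fun u hu => ?_)
      (fun u => mul_le_dotProduct_sampleCov hρ0 hρc hΛq hF hE u) (by simp)
    have h1 := hΛq u
    rw [hu, dotProduct_zero, dotProduct_self_eq_sum_sq] at h1
    have h2 : ∑ i, u i ^ 2 ≤ 0 := by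
      by_contra hcon
      exact absurd h1 (not_le.2 (mul_pos (mul_pos hc hn) (not_le.1 hcon)))
    have h3 := (Finset.sum_eq_zero_iff_of_nonneg fun i _ => sq_nonneg (u i)).1
      (le_antisymm h2 (Finset.sum_nonneg fun i _ => sq_nonneg _))
    ext i
    exact pow_eq_zero_iff two_ne_zero |>.1 (h3 i (Finset.mem_univ i))
  set F : Matrix (Fin r) (Fin r) ℝ :=
    Matrix.of fun j k => (T : ℝ)⁻¹ * ∑ t ∈ Finset.Icc 1 T, f t j * f t k with hFdef
  set G : Matrix (Fin n) (Fin r) ℝ :=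
    Matrix.of fun i j => (T : ℝ)⁻¹ * ∑ t ∈ Finset.Icc 1 T, f t j * ε t i with hGdef
  set E : Matrix (Fin n) (Fin n) ℝ :=
    Matrix.of fun i k => (T : ℝ)⁻¹ * ∑ t ∈ Finset.Icc 1 T, ε t i * ε t k with hEdef
  set W : Matrix (Fin n) (Fin r) ℝ := Matrix.of fun i j => w (Fin.castLE hrn j) i with hWdef
  set d : Fin r → ℝ := fun j => μ (Fin.castLE hrn j) with hd
  have hdpos : ∀ j, 0 < d j := fun j => lt_of_lt_of_le (by positivity) (hμlow j)
  have hWW : Wᵀ * W = 1 := by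
    ext j k
    rw [Matrix.mul_apply', Matrix.one_apply]
    refine (horth _ _).trans ?_
    simp [Fin.ext_iff]
  have hWsq : ∀ j, ∑ i, W i j ^ 2 ≤ 1 ^ 2 := fun j => by
    have := congrFun (congrFun hWW j) j
    rw [Matrix.mul_apply, Matrix.one_apply_eq] at this
    simp only [Matrix.transpose_apply] at this
    simp only [sq]
    rw [this, one_mul]
  have hSW : sampleCov T (fun t => Λ *ᵥ f t + ε t) * W = W * Matrix.diagonal d := by
    ext i j
    rw [Matrix.mul_diagonal]
    have := congrFun (heig (Fin.castLE hrn j)) i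
    rw [Pi.smul_apply, smul_eq_mul, mul_comm] at this
    exact this
  -- Grouping by whether a summand of the sample covariance starts with `Λ` gives the decomposition
  -- `W D = Λ A₀ + R₀`.
  set A₀ := F * (Λᵀ * W) + Gᵀ * W with hA₀
  set R₀ := G * (Λᵀ * W) + E * W with hR₀
  have hWD : W * Matrix.diagonal d = Λ * A₀ + R₀ := by
    rw [← hSW, sampleCov_factor_eq, hA₀, hR₀]
    simp only [Matrix.add_mul, Matrix.mul_add, Matrix.mul_assoc]
    abel
  have hdd : Matrix.diagonal d * Matrix.diagonal (fun j => (d j)⁻¹) = 1 := by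
    rw [Matrix.diagonal_mul_diagonal, ← Matrix.diagonal_one]
    congr 1
    ext j
    exact mul_inv_cancel₀ (hdpos j).ne'
  set A := A₀ * Matrix.diagonal (fun j => (d j)⁻¹) with hA
  set R := R₀ * Matrix.diagonal (fun j => (d j)⁻¹) with hR
  have hW : W = Λ * A + R := by
    rw [hA, hR, ← Matrix.mul_assoc, ← Matrix.add_mul, ← hWD, Matrix.mul_assoc, hdd, Matrix.mul_one]
  have hΛW : ∀ l j, |(Λᵀ * W) l j| ≤ s * lam := fun l j => by
    rw [Matrix.mul_apply, ← mul_one (s * lam)]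
    refine abs_sum_mul_le_of_sum_sq (by positivity) zero_le_one ?_ (hWsq j)
    calc ∑ i, Λᵀ l i ^ 2 ≤ ∑ _i : Fin n, lam ^ 2 := Finset.sum_le_sum fun i _ =>
          sq_le_sq' (abs_le.1 (hΛb i l)).1 (abs_le.1 (hΛb i l)).2
      _ = (s * lam) ^ 2 := by simp [mul_pow, hsn]
  have hFb : ∀ j k, |F j k| ≤ 2 := fun j k => by
    have h1 : 1 / (2 * ((r : ℝ) + 1)) ≤ 1 := by
      rw [div_le_one (by positivity)]
      have : (0 : ℝ) ≤ r := Nat.cast_nonneg r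
      linarith
    have h2 := (abs_le.1 ((hF j k).trans h1))
    rw [hFdef, Matrix.of_apply, abs_le]
    split_ifs at h2 <;> constructor <;> linarith [h2.1, h2.2]
  have hA₀b : ∀ l j, |A₀ l j| ≤ s * (2 * r * lam + 1) := fun l j => by
    have h1 : |(F * (Λᵀ * W)) l j| ≤ r * (2 * (s * lam)) := by
      rw [Matrix.mul_apply]
      simpa using abs_sum_mul_le_card zero_le_two (hFb l) (fun m => hΛW m j)
    have h2 : |(Gᵀ * W) l j| ≤ s * 1 := by
      rw [Matrix.mul_apply]
      refine abs_sum_mul_le_of_sum_sq hs0.le zero_le_one ?_ (hWsq j)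
      calc ∑ k, Gᵀ l k ^ 2 ≤ ∑ _k : Fin n, (1 : ℝ) ^ 2 := Finset.sum_le_sum fun k _ =>
            sq_le_sq' (abs_le.1 ((hG k l).trans hρ1)).1 (abs_le.1 ((hG k l).trans hρ1)).2
        _ = s ^ 2 := by simp [hsn]
    rw [hA₀, Matrix.add_apply]
    refine (abs_add_le _ _).trans ((add_le_add h1 h2).trans_eq ?_)
    ring
  have hGb : ∀ i j, |G i j| ≤ ρ := hG
  have hR₀b : ∀ l j, |R₀ l j| ≤ s * ρ * (r * lam + 1) := fun l j => by
    have h1 : |(G * (Λᵀ * W)) l j| ≤ r * (ρ * (s * lam)) := by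
      rw [Matrix.mul_apply]
      simpa using abs_sum_mul_le_card hρ0 (hGb l) (fun m => hΛW m j)
    have h2 : |(E * W) l j| ≤ s * ρ * 1 := by
      rw [Matrix.mul_apply]
      refine abs_sum_mul_le_of_sum_sq (by positivity) zero_le_one ?_ (hWsq j)
      rw [mul_pow, hsn]
      exact hE l
    rw [hR₀, Matrix.add_apply]
    refine (abs_add_le _ _).trans ((add_le_add h1 h2).trans_eq ?_)
    ring
  have hdinv : ∀ j, (d j)⁻¹ ≤ 8 / c / s ^ 2 := fun j => by
    have h1 : (d j)⁻¹ ≤ (c / 8 * n)⁻¹ := inv_anti₀ (by positivity) (hμlow j)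
    refine h1.trans_eq ?_
    rw [hsn]
    field_simp
  have hAb : ∀ l j, |A l j| ≤ CA / s := fun l j => by
    rw [hA, Matrix.mul_diagonal, abs_mul, abs_of_pos (inv_pos.2 (hdpos j))]
    refine (mul_le_mul (hA₀b l j) (hdinv j) (inv_pos.2 (hdpos j)).le (by positivity)).trans_eq ?_
    rw [hCA]
    field_simp
  have hRb : ∀ l j, |R l j| ≤ CR * ρ / s := fun l j => by
    rw [hR, Matrix.mul_diagonal, abs_mul, abs_of_pos (inv_pos.2 (hdpos j))]
    refine (mul_le_mul (hR₀b l j) (hdinv j) (inv_pos.2 (hdpos j)).le (by positivity)).trans_eq ?_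
    rw [hCR]
    field_simp
  have hfin := abs_projection_sub_le hs0 hsn hsρ hCA0 hCR0 hlam hφ hψ hCW hρ1 hρQ hWW hW hΛb hAb hRb
    (hf t ht) (hε t ht) (hΛε t ht) i
  have hest : pcaEstimator r w (Λ *ᵥ f t + ε t) i = (W *ᵥ (Wᵀ *ᵥ (Λ *ᵥ f t + ε t))) i := by
    rw [pcaEstimator, sum_filter_val_lt hrn]
    rfl
  simp only
  rw [hest]
  refine hfin.trans (mul_le_mul_of_nonneg_right (by linarith) (by positivity))

end

end Perturbation

/-! ### Fourth moments and tails -/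

section Moments

variable {Ω : Type*} {m0 : MeasurableSpace Ω} {P : Measure Ω}

/-- The layer-cake formula for the fourth power; the resulting bound depends on `c` and `b` alone,
hence is uniform over times, factors and sample sizes. -/
theorem integrable_pow_four_of_tail [IsProbabilityMeasure P] {X : Ω → ℝ}
    (hX : Measurable X) {c b : ℝ} (hc : 0 < c) (hb : 0 < b)
    (htail : ∀ z : ℝ, 0 < z → P.real {ω | z < |X ω|} ≤ Real.exp (1 - (z / c) ^ b)) :
    Integrable (fun ω => X ω ^ 4) P ∧ ∫ ω, X ω ^ 4 ∂P ≤
      4 * ∫ t in Set.Ioi (0 : ℝ), Real.exp 1 * (t ^ (3 : ℝ) * Real.exp (-(c ^ b)⁻¹ * t ^ b)) := by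
  set g : ℝ → ℝ := fun t => Real.exp 1 * (t ^ (3 : ℝ) * Real.exp (-(c ^ b)⁻¹ * t ^ b)) with hg
  have hgi : IntegrableOn g (Set.Ioi 0) :=
    (integrableOn_rpow_mul_exp_neg_mul_rpow (by norm_num) hb (by positivity)).const_mul _
  have hg0 : ∀ t ∈ Set.Ioi (0 : ℝ), 0 ≤ g t := fun t ht => by
    have : (0 : ℝ) < t := ht
    positivity
  have key : ∫⁻ ω, ENNReal.ofReal (X ω ^ 4) ∂P ≤
      ENNReal.ofReal (4 * ∫ t in Set.Ioi (0 : ℝ), g t) := by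
    have h1 := lintegral_rpow_eq_lintegral_meas_lt_mul P (f := fun ω => |X ω|)
      (ae_of_all _ fun ω => abs_nonneg _) hX.abs.aemeasurable (p := 4) (by norm_num)
    have h2 : ∀ ω, |X ω| ^ (4 : ℝ) = X ω ^ 4 := fun ω => by
      rw [Real.rpow_ofNat, (by decide : Even 4).pow_abs]
    simp_rw [h2] at h1
    rw [h1, ENNReal.ofReal_mul (by norm_num)]
    gcongr
    rw [ofReal_integral_eq_lintegral_ofReal hgi
      ((ae_restrict_iff' measurableSet_Ioi).2 (ae_of_all _ hg0))]
    refine setLIntegral_mono' measurableSet_Ioi fun t ht => ?_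
    have ht0 : (0 : ℝ) < t := ht
    rw [← ofReal_measureReal, ← ENNReal.ofReal_mul measureReal_nonneg]
    refine ENNReal.ofReal_le_ofReal ?_
    refine (mul_le_mul_of_nonneg_right (htail t ht0) (by positivity)).trans_eq ?_
    rw [sub_eq_add_neg, Real.exp_add, Real.div_rpow ht0.le hc.le, hg]
    norm_num
    ring_nf
  have h0 : ∀ ω, 0 ≤ X ω ^ 4 := fun ω => by positivity
  have hm : AEStronglyMeasurable (fun ω => X ω ^ 4) P := (hX.pow_const 4).aestronglyMeasurable
  refine ⟨⟨hm, ?_⟩, ?_⟩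
  · rw [hasFiniteIntegral_iff_ofReal (ae_of_all _ h0)]
    exact key.trans_lt ENNReal.ofReal_lt_top
  · rw [integral_eq_lintegral_of_nonneg_ae (ae_of_all _ h0) hm]
    refine ENNReal.toReal_le_of_le_ofReal ?_ key
    exact mul_nonneg (by norm_num) (setIntegral_nonneg measurableSet_Ioi hg0)

theorem hasSubgaussianMGF_of_hasGaussianLaw {X : Ω → ℝ} (hX : HasGaussianLaw X P)
    (hmean : ∫ ω, X ω ∂P = 0) {v : ℝ} (hv : ∫ ω, X ω ^ 2 ∂P ≤ v) :
    HasSubgaussianMGF X v.toNNReal P := by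
  have hmap := hX.map_eq_gaussianReal
  have hvar : Var[X; P] = ∫ ω, X ω ^ 2 ∂P := variance_of_integral_eq_zero hX.aemeasurable hmean
  refine ⟨fun t => ?_, fun t => ?_⟩
  · have h1 : Integrable (fun x => Real.exp (t * x)) (Measure.map X P) := by
      rw [hmap]; exact integrable_exp_mul_gaussianReal t
    exact h1.comp_aemeasurable hX.aemeasurable
  · rw [mgf_gaussianReal hmap, hmean, zero_mul, zero_add, hvar]
    refine Real.exp_le_exp.2 ?_
    have h1 : (∫ ω, X ω ^ 2 ∂P).toNNReal ≤ v.toNNReal := Real.toNNReal_le_toNNReal hv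
    gcongr

theorem ProbabilityTheory.HasSubgaussianMGF.measure_abs_gt_le [IsProbabilityMeasure P]
    {X : Ω → ℝ} {v : NNReal} (hX : HasSubgaussianMGF X v P) {z : ℝ} (hz : 0 ≤ z) :
    P.real {ω | z < |X ω|} ≤ 2 * Real.exp (-z ^ 2 / (2 * v)) := by
  have hsub : {ω | z < |X ω|} ⊆ {ω | z ≤ X ω} ∪ {ω | z ≤ (-X) ω} := fun ω hω => by
    rcases lt_abs.1 (show z < |X ω| from hω) with h | h
    · exact Or.inl h.le
    · exact Or.inr h.le
  have h1 := (measureReal_mono hsub).trans (measureReal_union_le (μ := P) _ _)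
  linarith [hX.measure_ge_le hz, hX.neg.measure_ge_le hz]

/-- One term of the exponential series gives `x ^ 4 ≤ 24 * exp |x| ≤ 24 * (exp x + exp (-x))`, and
both exponentials have mean at most `exp (v / 2)`. -/
theorem ProbabilityTheory.HasSubgaussianMGF.integrable_pow_four {X : Ω → ℝ} {v : NNReal}
    (hX : HasSubgaussianMGF X v P) (hXm : Measurable X) :
    Integrable (fun ω => X ω ^ 4) P ∧ ∫ ω, X ω ^ 4 ∂P ≤ 48 * Real.exp (v / 2) := by
  have h1 := hX.integrable_exp_mul 1
  have h2 := hX.integrable_exp_mul (-1)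
  have hle : ∀ ω, X ω ^ 4 ≤ 24 * (Real.exp (1 * X ω) + Real.exp (-1 * X ω)) := fun ω => by
    have := Real.pow_div_factorial_le_exp |X ω| (abs_nonneg _) 4
    rw [(by decide : Even 4).pow_abs] at this
    norm_num [Nat.factorial] at this
    have h3 : Real.exp |X ω| ≤ Real.exp (X ω) + Real.exp (-X ω) := by
      rcases abs_cases (X ω) with ⟨h, _⟩ | ⟨h, _⟩ <;> rw [h]
      · linarith [Real.exp_pos (-X ω)]
      · linarith [Real.exp_pos (X ω)]
    rw [one_mul, neg_one_mul]
    linarith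
  have hi : Integrable (fun ω => 24 * (Real.exp (1 * X ω) + Real.exp (-1 * X ω))) P :=
    (h1.fun_add h2).const_mul 24
  have hX4 : Integrable (fun ω => X ω ^ 4) P :=
    hi.mono' (hXm.pow_const 4).aestronglyMeasurable (ae_of_all _ fun ω => by
      rw [Real.norm_of_nonneg (by positivity)]; exact hle ω)
  refine ⟨hX4, (integral_mono hX4 hi hle).trans ?_⟩
  rw [integral_const_mul, integral_add h1 h2]
  have h3 := hX.mgf_le 1
  have h4 := hX.mgf_le (-1)
  simp only [mgf] at h3 h4
  norm_num at h3 h4 ⊢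
  linarith

end Moments

/-! ### Concentration for sums of products -/

section Products

variable {Ω : Type*} {m0 : MeasurableSpace Ω}

/-- An adapted process with uniformly bounded fourth moments whose values exceed `b` only with
polynomially small probability. -/
structure IsLightTailed (P : Measure Ω) (T : ℕ) (F : ℕ → ℕ → MeasurableSpace Ω)
    (U : ℕ → Ω → ℝ) (C b p : ℝ) : Prop where
  measurable : ∀ t ∈ Finset.Icc 1 T, Measurable[F t t] (U t)
  integrable : ∀ t ∈ Finset.Icc 1 T, Integrable (fun ω => U t ω ^ 4) P
  moment : ∀ t ∈ Finset.Icc 1 T, ∫ ω, U t ω ^ 4 ∂P ≤ C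
  tail : ∀ t ∈ Finset.Icc 1 T, P.real {ω | b < |U t ω|} ≤ (T : ℝ) ^ (-p)

universe u

/-- A product exceeds the level only if a factor does, and its second moment is at most the mean of
the two fourth moments. The truncation power is `2 * a + 1`, the extra logarithm absorbing `K ^ 2`.
-/
theorem eventually_measure_abs_sum_mul_sub_ge_le {a c β q K C : ℝ} (hc : 0 < c) (hβ : 0 < β)
    (hq : 0 ≤ q) (hC : 1 ≤ C) :
    ∀ᶠ T : ℕ in atTop, ∀ (Ω : Type u) (_ : MeasurableSpace Ω) (P : Measure Ω)
      [IsProbabilityMeasure P] (F : ℕ → ℕ → MeasurableSpace Ω)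
      (_ : IsMixingFamily P T F fun k => Real.exp (-c * (k : ℝ) ^ β)) (U V : ℕ → Ω → ℝ),
      IsLightTailed P T F U C (K * Real.log T ^ a) (q + 3) →
      IsLightTailed P T F V C (K * Real.log T ^ a) (q + 3) →
      P.real {ω | (4 * q + 33) * (Real.sqrt (C * T) * Real.log T) <
        |∑ t ∈ Finset.Icc 1 T, (U t ω * V t ω - ∫ ω, U t ω * V t ω ∂P)|} ≤ (T : ℝ) ^ (-q) := by
  have hlog : Tendsto (fun T : ℕ => Real.log T) atTop atTop :=
    Real.tendsto_log_atTop.comp tendsto_natCast_atTop_atTop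
  filter_upwards [eventually_measure_abs_sum_sub_ge_le.{u} (2 * a + 1) q hc hβ hq,
    hlog.eventually_ge_atTop (K ^ 2), hlog.eventually_ge_atTop 1, eventually_ge_atTop 2]
    with T hconc hK h1 hT2 Ω _ P _ F hF U V hU hV
  have hT2' : (2 : ℝ) ≤ T := by exact_mod_cast hT2
  have hT : (0 : ℝ) < T := by linarith
  have hlogpos : 0 < Real.log T := by linarith
  have hle : ∀ t ω, (U t ω * V t ω) ^ 2 ≤ U t ω ^ 4 / 2 + V t ω ^ 4 / 2 := fun t ω => by
    nlinarith [sq_nonneg (U t ω ^ 2 - V t ω ^ 2)]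
  have hdom : ∀ t ∈ Finset.Icc 1 T, Integrable (fun ω => U t ω ^ 4 / 2 + V t ω ^ 4 / 2) P :=
    fun t ht => ((hU.integrable t ht).div_const 2).fun_add ((hV.integrable t ht).div_const 2)
  have hm : ∀ t ∈ Finset.Icc 1 T, Measurable[F t t] fun ω => U t ω * V t ω := fun t ht =>
    (hU.measurable t ht).mul (hV.measurable t ht)
  have hint : ∀ t ∈ Finset.Icc 1 T, Integrable (fun ω => (U t ω * V t ω) ^ 2) P := fun t ht =>
    (hdom t ht).mono' (((hm t ht).mono (hF.le t t (Finset.mem_Icc.1 ht).1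
      (Finset.mem_Icc.1 ht).2) le_rfl).pow_const 2).aestronglyMeasurable
      (ae_of_all _ fun ω => by rw [Real.norm_of_nonneg (sq_nonneg _)]; exact hle t ω)
  refine hconc Ω _ P F hF (fun t ω => U t ω * V t ω) C hC hm hint (fun t ht => ?_) ?_
  · have hsub : {ω | Real.log T ^ (2 * a + 1) < |U t ω * V t ω|} ⊆
        {ω | K * Real.log T ^ a < |U t ω|} ∪ {ω | K * Real.log T ^ a < |V t ω|} := by
      intro ω hω
      by_contra hcon
      rw [Set.mem_union, not_or] at hcon
      have hu : ¬ K * Real.log T ^ a < |U t ω| := hcon.1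
      have hv : ¬ K * Real.log T ^ a < |V t ω| := hcon.2
      have hω : Real.log T ^ (2 * a + 1) < |U t ω * V t ω| := hω
      rw [abs_mul, Real.rpow_add_one hlogpos.ne', mul_comm 2 a, Real.rpow_mul hlogpos.le,
        Real.rpow_ofNat] at hω
      have h3 : |U t ω| * |V t ω| ≤ (K * Real.log T ^ a) * (K * Real.log T ^ a) :=
        mul_le_mul (not_lt.1 hu) (not_lt.1 hv) (abs_nonneg _)
          ((abs_nonneg _).trans (not_lt.1 hu))
      have h4 : (Real.log T ^ a) ^ 2 * K ^ 2 ≤ (Real.log T ^ a) ^ 2 * Real.log T :=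
        mul_le_mul_of_nonneg_left hK (sq_nonneg _)
      nlinarith
    refine (measureReal_mono hsub).trans ((measureReal_union_le _ _).trans ?_)
    have h5 : (T : ℝ) ^ (-(q + 2)) = (T : ℝ) ^ (-(q + 3)) * T := by
      rw [← Real.rpow_add_one hT.ne']; ring_nf
    have h6 := hU.tail t ht
    have h7 := hV.tail t ht
    have h8 : 0 ≤ (T : ℝ) ^ (-(q + 3)) := by positivity
    rw [h5]
    nlinarith
  · calc ∑ t ∈ Finset.Icc 1 T, ∫ ω, (U t ω * V t ω) ^ 2 ∂P ≤ ∑ _t ∈ Finset.Icc 1 T, C := by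
          refine Finset.sum_le_sum fun t ht => ?_
          refine (integral_mono (hint t ht) (hdom t ht) (hle t)).trans ?_
          rw [integral_add ((hU.integrable t ht).div_const 2) ((hV.integrable t ht).div_const 2),
            integral_div, integral_div]
          linarith [hU.moment t ht, hV.moment t ht]
      _ = C * T := by simp [mul_comm]

end Products

/-! ### Consequences of the model assumptions -/

section Model

variable {Ω : Type*} [MeasurableSpace Ω] {P : Measure Ω} {n r T : ℕ}
  {f : ℕ → Fin r → Ω → ℝ} {ε : ℕ → Fin n → Ω → ℝ}

omit [MeasurableSpace Ω] in
theorem comap_le_sigmaBetween (t : ℕ) :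
    MeasurableSpace.comap
      (fun ω => ((fun j => f t j ω, fun i => ε t i ω) : (Fin r → ℝ) × (Fin n → ℝ))) inferInstance ≤
      sigmaBetween f ε t t :=
  le_iSup₂_of_le t (Finset.mem_Icc.2 ⟨le_rfl, le_rfl⟩) le_rfl

omit [MeasurableSpace Ω] in
theorem measurable_factor_sigmaBetween (t : ℕ) (j : Fin r) :
    Measurable[sigmaBetween f ε t t] (f t j) :=
  ((measurable_pi_apply j).comp (measurable_fst.comp (comap_measurable _))).mono
    (comap_le_sigmaBetween (ε := ε) t) le_rfl

omit [MeasurableSpace Ω] in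
theorem measurable_idio_sigmaBetween (t : ℕ) (i : Fin n) :
    Measurable[sigmaBetween f ε t t] (ε t i) :=
  ((measurable_pi_apply i).comp (measurable_snd.comp (comap_measurable _))).mono
    (comap_le_sigmaBetween (f := f) t) le_rfl

theorem isMixingFamily_sigmaBetween [IsProbabilityMeasure P]
    (hmodel : IsCentredModel P T f ε) {c β : ℝ} (hmix : ExpMixing P T f ε c β) :
    IsMixingFamily P T (sigmaBetween f ε) fun k => Real.exp (-c * (k : ℝ) ^ β) where
  le s e hs he := by
    refine iSup₂_le fun t ht => ?_
    have ht' : t ∈ Finset.Icc 1 T := by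
      rw [Finset.mem_Icc] at ht ⊢; omega
    exact ((measurable_pi_lambda _ fun j => hmodel.measurable_factor t ht' j).prodMk
      (measurable_pi_lambda _ fun i => hmodel.measurable_idio t ht' i)).comap_le
  mono s s' e e' hs he := by
    refine iSup₂_le fun t ht => le_iSup₂_of_le t ?_ le_rfl
    rw [Finset.mem_Icc] at ht ⊢; omega
  mixing t k hk ht := by
    rcases Nat.eq_zero_or_pos t with rfl | htpos
    · have : sigmaBetween f ε 1 0 = ⊥ := by simp [sigmaBetween]
      rw [this]
      exact IsAlphaMixing.of_bot (Real.exp_pos _).le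
    · intro A D hA hD
      refine le_trans ?_ (hmix k hk)
      unfold mixingCoeff
      -- The upper bound `1` is needed for the real supremum to dominate its members; an unbounded
      -- set would have `sSup` equal to `0`.
      refine le_csSup ⟨1, ?_⟩ ⟨t, Finset.mem_Icc.2 ⟨htpos, ht⟩, A, D, hA, hD, rfl⟩
      rintro x ⟨_, _, A', D', _, _, rfl⟩
      have h1 : 0 ≤ P.real A' * P.real D' := mul_nonneg measureReal_nonneg measureReal_nonneg
      have h2 : P.real A' * P.real D' ≤ 1 :=
        mul_le_one₀ measureReal_le_one measureReal_nonneg measureReal_le_one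
      have h3 : P.real (A' ∩ D') ≤ 1 := measureReal_le_one
      have h4 : 0 ≤ P.real (A' ∩ D') := measureReal_nonneg
      rw [abs_le]
      constructor <;> linarith

theorem integral_factor_mul_idio (hmodel : IsCentredModel P T f ε)
    (hind : FactorIdioIndep P T f ε) {t : ℕ} (ht : t ∈ Finset.Icc 1 T) (j : Fin r) (i : Fin n) :
    ∫ ω, f t j ω * ε t i ω ∂P = 0 := by
  have h : IndepFun (f t j) (ε t i) P :=
    hind.comp (φ := fun x : Finset.Icc 1 T → Fin r → ℝ => x ⟨t, ht⟩ j)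
      (ψ := fun x : Finset.Icc 1 T → Fin n → ℝ => x ⟨t, ht⟩ i) (by fun_prop) (by fun_prop)
  rw [h.integral_fun_mul_eq_mul_integral
    (hmodel.measurable_factor t ht j).aestronglyMeasurable
    (hmodel.measurable_idio t ht i).aestronglyMeasurable, hmodel.mean_factor t ht, zero_mul]

section Idiosyncratic

variable {C : ℝ} (hbdd : IdioBounded P T ε C) (hgauss : IdioGaussian P T ε) {t : ℕ}
  (ht : t ∈ Finset.Icc 1 T)

include hgauss ht in
theorem hasGaussianLaw_sum_mul_idio (a : Fin n → ℝ) :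
    HasGaussianLaw (fun ω => ∑ i, a i * ε t i ω) P := by
  have h := (hgauss t ht).map_fun (∑ i, a i • (ContinuousLinearMap.proj i : (Fin n → ℝ) →L[ℝ] ℝ))
  simpa using h

include hgauss ht in
theorem integrable_idio_mul_idio (i k : Fin n) : Integrable (fun ω => ε t i ω * ε t k ω) P :=
  ((hgauss t ht).eval i).memLp_two.integrable_mul ((hgauss t ht).eval k).memLp_two

include hgauss ht in
theorem integral_sum_mul_idio_sq (a : Fin n → ℝ) :
    ∫ ω, (∑ i, a i * ε t i ω) ^ 2 ∂P = ∑ i, ∑ k, a i * a k * ∫ ω, ε t i ω * ε t k ω ∂P := by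
  have hi := integrable_idio_mul_idio hgauss ht
  have h1 : ∀ ω, (∑ i, a i * ε t i ω) ^ 2 = ∑ i, ∑ k, a i * a k * (ε t i ω * ε t k ω) :=
    fun ω => by
      rw [sq, Finset.sum_mul_sum]
      exact Finset.sum_congr rfl fun i _ => Finset.sum_congr rfl fun k _ => by ring
  simp_rw [h1]
  rw [integral_finsetSum _ fun i _ => integrable_finsetSum _ fun k _ => (hi i k).const_mul _]
  refine Finset.sum_congr rfl fun i _ => ?_
  rw [integral_finsetSum _ fun k _ => (hi i k).const_mul _]
  exact Finset.sum_congr rfl fun k _ => integral_const_mul _ _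

include hbdd hgauss ht in
theorem integral_sum_mul_idio_sq_le (a : Fin n → ℝ) :
    ∫ ω, (∑ i, a i * ε t i ω) ^ 2 ∂P ≤ C * ∑ i, a i ^ 2 := by
  have ht' := Finset.mem_Icc.1 ht
  have hunit : ∀ b : Fin n → ℝ, ∑ i, b i ^ 2 = 1 → ∫ ω, (∑ i, b i * ε t i ω) ^ 2 ∂P ≤ C :=
    fun b hb => by
      -- The window of the single time `t` turns the long-run bound into a bound on the
      -- contemporaneous covariance matrix. General vectors follow by scaling.
      have := hbdd b hb t t ht'.1 le_rfl ht'.2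
      rw [integral_sum_mul_idio_sq hgauss ht]
      simpa using this.le
  have h0 : 0 ≤ ∑ i, a i ^ 2 := Finset.sum_nonneg fun i _ => sq_nonneg _
  rcases h0.eq_or_lt with h | h
  · have ha : ∀ i, a i = 0 := fun i => pow_eq_zero_iff two_ne_zero |>.1
      ((Finset.sum_eq_zero_iff_of_nonneg fun i _ => sq_nonneg (a i)).1 h.symm i (Finset.mem_univ i))
    simp [ha]
  · set s := √(∑ i, a i ^ 2) with hs
    have hs2 : s ^ 2 = ∑ i, a i ^ 2 := Real.sq_sqrt h0
    have hs0 : 0 < s := Real.sqrt_pos.2 h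
    have h1 := hunit (fun i => a i / s) (by
      simp_rw [div_pow]
      rw [← Finset.sum_div, hs2, div_self h.ne'])
    have h2 : ∀ ω, (∑ i, a i / s * ε t i ω) ^ 2 = (s ^ 2)⁻¹ * (∑ i, a i * ε t i ω) ^ 2 :=
      fun ω => by
        rw [← inv_pow, ← mul_pow, Finset.mul_sum]
        congr 1
        exact Finset.sum_congr rfl fun i _ => by ring
    simp_rw [h2] at h1
    rw [integral_const_mul, inv_mul_le_iff₀ (by positivity), hs2] at h1
    linarith

include hbdd hgauss ht in
theorem hasSubgaussianMGF_sum_mul_idio (hmodel : IsCentredModel P T f ε) (a : Fin n → ℝ) {v : ℝ}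
    (hv : C * ∑ i, a i ^ 2 ≤ v) :
    HasSubgaussianMGF (fun ω => ∑ i, a i * ε t i ω) v.toNNReal P := by
  refine hasSubgaussianMGF_of_hasGaussianLaw (hasGaussianLaw_sum_mul_idio hgauss ht a) ?_
    ((integral_sum_mul_idio_sq_le hbdd hgauss ht a).trans hv)
  rw [integral_finsetSum _ fun i _ => (((hgauss t ht).eval i).integrable).const_mul _]
  exact Finset.sum_eq_zero fun i _ => by
    rw [integral_const_mul, hmodel.mean_idio t ht, mul_zero]

include hbdd hgauss ht in
theorem hasSubgaussianMGF_idio (hmodel : IsCentredModel P T f ε) (i : Fin n) :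
    HasSubgaussianMGF (ε t i) C.toNNReal P := by
  have e1 : ∑ k, (Pi.single i 1 : Fin n → ℝ) k ^ 2 = 1 := by
    simp [Pi.single_apply, ite_pow]
  have h := hasSubgaussianMGF_sum_mul_idio hbdd hgauss ht hmodel (Pi.single i 1) (v := C)
    (by rw [e1, mul_one])
  have e2 : (fun ω => ∑ k, (Pi.single i 1 : Fin n → ℝ) k * ε t k ω) = ε t i := by
    ext ω; simp [Pi.single_apply]
  rwa [e2] at h

include hbdd hgauss ht in
/-- The rows of the covariance matrix of the idiosyncratic components are bounded. -/
theorem sum_integral_idio_mul_sq_le (hC : 0 < C) (i : Fin n) :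
    ∑ k, (∫ ω, ε t i ω * ε t k ω ∂P) ^ 2 ≤ C ^ 2 := by
  set b : Fin n → ℝ := fun k => ∫ ω, ε t i ω * ε t k ω ∂P with hb
  have h1 := integral_sum_mul_idio_sq_le hbdd hgauss ht
    (fun k => b k - C * (Pi.single i 1 : Fin n → ℝ) k)
  have h0 : 0 ≤ ∫ ω, (∑ k, (b k - C * (Pi.single i 1 : Fin n → ℝ) k) * ε t k ω) ^ 2 ∂P :=
    integral_nonneg fun ω => sq_nonneg _
  have hbi := integral_sum_mul_idio_sq_le hbdd hgauss ht b
  have hii := integral_sum_mul_idio_sq_le hbdd hgauss ht (Pi.single i 1)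
  have e1 : ∑ k, (Pi.single i 1 : Fin n → ℝ) k ^ 2 = 1 := by
    simp [Pi.single_apply, ite_pow]
  have e2 : ∀ ω, ∑ k, (Pi.single i 1 : Fin n → ℝ) k * ε t k ω = ε t i ω := fun ω => by
    simp [Pi.single_apply]
  simp_rw [e1, e2, mul_one] at hii
  have hL2 : ∀ a : Fin n → ℝ, MemLp (fun ω => ∑ k, a k * ε t k ω) 2 P := fun a =>
    (hasGaussianLaw_sum_mul_idio hgauss ht a).memLp_two
  have hcross : ∫ ω, ε t i ω * ∑ k, b k * ε t k ω ∂P = ∑ k, b k ^ 2 := by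
    have e : ∀ ω, ε t i ω * ∑ k, b k * ε t k ω = ∑ k, b k * (ε t i ω * ε t k ω) := fun ω => by
      rw [Finset.mul_sum]
      exact Finset.sum_congr rfl fun k _ => mul_left_comm _ _ _
    simp_rw [e]
    rw [integral_finsetSum _ fun k _ => (integrable_idio_mul_idio hgauss ht i k).const_mul _]
    exact Finset.sum_congr rfl fun k _ => by rw [integral_const_mul, sq]
  have hi1 : Integrable (fun ω => (∑ k, b k * ε t k ω) ^ 2) P := (hL2 b).integrable_sq
  have hi2 : Integrable (fun ω => ε t i ω ^ 2) P := ((hgauss t ht).eval i).memLp_two.integrable_sq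
  have hi3 : Integrable (fun ω => ε t i ω * ∑ k, b k * ε t k ω) P :=
    ((hgauss t ht).eval i).memLp_two.integrable_mul (hL2 b)
  -- The left side equals the sum of the `b k ^ 2`. Weighted by `C`, the inequality bounds it by `C
  -- ^ 2 / 2` plus half of itself.
  have hamgm : ∫ ω, ε t i ω * ∑ k, b k * ε t k ω ∂P ≤
      ∫ ω, (C / 2 * ε t i ω ^ 2 + (2 * C)⁻¹ * (∑ k, b k * ε t k ω) ^ 2) ∂P := by
    refine integral_mono hi3 ((hi2.const_mul _).fun_add (hi1.const_mul _)) fun ω => ?_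
    have : C / 2 * ε t i ω ^ 2 + (2 * C)⁻¹ * (∑ k, b k * ε t k ω) ^ 2 -
        ε t i ω * ∑ k, b k * ε t k ω =
        (2 * C)⁻¹ * (C * ε t i ω - ∑ k, b k * ε t k ω) ^ 2 := by
      field_simp; ring
    have h2 : 0 ≤ (2 * C)⁻¹ * (C * ε t i ω - ∑ k, b k * ε t k ω) ^ 2 := by positivity
    linarith
  rw [integral_add (hi2.const_mul _) (hi1.const_mul _), integral_const_mul, integral_const_mul,
    hcross] at hamgm
  have h3 : C / 2 * ∫ ω, ε t i ω ^ 2 ∂P ≤ C / 2 * C := by gcongr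
  have h4 : (2 * C)⁻¹ * ∫ ω, (∑ k, b k * ε t k ω) ^ 2 ∂P ≤ (2 * C)⁻¹ * (C * ∑ k, b k ^ 2) := by
    gcongr
  have h5 : (2 * C)⁻¹ * (C * ∑ k, b k ^ 2) = (∑ k, b k ^ 2) / 2 := by field_simp
  have h6 : ∑ k, b k ^ 2 ≤ C ^ 2 := by nlinarith
  exact h6

end Idiosyncratic

end Model

/-! ### Nondegeneracy of the loadings -/

section Loadings

/-- The quadratic form attains a positive minimum on the compact unit sphere; homogeneity does the
rest. -/
theorem Matrix.PosDef.exists_mul_dotProduct_le {r : ℕ} {H : Matrix (Fin r) (Fin r) ℝ}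
    (hH : H.PosDef) : ∃ c : ℝ, 0 < c ∧ ∀ u, c * (u ⬝ᵥ u) ≤ u ⬝ᵥ H *ᵥ u := by
  set S : Set (Fin r → ℝ) := {u | u ⬝ᵥ u = 1} with hS
  have hcont : Continuous fun u : Fin r → ℝ => u ⬝ᵥ H *ᵥ u := by fun_prop
  have hclosed : IsClosed S := isClosed_eq (by fun_prop) continuous_const
  have hbdd : Bornology.IsBounded S := by
    refine (Metric.isBounded_closedBall (x := (0 : Fin r → ℝ)) (r := 1)).subset fun u hu => ?_
    rw [mem_closedBall_zero_iff, pi_norm_le_iff_of_nonneg zero_le_one]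
    intro i
    have h1 : u ⬝ᵥ u = 1 := hu
    rw [dotProduct_self_eq_sum_sq] at h1
    have h2 := Finset.single_le_sum (f := fun i => u i ^ 2) (fun i _ => sq_nonneg _)
      (Finset.mem_univ i)
    rw [h1] at h2
    exact abs_le_one_iff_mul_self_le_one.2 (by simpa only [sq] using h2)
  have hcompact : IsCompact S := Metric.isCompact_of_isClosed_isBounded hclosed hbdd
  have hpos : ∀ u : Fin r → ℝ, u ≠ 0 → 0 < u ⬝ᵥ H *ᵥ u := fun u hu => by
    simpa using hH.dotProduct_mulVec_pos hu
  obtain ⟨c, hc, hmin⟩ : ∃ c : ℝ, 0 < c ∧ ∀ u ∈ S, c ≤ u ⬝ᵥ H *ᵥ u := by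
    rcases S.eq_empty_or_nonempty with h | h
    · exact ⟨1, one_pos, fun u hu => by rw [h] at hu; exact hu.elim⟩
    · obtain ⟨u₀, hu₀, hmin⟩ := hcompact.exists_isMinOn h hcont.continuousOn
      refine ⟨u₀ ⬝ᵥ H *ᵥ u₀, hpos u₀ ?_, fun u hu => hmin hu⟩
      rintro rfl
      have : (0 : Fin r → ℝ) ⬝ᵥ 0 = 1 := hu₀
      simp at this
  refine ⟨c, hc, fun u => ?_⟩
  by_cases hu : u = 0
  · simp [hu]
  have huu : 0 < u ⬝ᵥ u := by
    rw [dotProduct_self_eq_sum_sq]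
    obtain ⟨i, hi⟩ := Function.ne_iff.1 hu
    exact Finset.sum_pos' (fun i _ => sq_nonneg _) ⟨i, Finset.mem_univ _, by
      have : u i ≠ 0 := hi
      positivity⟩
  set s := √(u ⬝ᵥ u) with hs
  have hs2 : s ^ 2 = u ⬝ᵥ u := Real.sq_sqrt huu.le
  have hs0 : 0 < s := Real.sqrt_pos.2 huu
  have h1 := hmin (s⁻¹ • u) (by
    change s⁻¹ • u ⬝ᵥ s⁻¹ • u = 1
    rw [smul_dotProduct, dotProduct_smul, smul_eq_mul, smul_eq_mul, ← hs2]
    field_simp)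
  rw [Matrix.mulVec_smul, smul_dotProduct, dotProduct_smul, smul_eq_mul, smul_eq_mul, ← mul_assoc,
    ← sq, inv_pow, hs2, ← div_eq_inv_mul, le_div_iff₀ huu] at h1
  exact h1

/-- Positivity of the limit `H` survives small entrywise errors: with tolerance `c / (2 * (r + 1))`
they cost at most half of the constant `c` of `H`. -/
theorem exists_eventually_mul_le_dotProduct_mulVec {r : ℕ} {n : ℕ → ℕ}
    {Λ : ∀ T, Matrix (Fin (n T)) (Fin r) ℝ} {H : Matrix (Fin r) (Fin r) ℝ} (hH : H.PosDef)
    (hΛ : Tendsto (fun T => (n T : ℝ)⁻¹ • ((Λ T)ᵀ * Λ T)) atTop (𝓝 H)) :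
    ∃ c : ℝ, 0 < c ∧ ∀ᶠ T in atTop,
      ∀ u, c * n T * (u ⬝ᵥ u) ≤ Λ T *ᵥ u ⬝ᵥ Λ T *ᵥ u := by
  obtain ⟨c, hc, hcH⟩ := hH.exists_mul_dotProduct_le
  refine ⟨c / 2, by positivity, ?_⟩
  have hentry : ∀ᶠ T in atTop, ∀ i k,
      |((n T : ℝ)⁻¹ • ((Λ T)ᵀ * Λ T)) i k - H i k| ≤ c / (2 * (r + 1)) := by
    rw [eventually_all]
    intro i
    rw [eventually_all]
    intro k
    have h1 := (tendsto_pi_nhds.1 ((tendsto_pi_nhds.1 hΛ) i)) k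
    exact (Metric.tendsto_nhds.1 h1 _ (by positivity)).mono fun T hT => hT.le
  filter_upwards [hentry] with T hT u
  have huu : 0 ≤ u ⬝ᵥ u := by rw [dotProduct_self_eq_sum_sq]; positivity
  set G := (n T : ℝ)⁻¹ • ((Λ T)ᵀ * Λ T) with hG
  have e1 : u ⬝ᵥ G *ᵥ u = (n T : ℝ)⁻¹ * (Λ T *ᵥ u ⬝ᵥ Λ T *ᵥ u) := by
    rw [hG, Matrix.smul_mulVec, dotProduct_smul, smul_eq_mul, ← Matrix.mulVec_mulVec,
      Matrix.dotProduct_mulVec, Matrix.vecMul_transpose]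
  have e2 : u ⬝ᵥ G *ᵥ u = u ⬝ᵥ H *ᵥ u + ∑ i, u i * ∑ k, u k * (G i k - H i k) := by
    simp only [dotProduct, Matrix.mulVec]
    rw [← Finset.sum_add_distrib]
    refine Finset.sum_congr rfl fun i _ => ?_
    rw [← mul_add, ← Finset.sum_add_distrib]
    congr 1
    exact Finset.sum_congr rfl fun k _ => by ring
  have h1 := (abs_le.1 (abs_quadratic_le hT u)).1
  have h2 : c / (2 * (r + 1)) * r * (u ⬝ᵥ u) ≤ c / 2 * (u ⬝ᵥ u) := by
    refine mul_le_mul_of_nonneg_right ?_ huu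
    rw [div_mul_eq_mul_div, div_le_div_iff₀ (by positivity) (by norm_num)]
    nlinarith
  have h3 : c / 2 * (u ⬝ᵥ u) ≤ (n T : ℝ)⁻¹ * (Λ T *ᵥ u ⬝ᵥ Λ T *ᵥ u) := by
    rw [← e1, e2]
    linarith [hcH u]
  rcases Nat.eq_zero_or_pos (n T) with h0 | h0
  · have h4 : 0 ≤ Λ T *ᵥ u ⬝ᵥ Λ T *ᵥ u := by rw [dotProduct_self_eq_sum_sq]; positivity
    simpa [h0] using h4
  · have hn : (0 : ℝ) < n T := by exact_mod_cast h0
    rw [← div_eq_inv_mul, le_div_iff₀ hn] at h3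
    linarith

end Loadings

/-! ### Tail bounds at polynomial probability levels -/

section Tails

theorem two_mul_exp_le_rpow {T p : ℝ} (hT : 2 ≤ T) :
    2 * Real.exp (-((p + 1) * Real.log T)) ≤ T ^ (-p) := by
  have hT0 : 0 < T := by linarith
  have : T ^ (-p) = T * Real.exp (-((p + 1) * Real.log T)) := by
    nth_rw 2 [← Real.exp_log hT0]
    rw [← Real.exp_add, Real.rpow_def_of_pos hT0]
    ring_nf
  rw [this]
  gcongr

variable {Ω : Type*} {m0 : MeasurableSpace Ω} {P : Measure Ω}

/-- The condition on `K` makes `(z / c) ^ b` at least `(p + 2) * log T` at the level `z` considered.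
One of the surplus logarithms absorbs the `1` in the exponent. -/
theorem measure_abs_gt_le_of_tail {X : Ω → ℝ} {c b a p K T : ℝ} (hc : 0 < c) (hb : 0 < b)
    (htail : ∀ z : ℝ, 0 < z → P.real {ω | z < |X ω|} ≤ Real.exp (1 - (z / c) ^ b))
    (hT : 2 ≤ T) (hu : 2 ≤ Real.log T) (ha : b⁻¹ ≤ a) (hp : 0 ≤ p)
    (hK : c * (p + 2) ^ b⁻¹ ≤ K) :
    P.real {ω | K * Real.log T ^ a < |X ω|} ≤ T ^ (-p) := by
  have hu0 : 0 < Real.log T := by linarith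
  have hK0 : 0 < K := lt_of_lt_of_le (by positivity) hK
  refine (htail _ (by positivity)).trans (le_trans ?_ (two_mul_exp_le_rpow hT))
  have h1 : (p + 2) ^ b⁻¹ * Real.log T ^ b⁻¹ ≤ K * Real.log T ^ a / c := by
    rw [le_div_iff₀ hc]
    have h2 : Real.log T ^ b⁻¹ ≤ Real.log T ^ a := Real.rpow_le_rpow_of_exponent_le (by linarith) ha
    calc (p + 2) ^ b⁻¹ * Real.log T ^ b⁻¹ * c = c * (p + 2) ^ b⁻¹ * Real.log T ^ b⁻¹ := by ring
      _ ≤ K * Real.log T ^ a := by gcongr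
  have h3 : (p + 2) * Real.log T ≤ (K * Real.log T ^ a / c) ^ b := by
    calc (p + 2) * Real.log T = ((p + 2) ^ b⁻¹ * Real.log T ^ b⁻¹) ^ b := by
          rw [Real.mul_rpow (by positivity) (by positivity), ← Real.rpow_mul (by linarith),
            ← Real.rpow_mul hu0.le, inv_mul_cancel₀ hb.ne', Real.rpow_one, Real.rpow_one]
      _ ≤ _ := Real.rpow_le_rpow (by positivity) h1 hb.le
  have h4 : Real.exp (1 - (K * Real.log T ^ a / c) ^ b) ≤ Real.exp (-((p + 1) * Real.log T)) :=
    Real.exp_le_exp.2 (by linarith)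
  linarith [Real.exp_pos (-((p + 1) * Real.log T))]

theorem ProbabilityTheory.HasSubgaussianMGF.measure_abs_gt_le_rpow [IsProbabilityMeasure P]
    {X : Ω → ℝ} {V z p T : ℝ} (hV : 0 < V) (hX : HasSubgaussianMGF X V.toNNReal P) (hT : 2 ≤ T)
    (hz : 0 ≤ z) (hzV : 2 * V * ((p + 1) * Real.log T) ≤ z ^ 2) :
    P.real {ω | z < |X ω|} ≤ T ^ (-p) := by
  refine (hX.measure_abs_gt_le hz).trans (le_trans ?_ (two_mul_exp_le_rpow hT))
  have : -z ^ 2 / (2 * (V.toNNReal : ℝ)) ≤ -((p + 1) * Real.log T) := by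
    rw [Real.coe_toNNReal V hV.le, div_le_iff₀ (by positivity)]
    linarith
  gcongr

theorem measureReal_exists_lt_abs_le {ι : Type*} [Fintype ι] {X : ι → Ω → ℝ} {b a : ℝ}
    (h : ∀ i, P.real {ω | b < |X i ω|} ≤ a) :
    P.real {ω | ∃ i, b < |X i ω|} ≤ Fintype.card ι * a := by
  rw [Set.ofPred_exists]
  refine (measureReal_iUnion_fintype_le _).trans
    ((Finset.sum_le_card_nsmul _ _ a fun i _ => h i).trans_eq ?_)
  simp

end Tails

/-! ### The regular event and the error bound on it -/

section GoodEvent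

variable {Ω : Type*} {n r : ℕ}

/-- The event that the data have no outliers beyond the level `b`, and that the centred sums of all
products deviate by at most `D` from zero. -/
structure IsRegularSample {m0 : MeasurableSpace Ω} (P : Measure Ω) (T : ℕ)
    (Λ : Matrix (Fin n) (Fin r) ℝ) (f : ℕ → Fin r → Ω → ℝ) (ε : ℕ → Fin n → Ω → ℝ) (b D : ℝ)
    (ω : Ω) : Prop where
  factor : ∀ t ∈ Finset.Icc 1 T, ∀ j, |f t j ω| ≤ b
  idio : ∀ t ∈ Finset.Icc 1 T, ∀ i, |ε t i ω| ≤ b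
  loading : ∀ t ∈ Finset.Icc 1 T, ∀ j, |∑ i, Λ i j * ε t i ω| ≤ √n * b
  factor_factor : ∀ j k, |∑ t ∈ Finset.Icc 1 T, (f t j ω * f t k ω - ∫ ω, f t j ω * f t k ω ∂P)| ≤ D
  factor_idio : ∀ j i, |∑ t ∈ Finset.Icc 1 T, (f t j ω * ε t i ω - ∫ ω, f t j ω * ε t i ω ∂P)| ≤ D
  idio_idio : ∀ i k, |∑ t ∈ Finset.Icc 1 T, (ε t i ω * ε t k ω - ∫ ω, ε t i ω * ε t k ω ∂P)| ≤ D

variable [MeasurableSpace Ω] {P : Measure Ω} {T : ℕ} {Λ : Matrix (Fin n) (Fin r) ℝ}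
  {f : ℕ → Fin r → Ω → ℝ} {ε : ℕ → Fin n → Ω → ℝ} {b D : ℝ}

theorem measureReal_not_isRegularSample_le [IsProbabilityMeasure P] {a a' : ℝ}
    (hf : ∀ t ∈ Finset.Icc 1 T, ∀ j, P.real {ω | b < |f t j ω|} ≤ a)
    (hε : ∀ t ∈ Finset.Icc 1 T, ∀ i, P.real {ω | b < |ε t i ω|} ≤ a)
    (hΛ : ∀ t ∈ Finset.Icc 1 T, ∀ j, P.real {ω | √n * b < |∑ i, Λ i j * ε t i ω|} ≤ a)
    (hff : ∀ j k, P.real {ω | D <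
      |∑ t ∈ Finset.Icc 1 T, (f t j ω * f t k ω - ∫ ω, f t j ω * f t k ω ∂P)|} ≤ a')
    (hfε : ∀ j i, P.real {ω | D <
      |∑ t ∈ Finset.Icc 1 T, (f t j ω * ε t i ω - ∫ ω, f t j ω * ε t i ω ∂P)|} ≤ a')
    (hεε : ∀ i k, P.real {ω | D <
      |∑ t ∈ Finset.Icc 1 T, (ε t i ω * ε t k ω - ∫ ω, ε t i ω * ε t k ω ∂P)|} ≤ a') :
    P.real {ω | ¬ IsRegularSample P T Λ f ε b D ω} ≤
      T * (r + n + r) * a + (r * r + r * n + n * n) * a' := by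
  have h1 := measureReal_exists_lt_abs_le (P := P) (ι := Finset.Icc 1 T × Fin r)
    (X := fun i => f i.1 i.2) fun i => hf i.1 i.1.2 i.2
  have h2 := measureReal_exists_lt_abs_le (P := P) (ι := Finset.Icc 1 T × Fin n)
    (X := fun i => ε i.1 i.2) fun i => hε i.1 i.1.2 i.2
  have h3 := measureReal_exists_lt_abs_le (P := P) (ι := Finset.Icc 1 T × Fin r)
    (X := fun i ω => ∑ k, Λ k i.2 * ε i.1 k ω) fun i => hΛ i.1 i.1.2 i.2
  have h4 := measureReal_exists_lt_abs_le (P := P) (ι := Fin r × Fin r)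
    (X := fun i ω => ∑ t ∈ Finset.Icc 1 T,
      (f t i.1 ω * f t i.2 ω - ∫ ω, f t i.1 ω * f t i.2 ω ∂P)) fun i => hff i.1 i.2
  have h5 := measureReal_exists_lt_abs_le (P := P) (ι := Fin r × Fin n)
    (X := fun i ω => ∑ t ∈ Finset.Icc 1 T,
      (f t i.1 ω * ε t i.2 ω - ∫ ω, f t i.1 ω * ε t i.2 ω ∂P)) fun i => hfε i.1 i.2
  have h6 := measureReal_exists_lt_abs_le (P := P) (ι := Fin n × Fin n)
    (X := fun i ω => ∑ t ∈ Finset.Icc 1 T,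
      (ε t i.1 ω * ε t i.2 ω - ∫ ω, ε t i.1 ω * ε t i.2 ω ∂P)) fun i => hεε i.1 i.2
  set E1 : Set Ω := {ω | ∃ i : Finset.Icc 1 T × Fin r, b < |f i.1 i.2 ω|}
  set E2 : Set Ω := {ω | ∃ i : Finset.Icc 1 T × Fin n, b < |ε i.1 i.2 ω|}
  set E3 : Set Ω := {ω | ∃ i : Finset.Icc 1 T × Fin r, √n * b < |∑ k, Λ k i.2 * ε i.1 k ω|}
  set E4 : Set Ω := {ω | ∃ i : Fin r × Fin r, D < |∑ t ∈ Finset.Icc 1 T,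
      (f t i.1 ω * f t i.2 ω - ∫ ω, f t i.1 ω * f t i.2 ω ∂P)|}
  set E5 : Set Ω := {ω | ∃ i : Fin r × Fin n, D < |∑ t ∈ Finset.Icc 1 T,
      (f t i.1 ω * ε t i.2 ω - ∫ ω, f t i.1 ω * ε t i.2 ω ∂P)|}
  set E6 : Set Ω := {ω | ∃ i : Fin n × Fin n, D < |∑ t ∈ Finset.Icc 1 T,
      (ε t i.1 ω * ε t i.2 ω - ∫ ω, ε t i.1 ω * ε t i.2 ω ∂P)|}
  have hsub : {ω | ¬ IsRegularSample P T Λ f ε b D ω} ⊆ E1 ∪ E2 ∪ E3 ∪ E4 ∪ E5 ∪ E6 := by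
    intro ω hω
    by_contra hcon
    simp only [Set.mem_union, not_or] at hcon
    obtain ⟨⟨⟨⟨⟨c1, c2⟩, c3⟩, c4⟩, c5⟩, c6⟩ := hcon
    refine hω ⟨fun t ht j => ?_, fun t ht j => ?_, fun t ht j => ?_, fun j k => ?_, fun j k => ?_,
      fun j k => ?_⟩ <;> refine not_lt.1 fun h => ?_
    · exact c1 ⟨(⟨t, ht⟩, j), h⟩
    · exact c2 ⟨(⟨t, ht⟩, j), h⟩
    · exact c3 ⟨(⟨t, ht⟩, j), h⟩
    · exact c4 ⟨(j, k), h⟩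
    · exact c5 ⟨(j, k), h⟩
    · exact c6 ⟨(j, k), h⟩
  have u1 := measureReal_union_le (μ := P) E1 E2
  have u2 := measureReal_union_le (μ := P) (E1 ∪ E2) E3
  have u3 := measureReal_union_le (μ := P) (E1 ∪ E2 ∪ E3) E4
  have u4 := measureReal_union_le (μ := P) (E1 ∪ E2 ∪ E3 ∪ E4) E5
  have u5 := measureReal_union_le (μ := P) (E1 ∪ E2 ∪ E3 ∪ E4 ∪ E5) E6
  have u6 := measureReal_mono (μ := P) hsub
  simp only [Fintype.card_prod, Fintype.card_coe, Nat.card_Icc, Nat.add_sub_cancel,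
    Fintype.card_fin, Nat.cast_mul] at h1 h2 h3 h4 h5 h6
  linarith

/-- On a regular sample, sample second moments differ from their averaged expectations by at most `D
/ T`. The other part of `ρ`, of order `1 / √n`, comes from the expectation of the idiosyncratic
matrix, whose rows have norm at most `Cε`, and also covers the required `1 / √n ≤ ρ`. -/
theorem IsRegularSample.maxError_le [IsProbabilityMeasure P] {C ρ₁ c lam Cε ρ : ℝ} (hT : 0 < T)
    (hdet : ∀ (n T : ℕ) (Λ : Matrix (Fin n) (Fin r) ℝ) (f : ℕ → Fin r → ℝ)
      (ε x : ℕ → Fin n → ℝ) (w : Fin n → Fin n → ℝ) (ρ φ ψ : ℝ), r ≤ n → 1 ≤ n →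
      1 / √n ≤ ρ → ρ ≤ ρ₁ → 0 ≤ φ → 0 ≤ ψ → (∀ t, x t = Λ *ᵥ f t + ε t) →
      (∀ i j, |Λ i j| ≤ lam) → (∀ u, c * n * (u ⬝ᵥ u) ≤ Λ *ᵥ u ⬝ᵥ Λ *ᵥ u) →
      (∀ j k, |(T : ℝ)⁻¹ * ∑ t ∈ Finset.Icc 1 T, f t j * f t k - if j = k then 1 else 0| ≤
        1 / (2 * (r + 1))) →
      (∀ i j, |(T : ℝ)⁻¹ * ∑ t ∈ Finset.Icc 1 T, f t j * ε t i| ≤ ρ) →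
      (∀ i, ∑ k, ((T : ℝ)⁻¹ * ∑ t ∈ Finset.Icc 1 T, ε t i * ε t k) ^ 2 ≤ n * ρ ^ 2) →
      (∀ t ∈ Finset.Icc 1 T, ∀ j, |f t j| ≤ φ) → (∀ t ∈ Finset.Icc 1 T, ∀ i, |ε t i| ≤ ψ) →
      (∀ t ∈ Finset.Icc 1 T, ∀ j, |(Λᵀ *ᵥ ε t) j| ≤ √n * ψ) →
      IsOrderedEigenbasis (sampleCov T x) w →
      ∀ t ∈ Finset.Icc 1 T, ∀ i, |pcaEstimator r w (x t) i - (Λ *ᵥ f t) i| ≤ C * (ρ * (φ + ψ)))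
    (hC : 0 < C) (hCε : 0 < Cε) (hb : 0 ≤ b) (hD : 0 ≤ D) (hrn : r ≤ n) (hn : 1 ≤ n)
    (hρ : ρ = 2 * (Cε + 1) * (1 / √n) + 2 * (D / T)) (hρ₁ : ρ ≤ ρ₁)
    (hDr : D / T ≤ 1 / (2 * (r + 1))) (hΛ : ∀ i j, |Λ i j| ≤ lam)
    (hΛq : ∀ u, c * n * (u ⬝ᵥ u) ≤ Λ *ᵥ u ⬝ᵥ Λ *ᵥ u)
    (hmodel : IsCentredModel P T f ε) (hnorm : FactorNormalised P T f)
    (hbdd : IdioBounded P T ε Cε) (hgauss : IdioGaussian P T ε) (hind : FactorIdioIndep P T f ε)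
    {w : Fin n → Fin n → ℝ} {ω : Ω}
    (hw : IsOrderedEigenbasis (sampleCov T fun t i => observed Λ f ε t i ω) w)
    (hreg : IsRegularSample P T Λ f ε b D ω) :
    maxError T (fun t => pcaEstimator r w (fun i => observed Λ f ε t i ω))
      (fun t i => commonComp Λ f t i ω) ≤ C * (ρ * (b + b)) := by
  have hn0 : (0 : ℝ) < n := by exact_mod_cast hn
  have hT0 : (0 : ℝ) < T := by exact_mod_cast hT
  have hs0 : 0 < √(n : ℝ) := Real.sqrt_pos.2 hn0
  have hDT : 0 ≤ D / T := by positivity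
  have hsρ : 1 / √(n : ℝ) ≤ ρ := by
    have : 0 < 1 / √(n : ℝ) := by positivity
    rw [hρ]
    nlinarith
  have hρ0 : 0 ≤ ρ := le_trans (by positivity) hsρ
  have hdev : ∀ U E : ℕ → ℝ, |∑ t ∈ Finset.Icc 1 T, (U t - E t)| ≤ D →
      |(T : ℝ)⁻¹ * ∑ t ∈ Finset.Icc 1 T, U t - (T : ℝ)⁻¹ * ∑ t ∈ Finset.Icc 1 T, E t| ≤ D / T :=
    fun U E h => by
      rw [← mul_sub, ← Finset.sum_sub_distrib, abs_mul, abs_of_pos (inv_pos.2 hT0),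
        ← div_eq_inv_mul]
      gcongr
  have hmain := hdet n T Λ (fun t j => f t j ω) (fun t i => ε t i ω)
    (fun t i => observed Λ f ε t i ω) w ρ b b hrn hn hsρ hρ₁ hb hb (fun t => rfl) hΛ hΛq
    (fun j k => by
      have h1 := hdev _ _ (hreg.factor_factor j k)
      have h2 := congrFun (congrFun hnorm j) k
      rw [Matrix.smul_apply, Matrix.sum_apply, Matrix.one_apply, smul_eq_mul] at h2
      simp only [Matrix.of_apply] at h2
      rw [h2] at h1
      exact h1.trans hDr)
    (fun i j => by
      have h1 := hdev _ _ (hreg.factor_idio j i)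
      rw [Finset.sum_eq_zero fun t ht => integral_factor_mul_idio hmodel hind ht j i, mul_zero,
        sub_zero] at h1
      refine h1.trans ?_
      have : 0 ≤ 2 * (Cε + 1) * (1 / √(n : ℝ)) := by positivity
      rw [hρ]
      linarith)
    (fun i => by
      set e : Fin n → ℝ := fun k => (T : ℝ)⁻¹ * ∑ t ∈ Finset.Icc 1 T, ε t i ω * ε t k ω with he
      set g : Fin n → ℝ := fun k => (T : ℝ)⁻¹ * ∑ t ∈ Finset.Icc 1 T, ∫ ω, ε t i ω * ε t k ω ∂P
        with hg
      have h1 : ∀ k, |e k - g k| ≤ D / T := fun k => hdev _ _ (hreg.idio_idio i k)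
      -- By Cauchy–Schwarz in time, averaging over `t` preserves the bound on the row norms at each
      -- time.
      have h2 : ∑ k, g k ^ 2 ≤ Cε ^ 2 := by
        have h3 : ∀ k, g k ^ 2 ≤
            (T : ℝ)⁻¹ * ∑ t ∈ Finset.Icc 1 T, (∫ ω, ε t i ω * ε t k ω ∂P) ^ 2 := fun k => by
          have := sq_sum_le_card_mul_sum_sq (s := Finset.Icc 1 T)
            (f := fun t => ∫ ω, ε t i ω * ε t k ω ∂P)
          rw [Nat.card_Icc, Nat.add_sub_cancel] at this
          rw [hg, mul_pow]
          calc (T : ℝ)⁻¹ ^ 2 * (∑ t ∈ Finset.Icc 1 T, ∫ ω, ε t i ω * ε t k ω ∂P) ^ 2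
              ≤ (T : ℝ)⁻¹ ^ 2 *
                (T * ∑ t ∈ Finset.Icc 1 T, (∫ ω, ε t i ω * ε t k ω ∂P) ^ 2) := by gcongr
            _ = _ := by field_simp
        refine (Finset.sum_le_sum fun k _ => h3 k).trans ?_
        rw [← Finset.mul_sum, Finset.sum_comm, inv_mul_le_iff₀ hT0]
        refine (Finset.sum_le_sum fun t ht =>
          sum_integral_idio_mul_sq_le hbdd hgauss ht hCε i).trans_eq ?_
        simp
      have h4 : ∀ k, e k ^ 2 ≤ 2 * (D / T) ^ 2 + 2 * g k ^ 2 := fun k => by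
        have h5 : (e k - g k) ^ 2 ≤ (D / T) ^ 2 := sq_le_sq' (abs_le.1 (h1 k)).1 (abs_le.1 (h1 k)).2
        nlinarith [sq_nonneg (e k - 2 * g k)]
      refine (Finset.sum_le_sum fun k _ => h4 k).trans ?_
      rw [Finset.sum_add_distrib, Finset.sum_const, Finset.card_univ, Fintype.card_fin,
        nsmul_eq_mul, ← Finset.mul_sum]
      have h6 : (2 * (Cε + 1) * (1 / √(n : ℝ))) ^ 2 + (2 * (D / T)) ^ 2 ≤ ρ ^ 2 := by
        have : 0 ≤ 2 * (Cε + 1) * (1 / √(n : ℝ)) := by positivity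
        rw [hρ]
        nlinarith
      have h7 : n * (2 * (Cε + 1) * (1 / √(n : ℝ))) ^ 2 = 4 * (Cε + 1) ^ 2 := by
        rw [mul_pow, div_pow, Real.sq_sqrt hn0.le]
        field_simp
        norm_num
      have h8 := mul_le_mul_of_nonneg_left h6 hn0.le
      rw [mul_add, h7] at h8
      have h9 : 0 ≤ n * (D / T) ^ 2 := by positivity
      nlinarith)
    hreg.factor hreg.idio hreg.loading hw
  refine Real.iSup_le (fun p => ?_) (by positivity)
  exact hmain p.1 p.1.2 p.2

end GoodEvent

/-! ### Regular samples have high probability -/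

section Regularity

variable {Ω : ℕ → Type*} [∀ T, MeasurableSpace (Ω T)] {P : ∀ T, Measure (Ω T)}
  [∀ T, IsProbabilityMeasure (P T)] {r : ℕ} {n : ℕ → ℕ}
  {Λ : ∀ T, Matrix (Fin (n T)) (Fin r) ℝ} {f : ∀ T, ℕ → Fin r → Ω T → ℝ}
  {ε : ∀ T, ℕ → Fin (n T) → Ω T → ℝ} {cf βf lamBar Cε cα β : ℝ}

/-- Samples are regular up to probability polynomially small of any order. -/
theorem exists_eventually_measureReal_not_isRegularSample_le
    (hcf : 0 < cf) (hβf : 0 < βf) (hlamBar : 0 < lamBar) (hCε : 0 < Cε) (hcα : 0 < cα)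
    (hβ : 0 < β) (hmodel : ∀ᶠ T in atTop, IsCentredModel (P T) T (f T) (ε T))
    (hftail : ∀ᶠ T in atTop, FactorTails (P T) T (f T) cf βf)
    (hΛ : ∀ᶠ T in atTop, ∀ i j, |Λ T i j| < lamBar)
    (hbdd : ∀ᶠ T in atTop, IdioBounded (P T) T (ε T) Cε)
    (hgauss : ∀ᶠ T in atTop, IdioGaussian (P T) T (ε T))
    (hmix : ∀ᶠ T in atTop, ExpMixing (P T) T (f T) (ε T) cα β)
    (hn : ∀ᶠ T in atTop, 1 ≤ n T) {q : ℝ} (hq : 0 ≤ q) :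
    ∃ K A : ℝ, 0 < K ∧ 0 < A ∧ ∀ᶠ T : ℕ in atTop,
      (P T).real {ω | ¬ IsRegularSample (P T) T (Λ T) (f T) (ε T)
        (K * Real.log T ^ max βf⁻¹ (1 / 2)) (A * (√T * Real.log T)) ω} ≤
      T * (r + n T + r) * (T : ℝ) ^ (-(q + 3)) +
        (r * r + r * n T + n T * n T) * (T : ℝ) ^ (-q) := by
  set a := max βf⁻¹ (1 / 2) with ha
  -- The summands serve the tails of the factors, of `ε_t` and of `Λᵀ ε_t / √n`; the last one gives
  -- `K ≤ K ^ 2`. The Gaussian bounds constrain the squared level, and `a ≥ 1/2` makes that square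
  -- at least `K * log T`.
  set K := cf * (q + 3 + 2) ^ βf⁻¹ + 2 * Cε * (q + 3 + 1) + 2 * (Cε * lamBar ^ 2) * (q + 3 + 1) + 1
    with hK
  set I := ∫ t in Set.Ioi (0 : ℝ), Real.exp 1 * (t ^ (3 : ℝ) * Real.exp (-(cf ^ βf)⁻¹ * t ^ βf))
    with hI
  have hI0 : 0 ≤ I := setIntegral_nonneg measurableSet_Ioi fun t ht => by
    have : (0 : ℝ) < t := ht
    positivity
  set C := 1 + 4 * I + 48 * Real.exp (Cε / 2) with hC
  have hC1 : 1 ≤ C := by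
    have := Real.exp_pos (Cε / 2)
    linarith
  have k1 : 0 ≤ cf * (q + 3 + 2) ^ βf⁻¹ := by positivity
  have k2 : 0 ≤ 2 * Cε * (q + 3 + 1) := by positivity
  have k3 : 0 ≤ 2 * (Cε * lamBar ^ 2) * (q + 3 + 1) := by positivity
  have hK1 : 1 ≤ K := by linarith
  have hKK : K ≤ K ^ 2 := by nlinarith
  have hlog : Tendsto (fun T : ℕ => Real.log T) atTop atTop :=
    Real.tendsto_log_atTop.comp tendsto_natCast_atTop_atTop
  refine ⟨K, (4 * q + 33) * √C, by linarith, mul_pos (by linarith) (Real.sqrt_pos.2 (by linarith)),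
    ?_⟩
  filter_upwards [hmodel, hftail, hΛ, hbdd, hgauss, hmix, hn, eventually_ge_atTop 2,
    hlog.eventually_ge_atTop 2, eventually_measure_abs_sum_mul_sub_ge_le (a := a) (K := K) hcα hβ
      hq hC1] with T hmodel hftail hΛ hbdd hgauss hmix hn hT hlog2 hconc
  have hT' : (2 : ℝ) ≤ T := by exact_mod_cast hT
  have hn0 : (0 : ℝ) < n T := by exact_mod_cast hn
  have hp : 0 ≤ q + 3 := by linarith
  set b := K * Real.log T ^ a with hb
  have hb0 : 0 ≤ b := by positivity
  have hb2 : K * Real.log T ≤ b ^ 2 := by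
    have h1 : Real.log T ≤ (Real.log T ^ a) ^ 2 := by
      rw [← Real.rpow_natCast, ← Real.rpow_mul (by linarith)]
      refine Real.self_le_rpow_of_one_le (by linarith) ?_
      have : 1 / 2 ≤ a := le_max_right _ _
      push_cast
      linarith
    rw [hb, mul_pow]
    exact mul_le_mul hKK h1 (by linarith) (by positivity)
  have hf : ∀ t ∈ Finset.Icc 1 T, ∀ j, (P T).real {ω | b < |f T t j ω|} ≤ (T : ℝ) ^ (-(q + 3)) :=
    fun t ht j => measure_abs_gt_le_of_tail hcf hβf (hftail t ht j) hT' hlog2 (le_max_left _ _) hp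
      (by linarith)
  have hε : ∀ t ∈ Finset.Icc 1 T, ∀ i, (P T).real {ω | b < |ε T t i ω|} ≤ (T : ℝ) ^ (-(q + 3)) :=
    fun t ht i => (hasSubgaussianMGF_idio hbdd hgauss ht hmodel i).measure_abs_gt_le_rpow hCε hT'
      hb0 (by
        refine le_trans ?_ hb2
        rw [← mul_assoc]
        exact mul_le_mul_of_nonneg_right (by linarith) (by linarith))
  have hfl : ∀ j, IsLightTailed (P T) T (sigmaBetween (f T) (ε T)) (fun t => f T t j) C b (q + 3) :=
    fun j =>
    { measurable := fun t _ => measurable_factor_sigmaBetween t j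
      integrable := fun t ht =>
        (integrable_pow_four_of_tail (hmodel.measurable_factor t ht j) hcf hβf (hftail t ht j)).1
      moment := fun t ht => (integrable_pow_four_of_tail (hmodel.measurable_factor t ht j) hcf hβf
        (hftail t ht j)).2.trans (by have := Real.exp_pos (Cε / 2); linarith)
      tail := fun t ht => hf t ht j }
  have hεl : ∀ i, IsLightTailed (P T) T (sigmaBetween (f T) (ε T)) (fun t => ε T t i) C b (q + 3) :=
    fun i =>
    { measurable := fun t _ => measurable_idio_sigmaBetween t i
      integrable := fun t ht =>
        ((hasSubgaussianMGF_idio hbdd hgauss ht hmodel i).integrable_pow_four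
        (hmodel.measurable_idio t ht i)).1
      moment := fun t ht => ((hasSubgaussianMGF_idio hbdd hgauss ht hmodel i).integrable_pow_four
        (hmodel.measurable_idio t ht i)).2.trans (by
          rw [Real.coe_toNNReal Cε hCε.le]
          linarith)
      tail := fun t ht => hε t ht i }
  have hD : (4 * q + 33) * √C * (√T * Real.log T) = (4 * q + 33) * (√(C * T) * Real.log T) := by
    rw [Real.sqrt_mul (by linarith)]
    ring
  rw [hD]
  have hF := isMixingFamily_sigmaBetween hmodel hmix
  refine measureReal_not_isRegularSample_le hf hε (fun t ht j => ?_)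
    (fun j k => hconc _ _ _ _ hF _ _ (hfl j) (hfl k))
    (fun j i => hconc _ _ _ _ hF _ _ (hfl j) (hεl i))
    (fun i k => hconc _ _ _ _ hF _ _ (hεl i) (hεl k))
  have hsum : ∑ i, Λ T i j ^ 2 ≤ n T * lamBar ^ 2 := by
    refine (Finset.sum_le_card_nsmul _ _ (lamBar ^ 2) fun i _ =>
      sq_le_sq.2 ((hΛ i j).le.trans_eq (abs_of_pos hlamBar).symm)).trans_eq ?_
    simp
  refine (hasSubgaussianMGF_sum_mul_idio hbdd hgauss ht hmodel (fun i => Λ T i j)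
    (v := Cε * (n T * lamBar ^ 2)) (by gcongr)).measure_abs_gt_le_rpow (by positivity) hT'
    (by positivity) ?_
  rw [mul_pow, Real.sq_sqrt hn0.le]
  calc 2 * (Cε * (n T * lamBar ^ 2)) * ((q + 3 + 1) * Real.log T)
      = n T * (2 * (Cε * lamBar ^ 2) * (q + 3 + 1) * Real.log T) := by ring
    _ ≤ n T * (K * Real.log T) := by gcongr; linarith
    _ ≤ n T * b ^ 2 := by gcongr

end Regularity

/-! ### Comparison of rates -/

section Rates

/-- The number of pairs of series is of order `T ^ (2 * κ)`, so the exponent `2 * κ + 1` leaves a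
failure probability of order `1 / T`. -/
theorem tendsto_union_bound {n : ℕ → ℕ} {κ : ℝ} (hκ : 0 < κ) (r : ℕ)
    (hn : (fun T => (n T : ℝ)) =O[atTop] fun T : ℕ => (T : ℝ) ^ κ) :
    Tendsto (fun T : ℕ => T * (r + n T + r) * (T : ℝ) ^ (-(2 * κ + 1 + 3)) +
      (r * r + r * n T + n T * n T) * (T : ℝ) ^ (-(2 * κ + 1))) atTop (𝓝 0) := by
  obtain ⟨c, hc⟩ := hn.bound
  set c' := max c 1 with hc'
  have hlim : Tendsto (fun T : ℕ => (2 * r + c' + (r + c') ^ 2) * (T : ℝ)⁻¹) atTop (𝓝 0) := by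
    simpa using tendsto_natCast_atTop_atTop.inv_tendsto_atTop.const_mul
      ((2 * r + c' + (r + c') ^ 2 : ℝ))
  refine squeeze_zero' (Eventually.of_forall fun T => by positivity) ?_ hlim
  filter_upwards [hc, eventually_ge_atTop 1] with T hnT hT
  have hT1 : (1 : ℝ) ≤ T := by exact_mod_cast hT
  have hT0 : (0 : ℝ) < T := by linarith
  have hc1 : 1 ≤ c' := le_max_right _ _
  set X := (T : ℝ) ^ κ with hX
  have hX1 : 1 ≤ X := Real.one_le_rpow hT1 hκ.le
  have hN : (n T : ℝ) ≤ c' * X := by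
    rw [Real.norm_of_nonneg (by positivity), Real.norm_of_nonneg (by positivity)] at hnT
    exact hnT.trans (mul_le_mul_of_nonneg_right (le_max_left _ _) (by linarith))
  have e1 : (T : ℝ) ^ (-(2 * κ + 1)) = (X ^ 2)⁻¹ * (T : ℝ)⁻¹ := by
    rw [hX, ← Real.rpow_natCast, ← Real.rpow_mul hT0.le, neg_add, Real.rpow_add hT0,
      Real.rpow_neg hT0.le, Real.rpow_neg_one]
    norm_num [mul_comm]
  have e2 : (T : ℝ) ^ (-(2 * κ + 1 + 3)) = (X ^ 2)⁻¹ * (T : ℝ)⁻¹ * ((T : ℝ) ^ 3)⁻¹ := by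
    rw [neg_add, Real.rpow_add hT0, e1, Real.rpow_neg hT0.le]
    norm_num
  have hr0 : (0 : ℝ) ≤ r := by positivity
  have hrX : (r : ℝ) ≤ r * X := le_mul_of_one_le_right hr0 hX1
  have s1 : T * (r + n T + r) * (T : ℝ) ^ (-(2 * κ + 1 + 3)) ≤ (2 * r + c') * (T : ℝ)⁻¹ := by
    have h1 : T * ((T : ℝ) ^ 3)⁻¹ ≤ 1 := by
      rw [← div_eq_mul_inv, div_le_one (by positivity)]
      exact le_self_pow₀ hT1 (by norm_num)
    have h2 : (r + n T + r) * (X ^ 2)⁻¹ ≤ 2 * r + c' := by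
      rw [← div_eq_mul_inv, div_le_iff₀ (by positivity)]
      have h3 : X ≤ X ^ 2 := le_self_pow₀ hX1 (by norm_num)
      have h4 : (2 * r + c') * X ≤ (2 * r + c') * X ^ 2 := by gcongr
      linarith
    rw [e2]
    calc T * (r + n T + r) * ((X ^ 2)⁻¹ * (T : ℝ)⁻¹ * ((T : ℝ) ^ 3)⁻¹)
        = ((r + n T + r) * (X ^ 2)⁻¹) * (T : ℝ)⁻¹ * (T * ((T : ℝ) ^ 3)⁻¹) := by ring
      _ ≤ (2 * r + c') * (T : ℝ)⁻¹ * 1 := by gcongr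
      _ = _ := mul_one _
  have s2 : (r * r + r * n T + n T * n T) * (T : ℝ) ^ (-(2 * κ + 1)) ≤
      (r + c') ^ 2 * (T : ℝ)⁻¹ := by
    rw [e1, ← mul_assoc]
    refine mul_le_mul_of_nonneg_right ?_ (by positivity)
    rw [← div_eq_mul_inv, div_le_iff₀ (by positivity)]
    have h1 : r + n T ≤ (r + c') * X := by linarith
    have h2 : (r + n T : ℝ) ^ 2 ≤ ((r + c') * X) ^ 2 := by gcongr
    have h3 : (0 : ℝ) ≤ r * n T := by positivity
    rw [mul_pow] at h2
    linarith
  linarith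

theorem tendsto_sqrt_mul_log_div_atTop :
    Tendsto (fun T : ℕ => √T * Real.log T / T) atTop (𝓝 0) := by
  have h1 := (isLittleO_log_rpow_atTop (r := 1 / 2) (by norm_num)).tendsto_div_nhds_zero.comp
    (tendsto_natCast_atTop_atTop (R := ℝ))
  refine h1.congr' ?_
  filter_upwards [eventually_ge_atTop 1] with T hT
  have hT0 : (0 : ℝ) < T := by exact_mod_cast hT
  have hs : 0 < √(T : ℝ) := Real.sqrt_pos.2 hT0
  have hs2 : √(T : ℝ) * √T = T := Real.mul_self_sqrt hT0.le
  simp only [Function.comp_apply]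
  rw [← Real.sqrt_eq_rpow, div_eq_div_iff hs.ne' hT0.ne']
  linear_combination -(Real.log T) * hs2

/-- Because `log n ≥ 1`, the scale `1 / √T` is below `√(log n / T)`. Concentration spends one
logarithm and the pointwise maxima spend `a`, which gives the exponent `1 + a`. -/
theorem rate_le {n T : ℕ} {a θ A B : ℝ} (hT : 1 ≤ Real.log T) (hn : 1 ≤ Real.log n) (ha : 0 ≤ a)
    (hθ : 1 + a ≤ θ) (hA : 0 ≤ A) (hB : 0 ≤ B) :
    (B * (1 / √n) + 2 * (A * (√T * Real.log T) / T)) * Real.log T ^ a ≤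
      (B + 2 * A) * (max √(Real.log n / T) (1 / √n) * Real.log T ^ θ) := by
  have hT0 : (0 : ℝ) < T := by
    rcases Nat.eq_zero_or_pos T with rfl | h
    · norm_num at hT
    · exact_mod_cast h
  set m := max √(Real.log n / T) (1 / √n) with hm
  have hm0 : 0 ≤ m := le_max_of_le_left (Real.sqrt_nonneg _)
  have hs : √(T : ℝ) / T = √(1 / T) := by
    rw [Real.sqrt_div_self', Real.sqrt_div zero_le_one, Real.sqrt_one]
  have h1 : √(T : ℝ) / T ≤ m := by
    rw [hs]
    exact (Real.sqrt_le_sqrt (by gcongr)).trans (le_max_left _ _)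
  have h2 : 1 / √(n : ℝ) ≤ m * Real.log T :=
    (le_max_right _ _).trans (le_mul_of_one_le_right hm0 hT)
  have h3 : A * (√T * Real.log T) / T ≤ A * (m * Real.log T) := by
    rw [mul_div_assoc, mul_div_right_comm]
    gcongr
  have h4 : Real.log T * Real.log T ^ a ≤ Real.log T ^ θ := by
    rw [← Real.rpow_one_add' (by linarith) (by linarith)]
    exact Real.rpow_le_rpow_of_exponent_le hT hθ
  calc (B * (1 / √n) + 2 * (A * (√T * Real.log T) / T)) * Real.log T ^ a
      ≤ (B * (m * Real.log T) + 2 * (A * (m * Real.log T))) * Real.log T ^ a := by gcongr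
    _ = (B + 2 * A) * (m * (Real.log T * Real.log T ^ a)) := by ring
    _ ≤ _ := by gcongr

end Rates

/-! ### Assembly of the main theorem -/

theorem theorem1
    -- the triangular array: sample size `T`, dimension `n T`, fixed number of factors `r`
    {Ω : ℕ → Type*} [∀ T, MeasurableSpace (Ω T)] (P : ∀ T, Measure (Ω T))
    [∀ T, IsProbabilityMeasure (P T)] (r : ℕ) (n : ℕ → ℕ)
    (Λ : ∀ T, Matrix (Fin (n T)) (Fin r) ℝ)
    (f : ∀ T, ℕ → Fin r → Ω T → ℝ) (ε : ∀ T, ℕ → Fin (n T) → Ω T → ℝ)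
    -- change-points and the stationary processes attached to the segments
    (Bχ Bε : ℕ → ℕ) (ηχ ηε : ℕ → ℕ → ℕ)
    (fb : ∀ T, ℕ → ℤ → Fin r → Ω T → ℝ) (εb : ∀ T, ℕ → ℤ → Fin (n T) → Ω T → ℝ)
    -- fixed constants
    (Kf Kε ρf ρε : ℝ) (τχ τε : ℕ) (cf βf lamBar Cε cα β cη κ : ℝ)
    (H : Matrix (Fin r) (Fin r) ℝ)
    (hρf : ρf ∈ Set.Ico (0 : ℝ) 1) (hρε : ρε ∈ Set.Ico (0 : ℝ) 1)
    (hcf : 0 < cf) (hβf : 0 < βf) (hlamBar : 0 < lamBar) (hCε : 0 < Cε) (hcα : 0 < cα)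
    (hβ : 0 < β) (hβfβ : 3 * βf⁻¹ + β⁻¹ > 1) (hcη : cη ∈ Set.Ioo (0 : ℝ) 1) (hκ : 0 < κ)
    -- the model
    (hmodel : ∀ᶠ T in atTop, IsCentredModel (P T) T (f T) (ε T))
    (hηχ : ∀ᶠ T in atTop, IsChangePoints T (Bχ T) (ηχ T))
    (hηε : ∀ᶠ T in atTop, IsChangePoints T (Bε T) (ηε T))
    -- piecewise stationarity
    (h1i : ∀ᶠ T in atTop, ApproxStationary (P T) T (Bχ T) (ηχ T) (f T) (fb T) Kf ρf)
    (h1ii : ∀ᶠ T in atTop,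
      AutocovChanges (P T) (Bχ T) (fun b => commonComp (Λ T) (fb T b)) τχ)
    (h1iii : ∀ᶠ T in atTop, ApproxStationary (P T) T (Bε T) (ηε T) (ε T) (εb T) Kε ρε)
    (h1iv : ∀ᶠ T in atTop, AutocovChanges (P T) (Bε T) (εb T) τε)
    -- factors
    (h2i : ∀ᶠ T in atTop, FactorNormalised (P T) T (f T))
    (h2ii : ∀ᶠ T in atTop, FactorTails (P T) T (f T) cf βf)
    -- loadings
    (hH : H.PosDef) (hHdistinct : Function.Injective hH.isHermitian.eigenvalues)
    (h3i : Tendsto (fun T => (n T : ℝ)⁻¹ • ((Λ T)ᵀ * Λ T)) atTop (𝓝 H))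
    (h3ii : ∀ᶠ T in atTop, ∀ i j, |Λ T i j| < lamBar)
    -- idiosyncratic components
    (h4i : ∀ᶠ T in atTop, IdioBounded (P T) T (ε T) Cε)
    (h4ii : ∀ᶠ T in atTop, IdioGaussian (P T) T (ε T))
    -- independence and mixing
    (h5i : ∀ᶠ T in atTop, FactorIdioIndep (P T) T (f T) (ε T))
    (h5ii : ∀ᶠ T in atTop, ExpMixing (P T) T (f T) (ε T) cα β)
    -- spacing of the change-points
    (h6χ : ∀ᶠ T in atTop, WellSpaced T (Bχ T) (ηχ T) cη)
    (h6ε : ∀ᶠ T in atTop, WellSpaced T (Bε T) (ηε T) cη)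
    -- growth of the dimension
    (h7 : Tendsto n atTop atTop)
    (h7' : (fun T => (n T : ℝ)) =O[atTop] (fun T : ℕ => (T : ℝ) ^ κ))
    -- any choice of ordered normalised eigenvectors of the sample covariance matrix
    (w : ∀ T, Ω T → Fin (n T) → Fin (n T) → ℝ)
    (hw : ∀ T ω, IsOrderedEigenbasis
      (sampleCov T (fun t i => observed (Λ T) (f T) (ε T) t i ω)) (w T ω))
    (θ : ℝ) (hθ : 1 + max βf⁻¹ (1 / 2) ≤ θ) :
    IsBigOp P
      (fun T ω => maxError T
        (fun t => pcaEstimator r (w T ω) (fun i => observed (Λ T) (f T) (ε T) t i ω))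
        (fun t i => commonComp (Λ T) (f T) t i ω))
      (fun T => max (Real.sqrt (Real.log (n T) / T)) (1 / Real.sqrt (n T)) * Real.log T ^ θ) := by
  set a := max βf⁻¹ (1 / 2) with ha
  have ha0 : 0 ≤ a := le_max_of_le_right (by norm_num)
  obtain ⟨c, hc, hΛq⟩ := exists_eventually_mul_le_dotProduct_mulVec hH h3i
  obtain ⟨C, ρ₁, hC, hρ₁, hdet⟩ := exists_pcaEstimator_error_le r hc hlamBar.le
  obtain ⟨K, A, hK, hA, hreg⟩ := exists_eventually_measureReal_not_isRegularSample_le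
    (Λ := Λ) (q := 2 * κ + 1) hcf hβf hlamBar hCε hcα hβ hmodel h2ii h3ii h4i h4ii h5ii
    (h7.eventually_ge_atTop 1) (by linarith)
  have hlogT : Tendsto (fun T : ℕ => Real.log T) atTop atTop :=
    Real.tendsto_log_atTop.comp tendsto_natCast_atTop_atTop
  have hlogn : Tendsto (fun T : ℕ => Real.log (n T)) atTop atTop := hlogT.comp h7
  have hDT : Tendsto (fun T : ℕ => A * (√T * Real.log T) / T) atTop (𝓝 0) := by
    simpa only [mul_div_assoc, mul_zero] using tendsto_sqrt_mul_log_div_atTop.const_mul A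
  have hsqrt : Tendsto (fun T : ℕ => 1 / √(n T : ℝ)) atTop (𝓝 0) := by
    simp only [one_div]
    exact (Real.tendsto_sqrt_atTop.comp
      (tendsto_natCast_atTop_atTop.comp h7)).inv_tendsto_atTop
  have hρ : Tendsto (fun T : ℕ => 2 * (Cε + 1) * (1 / √(n T : ℝ)) +
      2 * (A * (√T * Real.log T) / T)) atTop (𝓝 0) := by
    simpa using (hsqrt.const_mul (2 * (Cε + 1))).add (hDT.const_mul 2)
  intro δ hδ
  -- `C` is the perturbation constant, `2 * K` comes from adding equal bounds for factors and
  -- idiosyncratic parts, and the last factor from the comparison of rates. It does not depend on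
  -- `δ`, since the failure probability tends to zero.
  refine ⟨C * (2 * K) * (2 * (Cε + 1) + 2 * A), by positivity, ?_⟩
  filter_upwards [hmodel, h2i, h3ii, h4i, h4ii, h5i, hΛq, hreg,
    (tendsto_union_bound hκ r h7').eventually_le_const hδ, hlogT.eventually_ge_atTop 1,
    hlogn.eventually_ge_atTop 1, h7.eventually_ge_atTop (max r 1), eventually_gt_atTop 0,
    hρ.eventually_le_const hρ₁,
    hDT.eventually_le_const (show (0 : ℝ) < 1 / (2 * (r + 1)) by positivity)]
    with T hmodel h2i h3ii h4i h4ii h5i hΛq hreg hδT hlT hln hnT hT hρT hDT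
  have hb0 : 0 ≤ K * Real.log T ^ a := by positivity
  have hD0 : 0 ≤ A * (√T * Real.log T) := by positivity
  rw [← ofReal_measureReal]
  -- A large error forces the sample to be irregular; the contrapositive is the deterministic bound.
  refine ENNReal.ofReal_le_ofReal ((measureReal_mono fun ω hω => ?_).trans (hreg.trans hδT))
  intro hω'
  have hbound := hω'.maxError_le (w := w T ω) hT hdet hC hCε hb0 hD0
    ((le_max_left _ _).trans hnT) ((le_max_right _ _).trans hnT) rfl hρT hDT
    (fun i j => (h3ii i j).le) hΛq hmodel h2i h4i h4ii h5i (hw T ω)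
  have hrate := rate_le (a := a) (θ := θ) (A := A) (B := 2 * (Cε + 1)) hlT hln ha0 hθ hA.le
    (by positivity)
  have hnonneg : 0 ≤ maxError T
      (fun t => pcaEstimator r (w T ω) (fun i => observed (Λ T) (f T) (ε T) t i ω))
      (fun t i => commonComp (Λ T) (f T) t i ω) := Real.iSup_nonneg fun p => abs_nonneg _
  have hω₁ := Set.mem_ofPred_eq ▸ hω
  rw [abs_of_nonneg hnonneg] at hω₁
  refine absurd (hbound.trans ?_) (not_le.2 hω₁)
  have := mul_le_mul_of_nonneg_left hrate (show 0 ≤ C * (2 * K) by positivity)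
  linarith
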